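/- Let $K\subset\mathbb R^2$ be a convex body (compact, convex, with non-empty interior) of area $|K|$ whose boundary is a curve of class $C^2$, parametrized by a regular simple closed $C^2$ curve $\gamma$. For boundary points $\boldsymbol x=\gamma(s)$, $\boldsymbol y=\gamma(t)$ at which the tangent directions $\dot{\boldsymbol x}=\gamma'(s)$, $\dot{\boldsymbol y}=\gamma'(t)$ are not parallel, put $\boldsymbol c=\boldsymbol y-\boldsymbol x$ and let $$\|\boldsymbol c\|=2T^{1/3},\qquad T=\frac12\,\frac{\det(\dot{\boldsymbol x},\boldsymbol c)\det(\boldsymbol c,\dot{\boldsymbol y})}{\det(\dot{\boldsymbol x},\dot{\boldsymbol y})},$$ be the signed affine distance of the linear elements $(\boldsymbol x,\dot{\boldsymbol x})$ and $(\boldsymbol y,\dot{\boldsymbol y})$ (real cube root). We say that a set $A$ is homothetic to a set $B$ with ratio $\lambda$ if some dilation with ratio $\lambda$ and some centre maps $A$ onto $B$. Flotation. For $0<\delta<|K|$ and a unit vector $\xi$ let $H_\xi$ be the line orthogonal to $\xi$ for which the part of $K$ lying on the side of $H_\xi$ towards which $\xi$ points (the underwater part) has area $\delta$. The curve of flotation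 $\Pi_\delta(K)$ is the envelope of the lines $H_\xi$, and the curve of buoyancy $\Gamma_\delta(K)$ is the set of centroids of the underwater parts. The chords of flotation are the segments $K\cap H_\xi=[\boldsymbol x,\boldsymbol y]$, labelled so that the underwater arc of $\partial K$ leads counterclockwise from $\boldsymbol x$ to $\boldsymbol y$. Illumination. For $\hat\delta>0$ the curve of illumination $\Pi^{\hat\delta}(K)$ is the set of points $p$ for which the silhouette cone $\operatorname{Conv}(K\cup\{p\})\setminus K$ has area $\hat\delta$, and $\Gamma^{\hat\delta}(K)$ is the set of centroids of these silhouette cones. The corresponding chords are the segments $[\boldsymbol x,\boldsymbol y]$ joining a point of contact of one tangent from some $p\in\Pi^{\hat\delta}(K)$ to $K$ with a point of contact of the other, labelled so that the arc of $\partial K$ facing $p$ leads counterclockwise from $\boldsymbol x$ to $\boldsymbol y$. Then: 1. Let $0<\delta\le|K|/2$ and $\lambda\in\mathbb R$. Then $\lambda>1$ and $\Pi_\delta(K)$ is homothetic to $\Gamma_\delta(K)$ with ratio $\lambda$ if and only if for every chord of flotation $\|\boldsymbol c\|$ is defined (the tangents at its endpoints are not parallel) and $\|\boldsymbol c\|^3=12\delta\lambda$.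 2. Let $\hat\delta>0$ and $\hat\lambda\in\mathbb R$. Then $0<\hat\lambda<1$ and $\Pi^{\hat\delta}(K)$ is homothetic to $\Gamma^{\hat\delta}(K)$ with ratio $\hat\lambda$ if and only if $\|\boldsymbol c\|^3=24\hat\delta\hat\lambda$ for every chord corresponding to $\Pi^{\hat\delta}(K)$. -/

import Mathlib

open MeasureTheory Set

noncomputable section

namespace Flotation

/-- The Euclidean plane. -/
abbrev Plane : Type := EuclideanSpace ℝ (Fin 2)

/-- The determinant of two plane vectors. -/
def det (u v : Plane) : ℝ := u 0 * v 1 - u 1 * v 0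

/-- A planar convex body: a compact convex set with non-empty interior. -/
structure IsConvexBody (K : Set Plane) : Prop where
  convex : Convex ℝ K
  isCompact : IsCompact K
  interior_nonempty : (interior K).Nonempty

/-- `γ` is a regular simple closed curve of class `C²`, given as an `L`-periodic map, that
parametrizes the boundary of `K`. The boundary of a planar convex body is of class `C²`
precisely when such a parametrization exists. -/
structure IsC2BoundaryParam (K : Set Plane) (γ : ℝ → Plane) (L : ℝ) : Prop where
  contDiff : ContDiff ℝ 2 γ
  period_pos : 0 < L
  periodic : Function.Periodic γ L
  regular : ∀ s, deriv γ s ≠ 0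
  simple : InjOn γ (Ico 0 L)
  range_eq : range γ = frontier K

/-! ### Affine distance of linear elements -/

/-- The signed area `T` of the triangle determined by the linear elements `(x, x')`, `(y, y')`
with non-parallel directions `x'`, `y'`. -/
def triangleArea (x x' y y' : Plane) : ℝ :=
  1 / 2 * (det x' (y - x) * det (y - x) y' / det x' y')

/-- The real cube root, as an odd function on the whole real line. -/
def cbrt (a : ℝ) : ℝ := SignType.sign a * |a| ^ (1 / 3 : ℝ)

/-- The signed affine distance `2 T^{1/3}` of two linear elements with non-parallel
directions. -/
def affineDist (x x' y y' : Plane) : ℝ := 2 * cbrt (triangleArea x x' y y')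

/-! ### Homothety -/

/-- Some dilation with ratio `r` maps `A` onto `B`. -/
def IsHomothetic (A B : Set Plane) (r : ℝ) : Prop :=
  ∃ z : Plane, AffineMap.homothety z r '' A = B

/-- The centroid of a plane region of finite positive area. -/
def centroid (D : Set Plane) : Plane := ⨍ x in D, x

/-! ### Flotation -/

/-- The unit vector of polar angle `θ`. -/
def dir (θ : ℝ) : Plane := !₂[Real.cos θ, Real.sin θ]

/-- The underwater part: the part of `K` in the half-plane `⟨x, dir θ⟩ ≥ h`. -/
def underwater (K : Set Plane) (θ h : ℝ) : Set Plane := {x ∈ K | h ≤ inner ℝ x (dir θ)}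

/-- The line `⟨x, dir θ⟩ = h` is the water surface for which the part of `K` on the side of
`dir θ` has area `δ`. -/
def IsWaterSurface (K : Set Plane) (δ θ h : ℝ) : Prop :=
  volume (underwater K θ h) = ENNReal.ofReal δ

/-- The envelope of a one-parameter family of plane curves `F θ = 0`: the set of points
satisfying `F = 0` and `∂F/∂θ = 0` for some value of the parameter. -/
def envelope (F : ℝ → Plane → ℝ) : Set Plane :=
  {p | ∃ θ, F θ p = 0 ∧ HasDerivAt (fun φ => F φ p) 0 θ}

/-- The curve of flotation `Π_δ(K)`: the envelope of the water surfaces. -/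
def flotationCurve (K : Set Plane) (δ : ℝ) : Set Plane :=
  {p | ∃ h : ℝ → ℝ, (∀ θ, IsWaterSurface K δ θ (h θ)) ∧
    p ∈ envelope (fun θ x => inner ℝ x (dir θ) - h θ)}

/-- The curve of buoyancy `Γ_δ(K)`: the locus of the centroids of the underwater parts. -/
def buoyancyCurve (K : Set Plane) (δ : ℝ) : Set Plane :=
  {b | ∃ θ h, IsWaterSurface K δ θ h ∧ b = centroid (underwater K θ h)}

/-- `[x, y]` is a chord of flotation, i.e. the intersection of `K` with a water surface, and
the underwater arc of the boundary leads counterclockwise from `x` to `y`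
(so that `y - x` is `dir θ` turned by a right angle, up to a positive factor). -/
def IsFlotationChord (K : Set Plane) (δ : ℝ) (x y : Plane) : Prop :=
  ∃ θ h, IsWaterSurface K δ θ h ∧ {p ∈ K | inner ℝ p (dir θ) = h} = segment ℝ x y ∧
    0 < det (dir θ) (y - x)

/-! ### Illumination -/

/-- The silhouette cone `Conv(K ∪ {p}) \ K`. -/
def silhouetteCone (K : Set Plane) (p : Plane) : Set Plane := convexHull ℝ (insert p K) \ K

/-- The curve of illumination `Π^δ(K)`: the apexes of the silhouette cones of area `δ`. -/
def illuminationCurve (K : Set Plane) (δ : ℝ) : Set Plane :=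
  {p | volume (silhouetteCone K p) = ENNReal.ofReal δ}

/-- The centroid curve `Γ^δ(K)`: the locus of the centroids of the silhouette cones whose
apexes lie on the curve of illumination. -/
def illuminationCentroidCurve (K : Set Plane) (δ : ℝ) : Set Plane :=
  (fun p => centroid (silhouetteCone K p)) '' illuminationCurve K δ

/-- The tangent lines of the curve `γ` at the parameters `s` and `t` both pass through `p`, so
that `[γ s, γ t]` joins the points of contact of the two tangents from `p`; the last condition
says that the two tangents are different and that the arc of the boundary facing `p` leads
counterclockwise from `γ s` to `γ t`. -/
def IsContactChord (γ : ℝ → Plane) (p : Plane) (s t : ℝ) : Prop :=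
  det (p - γ s) (deriv γ s) = 0 ∧ det (p - γ t) (deriv γ t) = 0 ∧
    0 < det (γ t - p) (γ s - p)

end Flotation

end

/-!
Flotation. The direction of a chord of flotation turns with positive speed as the chord runs around
the body, so the midpoints `p θ` of the chords and the centroids `b θ` of the underwater parts are
parametrized by the angle `θ` of the normal of the water surface. As the underwater area is
constant, both move in the direction of the chord. With `N₁ = det(ẋ, c)`, `N₂ = det(c, ẏ)` and
`d = det(ẋ, ẏ)`, the speeds `r` and `ρ > 0` satisfy `r N₁ N₂ = 3 δ d ρ`
(`IsCcwParam.exists_flotationFamily`), and the midpoints form the envelope of the water surfaces.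
Thus `ρ = λ r` holds identically if and only if `d ≠ 0` and `‖c‖³ = 4 N₁ N₂ / d = 12 δ λ` for all
chords. The former gives a homothety by integration. Conversely, a homothety is a priori one of
point sets; that it respects the parameter `θ` holds because the curve of buoyancy is strictly
convex (`eq_of_range_eq`), which uses `δ ≤ |K| / 2`. Comparison of the widths of the two curves
shows `λ > 1` (`IsFlotationFamily.height_lt`).

Illumination. Let `F q` be the area of the convex hull of `K ∪ {q}`. The curve of illumination is a
level curve of `F`, and the chord `c = y - x` of the points of contact of the tangents from `q`,
turned by a right angle, is a subgradient of `2 F` at `q` (`IsContactPair.le_volume_hull`). Along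
the level curve, the first moment of the hull changes by the displacement of `q` times one third of
the area `T` of the triangle `q, x, y`, to first order
(`IsContactPair.moment_hull_sub_le`), and `‖c‖³ = 8 T`. The claim is therefore that the moment is
an affine function of `q`, with linear part `δ λ`, if and only if always `T = 3 δ λ`.

A homothety makes the moment affine: among the hulls of a given area, the one with apex `q` has its
centroid furthest out in the direction orthogonal to `c` (`IsContactPair.det_moment_hull_lt`, by
comparison of sections), while `q` itself is furthest out among the apexes, so that the homothety
has to match `q` with its own centroid (`IsCcwParam.moment_of_homothetic`). This gives `T = 3 δ λ`
for one choice of the chord from each point of contact (`IsApexFamily.exists_area`). The boundary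
might still contain segments, on which the points of contact could be chosen in several ways. But
the chosen chords define a map `φ` of the boundary that preserves affine arc length, the integral
of the cube root of the curvature. If the rotation that it induces on the affine arc length is of
infinite order, a point of zero curvature has images near points of non-zero curvature, which is
impossible. If the order is finite, an iterate of `φ` fixes all points of non-zero curvature and
so has derivative `1` at the endpoints of a maximal segment, whereas one computes that it stretches
the segment by a factor smaller than this derivative and yet maps the segment onto itself
(`IsContactMap.no_flat`). Hence `K` is strictly convex, and all chords are the chosen ones.

Conversely, if `T = 3 δ λ` for all chords, the same map shows that the curve of illumination is
differentiable, and the expansion of the moment can be integrated (`IsContactMap.moment_sub`).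
Widths show `λ < 1` (`IsApexFamily.exists_det_centroid_lt`).
-/

set_option linter.unusedSectionVars false

noncomputable section

namespace Flotation

/-! ### The determinant -/

lemma det_add_left (a b c : Plane) : det (a + b) c = det a c + det b c := by
  simp only [det, PiLp.add_apply]; ring

lemma det_add_right (a b c : Plane) : det a (b + c) = det a b + det a c := by
  simp only [det, PiLp.add_apply]; ring

lemma det_sub_left (a b c : Plane) : det (a - b) c = det a c - det b c := by
  simp only [det, PiLp.sub_apply]; ring

lemma det_sub_right (a b c : Plane) : det a (b - c) = det a b - det a c := by
  simp only [det, PiLp.sub_apply]; ring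

lemma det_smul_left (r : ℝ) (a b : Plane) : det (r • a) b = r * det a b := by
  simp only [det, PiLp.smul_apply, smul_eq_mul]; ring

lemma det_smul_right (r : ℝ) (a b : Plane) : det a (r • b) = r * det a b := by
  simp only [det, PiLp.smul_apply, smul_eq_mul]; ring

lemma det_neg_left (a b : Plane) : det (-a) b = - det a b := by
  simp only [det, PiLp.neg_apply]; ring

lemma det_neg_right (a b : Plane) : det a (-b) = - det a b := by
  simp only [det, PiLp.neg_apply]; ring

@[simp] lemma det_self (a : Plane) : det a a = 0 := by simp only [det]; ring

@[simp] lemma det_zero_left (a : Plane) : det 0 a = 0 := by simp [det]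

@[simp] lemma det_zero_right (a : Plane) : det a 0 = 0 := by simp [det]

lemma det_swap (a b : Plane) : det a b = - det b a := by simp only [det]; ring

/-- Any vector is a combination of two vectors, with Cramer's coefficients. -/
lemma cramer (a b w : Plane) : det a b • w = det w b • a + det a w • b := by
  ext i; fin_cases i <;> simp [det] <;> ring

lemma ext_plane {a b : Plane} (h0 : a 0 = b 0) (h1 : a 1 = b 1) : a = b := by
  ext i; fin_cases i
  · exact h0
  · exact h1

lemma inner_eq (a b : Plane) : inner ℝ a b = a 0 * b 0 + a 1 * b 1 := by
  simp [PiLp.inner_apply, Fin.sum_univ_two]; ring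

lemma norm_sq_eq (a : Plane) : ‖a‖ ^ 2 = a 0 ^ 2 + a 1 ^ 2 := by
  rw [← real_inner_self_eq_norm_sq, inner_eq]; ring

/-- The Hadamard inequality in the plane. -/
lemma abs_det_le (a b : Plane) : |det a b| ≤ ‖a‖ * ‖b‖ := by
  apply abs_le_of_sq_le_sq _ (by positivity)
  rw [mul_pow, norm_sq_eq, norm_sq_eq, det]
  nlinarith [sq_nonneg (a 0 * b 0 + a 1 * b 1)]

/-- Parallel vectors: if `a ≠ 0` and `det a b = 0` then `b` is a multiple of `a`. -/
lemma exists_smul_of_det_eq_zero {a b : Plane} (ha : a ≠ 0) (h : det a b = 0) :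
    ∃ k : ℝ, b = k • a := by
  have hn : a 0 ^ 2 + a 1 ^ 2 ≠ 0 := by
    rw [← norm_sq_eq]; positivity
  refine ⟨(a 0 * b 0 + a 1 * b 1) / (a 0 ^ 2 + a 1 ^ 2), ext_plane ?_ ?_⟩ <;>
    simp only [PiLp.smul_apply, smul_eq_mul] <;> field_simp <;> simp only [det] at h
  · linear_combination (-(a 1)) * h
  · linear_combination (a 0) * h

/-- The coordinates of a plane vector, as continuous linear functionals. -/
def coordL (i : Fin 2) : Plane →L[ℝ] ℝ := EuclideanSpace.proj i

@[simp] lemma coordL_apply (i : Fin 2) (a : Plane) : coordL i a = a i := rfl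

/-- The functional `w ↦ det a w`. -/
def detL (a : Plane) : Plane →L[ℝ] ℝ := a 0 • coordL 1 - a 1 • coordL 0

@[simp] lemma detL_apply (a w : Plane) : detL a w = det a w := by
  simp [detL, det]

@[fun_prop]
lemma continuous_det {X : Type*} [TopologicalSpace X] {f g : X → Plane} (hf : Continuous f)
    (hg : Continuous g) : Continuous fun x => det (f x) (g x) := by
  unfold det
  have h (i : Fin 2) {k : X → Plane} (hk : Continuous k) : Continuous fun x => k x i :=
    (coordL i).continuous.comp hk
  exact ((h 0 hf).mul (h 1 hg)).sub ((h 1 hf).mul (h 0 hg))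

lemma _root_.HasDerivAt.coord {f : ℝ → Plane} {f' : Plane} {x : ℝ} (hf : HasDerivAt f f' x)
    (i : Fin 2) : HasDerivAt (fun s => f s i) (f' i) x :=
  (coordL i).hasFDerivAt.comp_hasDerivAt x hf

lemma hasDerivAt_det {f g : ℝ → Plane} {f' g' : Plane} {x : ℝ} (hf : HasDerivAt f f' x)
    (hg : HasDerivAt g g' x) :
    HasDerivAt (fun s => det (f s) (g s)) (det f' (g x) + det (f x) g') x := by
  unfold det
  convert! ((hf.coord 0).mul (hg.coord 1)).sub ((hf.coord 1).mul (hg.coord 0)) using 1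
  ring

/-! ### Change of variables in the plane -/

/-- The plane as a product of two lines. -/
def pairL : (ℝ × ℝ) ≃L[ℝ] Plane :=
  (ContinuousLinearEquiv.finTwoArrow ℝ ℝ).symm.trans (EuclideanSpace.equiv (Fin 2) ℝ).symm

@[simp] lemma pairL_apply_zero (z : ℝ × ℝ) : pairL z 0 = z.1 := rfl
@[simp] lemma pairL_apply_one (z : ℝ × ℝ) : pairL z 1 = z.2 := rfl
@[simp] lemma pairL_symm_apply (w : Plane) : pairL.symm w = (w 0, w 1) := rfl

lemma measurePreserving_pairL : MeasurePreserving pairL volume volume :=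
  (PiLp.volume_preserving_toLp (Fin 2)).comp (volume_preserving_finTwoArrow ℝ).symm

instance : Measure.IsAddHaarMeasure volume (G := ℝ × ℝ) :=
  Measure.prod.instIsAddHaarMeasure _ _

lemma setIntegral_pairL {E : Type*} [NormedAddCommGroup E] [NormedSpace ℝ E] (g : Plane → E)
    (D : Set Plane) : ∫ w in D, g w = ∫ z in pairL ⁻¹' D, g (pairL z) :=
  (measurePreserving_pairL.setIntegral_preimage_emb
    pairL.toHomeomorph.measurableEmbedding g D).symm

/-- The change of variables formula for plane regions parametrized by pairs of reals. -/
lemma setIntegral_image_plane {E : Type*} [NormedAddCommGroup E] [NormedSpace ℝ E]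
    {f : ℝ × ℝ → Plane} {f' : ℝ × ℝ → (ℝ × ℝ) →L[ℝ] Plane} {S : Set (ℝ × ℝ)}
    (hS : MeasurableSet S) (hf' : ∀ z ∈ S, HasFDerivAt f (f' z) z) (hf : InjOn f S)
    (g : Plane → E) :
    ∫ w in f '' S, g w = ∫ z in S, |det (f' z (1, 0)) (f' z (0, 1))| • g (f z) := by
  rw [setIntegral_pairL]
  have himg : pairL ⁻¹' (f '' S) = ((pairL.symm : Plane →L[ℝ] ℝ × ℝ) ∘ f) '' S := by
    rw [image_comp]
    exact (pairL.symm.image_eq_preimage_symm _).symm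
  have hd (z) (hz : z ∈ S) := ((pairL.symm : Plane →L[ℝ] ℝ × ℝ).hasFDerivAt.comp z
      (hf' z hz)).hasFDerivWithinAt (s := S)
  rw [himg]
  rw [integral_image_eq_integral_abs_det_fderiv_smul volume hS
    (f' := fun z => (pairL.symm : Plane →L[ℝ] ℝ × ℝ).comp (f' z))
    hd (fun a ha b hb h => hf ha hb (pairL.symm.injective h))
    (fun z => g (pairL z))]
  refine setIntegral_congr_fun hS fun z _ => ?_
  have hdet : ((pairL.symm : Plane →L[ℝ] ℝ × ℝ).comp (f' z)).det =
      det (f' z (1, 0)) (f' z (0, 1)) := by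
    rw [ContinuousLinearMap.det, ← LinearMap.det_toMatrix (Module.Basis.finTwoProd ℝ),
      Matrix.det_fin_two]
    simp [LinearMap.toMatrix_apply, det]
    ring
  rw [hdet]
  congr 2
  exact pairL.apply_symm_apply (f z)

/-- Integration over the region swept by the segments from `O` to the points of a curve `η`,
in the case where each point of the region lies on only one of these segments. -/
lemma setIntegral_cone {E : Type*} [NormedAddCommGroup E] [NormedSpace ℝ E]
    {η η' : ℝ → Plane} (hη : ∀ s, HasDerivAt η (η' s) s) (hη' : Continuous η') (O : Plane)
    {a b : ℝ} (hab : a ≤ b) (hpos : ∀ s ∈ Ioo a b, 0 ≤ det (η s - O) (η' s))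
    (hinj : InjOn (fun z : ℝ × ℝ => O + z.2 • (η z.1 - O)) (Ioo a b ×ˢ Ioo 0 1))
    {g : Plane → E} (hg : Continuous g) :
    ∫ w in (fun z : ℝ × ℝ => O + z.2 • (η z.1 - O)) '' (Ioo a b ×ˢ Ioo 0 1), g w =
      ∫ s in a..b, det (η s - O) (η' s) • ∫ r in (0 : ℝ)..1, r • g (O + r • (η s - O)) := by
  have hηc : Continuous η := continuous_iff_continuousAt.2 fun s => (hη s).continuousAt
  have hd (z : ℝ × ℝ) : HasFDerivAt (fun z : ℝ × ℝ => O + z.2 • (η z.1 - O))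
      (z.2 • (ContinuousLinearMap.fst ℝ ℝ ℝ).smulRight (η' z.1) +
        (ContinuousLinearMap.snd ℝ ℝ ℝ).smulRight (η z.1 - O)) z := by
    have h1 : HasFDerivAt (fun z : ℝ × ℝ => η z.1 - O)
        ((ContinuousLinearMap.fst ℝ ℝ ℝ).smulRight (η' z.1)) z := by
      refine HasFDerivAt.sub_const _ ?_
      convert! (hη z.1).hasFDerivAt.comp z (hasFDerivAt_fst (𝕜 := ℝ) (p := z)) using 1
    exact ((hasFDerivAt_snd (𝕜 := ℝ) (p := z)).smul h1).const_add O
  rw [setIntegral_image_plane (measurableSet_Ioo.prod measurableSet_Ioo) (fun z _ => hd z) hinj]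
  have hcongr : ∀ z ∈ Ioo a b ×ˢ Ioo (0 : ℝ) 1,
      |det ((z.2 • (ContinuousLinearMap.fst ℝ ℝ ℝ).smulRight (η' z.1) +
        (ContinuousLinearMap.snd ℝ ℝ ℝ).smulRight (η z.1 - O)) (1, 0))
        ((z.2 • (ContinuousLinearMap.fst ℝ ℝ ℝ).smulRight (η' z.1) +
        (ContinuousLinearMap.snd ℝ ℝ ℝ).smulRight (η z.1 - O)) (0, 1))| •
          g (O + z.2 • (η z.1 - O)) =
      det (η z.1 - O) (η' z.1) • (z.2 • g (O + z.2 • (η z.1 - O))) := by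
    rintro z ⟨h1, h2⟩
    rw [smul_smul]
    congr 1
    have := hpos z.1 h1
    simp only [add_apply, smul_apply,
      ContinuousLinearMap.smulRight_apply, ContinuousLinearMap.coe_fst',
      ContinuousLinearMap.coe_snd', one_smul, zero_smul, add_zero, smul_zero, zero_add]
    rw [det_smul_left, det_swap, abs_mul, abs_neg, abs_of_nonneg this, abs_of_pos h2.1]
    ring
  rw [setIntegral_congr_fun (measurableSet_Ioo.prod measurableSet_Ioo) hcongr,
    Measure.volume_eq_prod, setIntegral_prod, intervalIntegral.integral_of_le hab,
    integral_Ioc_eq_integral_Ioo]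
  · refine setIntegral_congr_fun measurableSet_Ioo fun s _ => ?_
    simp only
    rw [intervalIntegral.integral_of_le zero_le_one, integral_Ioc_eq_integral_Ioo, integral_smul]
  · rw [← Measure.volume_eq_prod]
    refine (ContinuousOn.integrableOn_compact (isCompact_Icc.prod isCompact_Icc)
      (Continuous.continuousOn ?_)).mono_set (prod_mono Ioo_subset_Icc_self Ioo_subset_Icc_self)
    fun_prop

/-- The area of the region swept by the segments from `O` to the points of a curve. -/
lemma volume_real_cone {η η' : ℝ → Plane} (hη : ∀ s, HasDerivAt η (η' s) s)
    (hη' : Continuous η') (O : Plane) {a b : ℝ} (hab : a ≤ b)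
    (hpos : ∀ s ∈ Ioo a b, 0 ≤ det (η s - O) (η' s))
    (hinj : InjOn (fun z : ℝ × ℝ => O + z.2 • (η z.1 - O)) (Ioo a b ×ˢ Ioo 0 1)) :
    volume.real ((fun z : ℝ × ℝ => O + z.2 • (η z.1 - O)) '' (Ioo a b ×ˢ Ioo 0 1)) =
      1 / 2 * ∫ s in a..b, det (η s - O) (η' s) := by
  have h := setIntegral_cone hη hη' O hab hpos hinj (g := fun _ => (1 : ℝ)) continuous_const
  rw [setIntegral_const] at h
  simp only [smul_eq_mul, mul_one] at h
  rw [h, integral_id, intervalIntegral.integral_mul_const]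
  ring

/-- The first moment of the region swept by the segments from `O` to the points of a curve. -/
lemma moment_cone {η η' : ℝ → Plane} (hη : ∀ s, HasDerivAt η (η' s) s)
    (hη' : Continuous η') (O : Plane) {a b : ℝ} (hab : a ≤ b)
    (hpos : ∀ s ∈ Ioo a b, 0 ≤ det (η s - O) (η' s))
    (hinj : InjOn (fun z : ℝ × ℝ => O + z.2 • (η z.1 - O)) (Ioo a b ×ˢ Ioo 0 1)) :
    ∫ w in (fun z : ℝ × ℝ => O + z.2 • (η z.1 - O)) '' (Ioo a b ×ˢ Ioo 0 1), w =
      ∫ s in a..b, det (η s - O) (η' s) • ((1 / 3 : ℝ) • η s + (1 / 6 : ℝ) • O) := by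
  refine (setIntegral_cone hη hη' O hab hpos hinj continuous_id).trans ?_
  congr 1; ext1 s
  congr 1
  simp only [smul_add, id]
  rw [intervalIntegral.integral_add (Continuous.intervalIntegrable (by fun_prop) _ _)
    (Continuous.intervalIntegrable (by fun_prop) _ _)]
  simp only [smul_smul, ← pow_two]
  rw [intervalIntegral.integral_smul_const, intervalIntegral.integral_smul_const, integral_id,
    integral_pow, smul_sub]
  module

lemma volume_line {v : Plane} (hv : v ≠ 0) (p : Plane) :
    volume {w : Plane | det v (w - p) = 0} = 0 := by
  have h : {w : Plane | det v (w - p) = 0} =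
      (AffineSubspace.mk' p (LinearMap.ker (detL v).toLinearMap) : Set Plane) := by
    ext w
    simp [AffineSubspace.mem_mk']
  rw [h]
  apply Measure.addHaar_affineSubspace
  intro htop
  have h1 : (p + !₂[-v 1, v 0]) ∈ AffineSubspace.mk' p (LinearMap.ker (detL v).toLinearMap) := by
    rw [htop]; trivial
  simp only [AffineSubspace.mem_mk', vsub_eq_sub, add_sub_cancel_left, LinearMap.mem_ker,
    ContinuousLinearMap.coe_coe, detL_apply] at h1
  have h2 : v 0 ^ 2 + v 1 ^ 2 = 0 := by
    simp [det] at h1; linarith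
  rw [← norm_sq_eq] at h2
  exact hv (by simpa using h2)

/-! ### Triangles -/

/-- Points of a positively oriented triangle in barycentric coordinates. -/
lemma mem_triangle_iff {O a b w : Plane} (h : 0 < det (a - O) (b - O)) :
    w ∈ convexHull ℝ {O, a, b} ↔ 0 ≤ det (w - O) (b - O) ∧ 0 ≤ det (a - O) (w - O) ∧
      det (w - O) (b - O) + det (a - O) (w - O) ≤ det (a - O) (b - O) := by
  constructor
  · have hconv : Convex ℝ {w : Plane | 0 ≤ det (w - O) (b - O) ∧ 0 ≤ det (a - O) (w - O) ∧
      det (w - O) (b - O) + det (a - O) (w - O) ≤ det (a - O) (b - O)} := by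
      intro z hz w hw s t hs ht hst
      have e : s • z + t • w - O = s • (z - O) + t • (w - O) := by
        rw [smul_sub, smul_sub]
        nth_rewrite 1 [← one_smul ℝ O]
        rw [← hst]; module
      simp only [mem_ofPred_eq] at hz hw ⊢
      rw [e]
      simp only [det_add_left, det_add_right, det_smul_left, det_smul_right]
      obtain ⟨h1, h2, h3⟩ := hz
      obtain ⟨h4, h5, h6⟩ := hw
      refine ⟨by positivity, by positivity, ?_⟩
      have : det (a - O) (b - O) = s * det (a - O) (b - O) + t * det (a - O) (b - O) := by
        rw [← add_mul, hst, one_mul]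
      rw [this]
      nlinarith [mul_le_mul_of_nonneg_left h3 hs, mul_le_mul_of_nonneg_left h6 ht]
    intro hw
    refine convexHull_min ?_ hconv hw
    rintro z (rfl | rfl | rfl) <;> simp <;> exact h.le
  · rintro ⟨h1, h2, h3⟩
    set D := det (a - O) (b - O)
    have hc := cramer (a - O) (b - O) (w - O)
    have hw : w = (1 - det (w - O) (b - O) / D - det (a - O) (w - O) / D) • O +
        (det (w - O) (b - O) / D) • a + (det (a - O) (w - O) / D) • b := by
      have e : w - O = (det (w - O) (b - O) / D) • (a - O) +
          (det (a - O) (w - O) / D) • (b - O) := by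
        rw [div_eq_inv_mul, div_eq_inv_mul, mul_smul, mul_smul, ← smul_add, ← hc, smul_smul,
          inv_mul_cancel₀ h.ne', one_smul]
      rw [sub_eq_iff_eq_add] at e
      nth_rewrite 1 [e]
      module
    rw [hw]
    have := (convex_convexHull ℝ ({O, a, b} : Set Plane))
    have hm (z) (hz : z ∈ ({O, a, b} : Set Plane)) := subset_convexHull ℝ _ hz
    have h4 := this.sum_mem (t := Finset.univ)
      (w := ![1 - det (w - O) (b - O) / D - det (a - O) (w - O) / D,
        det (w - O) (b - O) / D, det (a - O) (w - O) / D]) (z := ![O, a, b])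
      (by
        intro i _
        fin_cases i
        · simp only [Fin.zero_eta, Matrix.cons_val_zero, sub_sub, ← add_div, sub_nonneg]
          rwa [div_le_one h]
        · exact div_nonneg h1 h.le
        · exact div_nonneg h2 h.le) (by simp [Fin.sum_univ_three]; ring)
      (by intro i _; fin_cases i <;> exact hm _ (by simp))
    simpa [Fin.sum_univ_three] using h4

/-- A triangle is swept by the segments from `O` to the side opposite to it, up to the boundary. -/
lemma triangle_eq_cone {O a b : Plane} (h : 0 < det (a - O) (b - O)) :
    InjOn (fun z : ℝ × ℝ => O + z.2 • ((a + z.1 • (b - a)) - O)) (Ioo 0 1 ×ˢ Ioo 0 1) ∧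
    (convexHull ℝ {O, a, b} : Set Plane) =ᵐ[volume]
      (fun z : ℝ × ℝ => O + z.2 • ((a + z.1 • (b - a)) - O)) '' (Ioo 0 1 ×ˢ Ioo 0 1) := by
  have key (z : ℝ × ℝ) : det (O + z.2 • ((a + z.1 • (b - a)) - O) - O) (b - O) =
      z.2 * (1 - z.1) * det (a - O) (b - O) ∧
      det (a - O) (O + z.2 • ((a + z.1 • (b - a)) - O) - O) =
      z.2 * z.1 * det (a - O) (b - O) := by
    constructor <;> simp [det] <;> ring
  constructor
  · rintro z ⟨-, hz⟩ w ⟨-, hw⟩ hzw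
    simp only at hzw
    have h1 := (key z).1
    have h2 := (key z).2
    rw [hzw, (key w).1] at h1
    rw [hzw, (key w).2] at h2
    have h1' := mul_right_cancel₀ h.ne' h1
    have h2' := mul_right_cancel₀ h.ne' h2
    have e2 : z.2 = w.2 := by linarith
    rw [e2] at h2'
    exact Prod.ext (mul_left_cancel₀ hw.1.ne' h2').symm e2
  · have hb : b - O ≠ 0 := by rintro e; simp [e] at h
    have ha : a - O ≠ 0 := by rintro e; simp [e] at h
    have hab : b - a ≠ 0 := by
      rintro e; rw [sub_eq_zero] at e; simp [e] at h
    have hN : volume ({w : Plane | det (b - O) (w - O) = 0} ∪ {w : Plane | det (a - O) (w - O) = 0} ∪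
        {w : Plane | det (b - a) (w - a) = 0}) = 0 := by
      simp [volume_line, ha, hb, hab]
    rw [ae_eq_set]
    constructor
    · refine measure_mono_null ?_ hN
      rintro w ⟨hw, hw'⟩
      by_contra hcon
      simp only [mem_union, mem_ofPred_eq, not_or] at hcon
      obtain ⟨⟨n1, n2⟩, n3⟩ := hcon
      rw [mem_triangle_iff h] at hw
      obtain ⟨h1, h2, h3⟩ := hw
      have h1' : 0 < det (w - O) (b - O) :=
        lt_of_le_of_ne h1 (fun e => n1 (by rw [det_swap, ← e, neg_zero]))
      have h2' : 0 < det (a - O) (w - O) := lt_of_le_of_ne h2 (Ne.symm n2)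
      have h3' : det (w - O) (b - O) + det (a - O) (w - O) < det (a - O) (b - O) := by
        refine lt_of_le_of_ne h3 (fun e => n3 ?_)
        have : det (b - a) (w - a) =
          det (a - O) (b - O) - (det (w - O) (b - O) + det (a - O) (w - O)) := by
          simp [det]; ring
        rw [this, e, sub_self]
      apply hw'
      set D := det (a - O) (b - O)
      set p := det (w - O) (b - O)
      set q := det (a - O) (w - O)
      have hpq : 0 < p + q := by positivity
      refine ⟨(q / (p + q), (p + q) / D), ⟨⟨by positivity, ?_⟩, ⟨by positivity, ?_⟩⟩, ?_⟩
      · rw [div_lt_one hpq]; linarith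
      · rwa [div_lt_one h]
      · have hc := cramer (a - O) (b - O) (w - O)
        have e : w - O = D⁻¹ • (p • (a - O) + q • (b - O)) := by
          rw [← hc, smul_smul, inv_mul_cancel₀ h.ne', one_smul]
        have : ((p + q) / D) • ((a + (q / (p + q)) • (b - a)) - O) =
            D⁻¹ • (p • (a - O) + q • (b - O)) := by
          have : D ≠ 0 := h.ne'
          match_scalars <;> field_simp <;> ring
        simp only
        rw [this, ← e]; abel
    · convert measure_empty (μ := (volume : Measure Plane)) using 2
      rw [sdiff_eq_empty]
      rintro _ ⟨z, ⟨hz1, hz2⟩, rfl⟩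
      rw [mem_triangle_iff h]
      simp only
      rw [(key z).1, (key z).2]
      have := hz1.1; have := hz1.2; have := hz2.1; have := hz2.2
      have h5 : 0 < 1 - z.1 := by linarith
      refine ⟨by positivity, by positivity, ?_⟩
      nlinarith

lemma triangle_path (a b : Plane) (s : ℝ) :
    HasDerivAt (fun s : ℝ => a + s • (b - a)) (b - a) s := by
  simpa using ((hasDerivAt_id s).smul_const (b - a)).const_add a

lemma volume_real_triangle {O a b : Plane} (h : 0 < det (a - O) (b - O)) :
    volume.real (convexHull ℝ {O, a, b}) = 1 / 2 * det (a - O) (b - O) := by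
  have e (s : ℝ) : det (a + s • (b - a) - O) (b - a) = det (a - O) (b - O) := by
    simp [det]; ring
  rw [measureReal_congr (triangle_eq_cone h).2,
    volume_real_cone (triangle_path a b) continuous_const O zero_le_one
    (fun s _ => by rw [e]; exact h.le) (triangle_eq_cone h).1]
  simp [e]

lemma moment_triangle {O a b : Plane} (h : 0 < det (a - O) (b - O)) :
    ∫ w in convexHull ℝ {O, a, b}, w =
      (1 / 2 * det (a - O) (b - O)) • ((1 / 3 : ℝ) • (O + a + b)) := by
  have e (s : ℝ) : det (a + s • (b - a) - O) (b - a) = det (a - O) (b - O) := by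
    simp [det]; ring
  rw [setIntegral_congr_set (triangle_eq_cone h).2,
    moment_cone (triangle_path a b) continuous_const O zero_le_one
    (fun s _ => by rw [e]; exact h.le) (triangle_eq_cone h).1]
  simp only [e]
  rw [intervalIntegral.integral_smul,
    intervalIntegral.integral_add (Continuous.intervalIntegrable (by fun_prop) _ _)
    (Continuous.intervalIntegrable (by fun_prop) _ _), intervalIntegral.integral_smul,
    intervalIntegral.integral_add (Continuous.intervalIntegrable (by fun_prop) _ _)
    (Continuous.intervalIntegrable (by fun_prop) _ _),
    intervalIntegral.integral_smul_const, integral_id]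
  simp only [intervalIntegral.integral_const, sub_zero, one_smul]
  module

/-! ### Convex bodies bounded by a positively oriented curve -/

/-- A convex body together with a `C²` parametrization of its boundary that runs
counterclockwise: the body lies to the left of all tangents. -/
structure IsCcwParam (K : Set Plane) (γ : ℝ → Plane) (L : ℝ) : Prop where
  body : IsConvexBody K
  param : IsC2BoundaryParam K γ L
  ccw : ∀ s, ∀ w ∈ K, 0 ≤ det (deriv γ s) (w - γ s)

namespace IsConvexBody

variable {K : Set Plane} (hK : IsConvexBody K)
include hK

lemma isClosed : IsClosed K := hK.isCompact.isClosed

lemma closure_interior : closure (interior K) = K := by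
  rw [hK.convex.closure_interior_eq_closure_of_nonempty_interior hK.interior_nonempty,
    hK.isClosed.closure_eq]

lemma frontier_subset : frontier K ⊆ K := hK.isClosed.frontier_subset

lemma combo_interior {x y : Plane} (hx : x ∈ interior K) (hy : y ∈ K) {t : ℝ} (h0 : 0 ≤ t)
    (h1 : t < 1) : x + t • (y - x) ∈ interior K := by
  rcases h0.eq_or_lt with rfl | h0
  · simpa using hx
  · apply hK.convex.openSegment_interior_self_subset_interior hx hy
    rw [openSegment_eq_image']
    exact ⟨t, ⟨h0, h1⟩, rfl⟩

lemma volume_real_pos : 0 < volume.real K := by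
  refine ENNReal.toReal_pos ?_ hK.isCompact.measure_lt_top.ne
  exact ((isOpen_interior.measure_pos volume hK.interior_nonempty).trans_le
    (measure_mono interior_subset)).ne'

/-- A ray from an interior point meets the boundary. -/
lemma exists_exit {O w : Plane} (hO : O ∈ interior K) (hw : w ≠ O) :
    ∃ τ : ℝ, 0 < τ ∧ O + τ • (w - O) ∈ frontier K ∧ (w ∈ interior K → 1 < τ) := by
  have hf : Continuous fun τ : ℝ => O + τ • (w - O) := by fun_prop
  obtain ⟨R, hR⟩ := hK.isCompact.isBounded.subset_ball O
  have hn : 0 < ‖w - O‖ := norm_pos_iff.2 (sub_ne_zero.2 hw)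
  have hS : IsCompact {τ : ℝ | 0 ≤ τ ∧ O + τ • (w - O) ∈ K} := by
    refine Metric.isCompact_of_isClosed_isBounded
      (isClosed_Ici.inter (hK.isClosed.preimage hf)) ?_
    refine (Metric.isBounded_Icc 0 (R / ‖w - O‖)).subset ?_
    rintro τ ⟨h0, h1⟩
    refine ⟨h0, ?_⟩
    have := hR h1
    rw [Metric.mem_ball, dist_eq_norm, add_sub_cancel_left, norm_smul, Real.norm_of_nonneg h0]
      at this
    rw [le_div_iff₀ hn]; exact this.le
  obtain ⟨τ, ⟨h0, h1⟩, hmax⟩ := hS.exists_isMaxOn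
    ⟨0, le_rfl, by simpa using interior_subset hO⟩ continuousOn_id
  have hni : O + τ • (w - O) ∉ interior K := by
    intro hi
    have : {t : ℝ | O + t • (w - O) ∈ interior K} ∈ nhds τ :=
      (isOpen_interior.preimage hf).mem_nhds hi
    obtain ⟨ε, hε, hb⟩ := Metric.mem_nhds_iff.1 this
    have hm : τ + ε / 2 ∈ Metric.ball τ ε := by
      rw [Metric.mem_ball, Real.dist_eq, add_sub_cancel_left, abs_of_pos (by positivity)]; linarith
    have := hmax (a := τ + ε / 2) ⟨by positivity, interior_subset (hb hm)⟩
    simp at this; linarith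
  have hτ : 0 < τ := by
    refine lt_of_le_of_ne h0 ?_
    rintro rfl
    simp at hni; exact hni hO
  refine ⟨τ, hτ, ⟨subset_closure h1, hni⟩, fun hwi => ?_⟩
  have h2 : 1 ≤ τ := hmax (a := (1 : ℝ)) ⟨zero_le_one, by simpa using interior_subset hwi⟩
  refine lt_of_le_of_ne h2 ?_
  rintro rfl
  simp at hni; exact hni hwi

/-- A boundary point has a supporting line, which misses the interior. -/
lemma exists_support {x : Plane} (hx : x ∈ frontier K) :
    ∃ f : Plane →L[ℝ] ℝ, (∀ w ∈ K, f w ≤ f x) ∧ ∀ w ∈ interior K, f w < f x := by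
  obtain ⟨f, hf⟩ := geometric_hahn_banach_open_point hK.convex.interior isOpen_interior hx.2
  refine ⟨f, fun w hw => ?_, hf⟩
  rw [← hK.closure_interior] at hw
  exact closure_minimal (fun w hw => (hf w hw).le) (isClosed_Iic.preimage f.continuous) hw

end IsConvexBody

namespace IsC2BoundaryParam

variable {K : Set Plane} {γ : ℝ → Plane} {L : ℝ} (hγ : IsC2BoundaryParam K γ L)
include hγ

lemma hasDerivAt (s : ℝ) : HasDerivAt γ (deriv γ s) s :=
  (hγ.contDiff.differentiable (by norm_num) s).hasDerivAt

lemma continuous : Continuous γ := hγ.contDiff.continuous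

lemma contDiff_deriv : ContDiff ℝ 1 (deriv γ) :=
  (contDiff_succ_iff_deriv.1 (show ContDiff ℝ (1 + 1) γ from hγ.contDiff)).2.2

lemma hasDerivAt_deriv (s : ℝ) : HasDerivAt (deriv γ) (deriv (deriv γ) s) s :=
  (hγ.contDiff_deriv.differentiable (by norm_num) s).hasDerivAt

lemma continuous_deriv : Continuous (deriv γ) := hγ.contDiff_deriv.continuous

lemma continuous_deriv2 : Continuous (deriv (deriv γ)) :=
  hγ.contDiff_deriv.continuous_deriv le_rfl

lemma deriv_periodic : Function.Periodic (deriv γ) L := by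
  intro s
  rw [← deriv_comp_add_const]
  congr 1
  ext1 x; exact hγ.periodic x

lemma mem_frontier (s : ℝ) : γ s ∈ frontier K := hγ.range_eq ▸ mem_range_self s

lemma exists_param {x : Plane} (hx : x ∈ frontier K) (a : ℝ) : ∃ s ∈ Ico a (a + L), γ s = x := by
  rw [← hγ.range_eq] at hx
  obtain ⟨t, rfl⟩ := hx
  obtain ⟨s, hs, e⟩ := hγ.periodic.exists_mem_Ico hγ.period_pos t a
  exact ⟨s, hs, e.symm⟩

lemma eq_add_of_eq {s t : ℝ} (h : γ s = γ t) : ∃ n : ℤ, t = s + n * L := by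
  have h1 : γ (toIcoMod hγ.period_pos 0 s) = γ (toIcoMod hγ.period_pos 0 t) := by
    simp only [toIcoMod]
    rw [hγ.periodic.sub_zsmul_eq, hγ.periodic.sub_zsmul_eq, h]
  have h2 := hγ.simple (by simpa using toIcoMod_mem_Ico hγ.period_pos 0 s)
    (by simpa using toIcoMod_mem_Ico hγ.period_pos 0 t) h1
  refine ⟨toIcoDiv hγ.period_pos 0 t - toIcoDiv hγ.period_pos 0 s, ?_⟩
  simp only [toIcoMod, zsmul_eq_mul] at h2
  push_cast; linarith

lemma injOn_Ico (a : ℝ) : InjOn γ (Ico a (a + L)) := by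
  intro s hs t ht h
  obtain ⟨n, hn⟩ := hγ.eq_add_of_eq h
  have hL := hγ.period_pos
  have h1 : n < 1 := by
    by_contra hc
    have : (1 : ℝ) ≤ n := by exact_mod_cast not_lt.1 hc
    nlinarith [hs.1, hs.2, ht.1, ht.2]
  have h2 : -1 < n := by
    by_contra hc
    have : (n : ℝ) ≤ -1 := by exact_mod_cast not_lt.1 hc
    nlinarith [hs.1, hs.2, ht.1, ht.2]
  have : n = 0 := by omega
  simp [hn, this]

lemma ne_of_lt {s t : ℝ} (h1 : s < t) (h2 : t < s + L) : γ s ≠ γ t := fun h =>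
  h1.ne (hγ.injOn_Ico s ⟨le_rfl, by linarith [hγ.period_pos]⟩ ⟨h1.le, h2⟩ h)

lemma add_int_mul (s : ℝ) (n : ℤ) : γ (s + n * L) = γ s := hγ.periodic.int_mul n s

lemma deriv_add_int_mul (s : ℝ) (n : ℤ) : deriv γ (s + n * L) = deriv γ s :=
  hγ.deriv_periodic.int_mul n s

/-- A boundary segment is an arc of the boundary: one of the two arcs between the endpoints of
a segment that lies in the boundary runs inside this segment. -/
lemma flat_arc {s t : ℝ} (h1 : s < t) (h2 : t < s + L)
    (hseg : segment ℝ (γ s) (γ t) ⊆ frontier K) :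
    (∀ σ ∈ Icc s t, γ σ ∈ segment ℝ (γ s) (γ t)) ∨
      ∀ σ ∈ Icc t (s + L), γ σ ∈ segment ℝ (γ s) (γ t) := by
  by_contra hcon
  push Not at hcon
  obtain ⟨⟨σ₁, hσ₁, n1⟩, σ₂, hσ₂, n2⟩ := hcon
  have e1 : σ₁ ≠ s := by rintro rfl; exact n1 (left_mem_segment _ _ _)
  have e2 : σ₁ ≠ t := by rintro rfl; exact n1 (right_mem_segment _ _ _)
  have e3 : σ₂ ≠ t := by rintro rfl; exact n2 (right_mem_segment _ _ _)
  have e4 : σ₂ ≠ s + L := by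
    rintro rfl; rw [hγ.periodic] at n2; exact n2 (left_mem_segment _ _ _)
  have l1 := lt_of_le_of_ne hσ₁.1 e1.symm
  have l2 := lt_of_le_of_ne hσ₁.2 e2
  have l3 := lt_of_le_of_ne hσ₂.1 e3.symm
  have l4 := lt_of_le_of_ne hσ₂.2 e4
  have hpre := (convex_segment (𝕜 := ℝ) (γ s) (γ t)).isPreconnected
  rw [isPreconnected_closed_iff] at hpre
  obtain ⟨x, hx, hx1, hx2⟩ := hpre (γ '' Icc σ₁ σ₂) (γ '' Icc σ₂ (σ₁ + L))
    (isCompact_Icc.image hγ.continuous).isClosed (isCompact_Icc.image hγ.continuous).isClosed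
    (by
      intro x hx
      obtain ⟨σ, hσ, rfl⟩ := hγ.exists_param (hseg hx) σ₁
      rcases le_total σ σ₂ with h | h
      · exact Or.inl ⟨σ, ⟨hσ.1, h⟩, rfl⟩
      · exact Or.inr ⟨σ, ⟨h, hσ.2.le⟩, rfl⟩)
    ⟨γ t, right_mem_segment _ _ _, t, ⟨l2.le, l3.le⟩, rfl⟩
    ⟨γ s, left_mem_segment _ _ _, s + L, ⟨l4.le, by linarith⟩, hγ.periodic s⟩
  obtain ⟨σ, hσ, rfl⟩ := hx1
  obtain ⟨τ, hτ, e⟩ := hx2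
  rcases hτ.2.eq_or_lt with rfl | h
  · rw [hγ.periodic] at e
    exact n1 (e ▸ hx)
  · have := hγ.injOn_Ico σ₁ ⟨by linarith [hτ.1], h⟩ ⟨hσ.1, by linarith [hσ.2]⟩ e
    have : σ = σ₂ := le_antisymm hσ.2 (this ▸ hτ.1)
    exact n2 (this ▸ hx)

lemma support_eq {f : Plane →L[ℝ] ℝ} {s : ℝ} (hf : f (deriv γ s) = 0) (w : Plane) :
    f w * ‖deriv γ s‖ ^ 2 = det (deriv γ s) w * f !₂[-(deriv γ s 1), deriv γ s 0] := by
  have h := cramer (deriv γ s) !₂[-(deriv γ s 1), deriv γ s 0] w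
  have h2 := congrArg f h
  rw [map_smul, map_add, map_smul, map_smul, hf] at h2
  have : det (deriv γ s) !₂[-(deriv γ s 1), deriv γ s 0] = ‖deriv γ s‖ ^ 2 := by
    rw [norm_sq_eq]; simp [det]; ring
  rw [this] at h2
  simp only [smul_eq_mul, mul_zero, zero_add] at h2
  linarith

lemma support_deriv {f : Plane →L[ℝ] ℝ} {s : ℝ} (hK : IsConvexBody K)
    (hf : ∀ w ∈ K, f w ≤ f (γ s)) : f (deriv γ s) = 0 := by
  have h1 : HasDerivAt (fun σ => f (γ σ)) (f (deriv γ s)) s :=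
    f.hasFDerivAt.comp_hasDerivAt s (hγ.hasDerivAt s)
  exact IsLocalMax.hasDerivAt_eq_zero
    (Filter.Eventually.of_forall fun σ => hf _ (hK.frontier_subset (hγ.mem_frontier σ))) h1

/-- The parametrization runs either counterclockwise or clockwise. -/
lemma ccw_or_cw (hK : IsConvexBody K) : (∀ s, ∀ w ∈ K, 0 ≤ det (deriv γ s) (w - γ s)) ∨
    ∀ s, ∀ w ∈ K, det (deriv γ s) (w - γ s) ≤ 0 := by
  obtain ⟨O, hO⟩ := hK.interior_nonempty
  have key (s : ℝ) : ∃ k : ℝ, (∀ w ∈ K, 0 ≤ k * det (deriv γ s) (w - γ s)) ∧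
      0 < k * det (deriv γ s) (O - γ s) := by
    obtain ⟨f, hf, hf'⟩ := hK.exists_support (hγ.mem_frontier s)
    have h0 := hγ.support_deriv hK hf
    have hn : 0 < ‖deriv γ s‖ ^ 2 := by have := hγ.regular s; positivity
    refine ⟨-f !₂[-(deriv γ s 1), deriv γ s 0], fun w hw => ?_, ?_⟩
    · have := hγ.support_eq h0 (w - γ s)
      rw [map_sub] at this
      nlinarith [hf w hw]
    · have := hγ.support_eq h0 (O - γ s)
      rw [map_sub] at this
      nlinarith [hf' O hO]
  have hc : Continuous fun s => det (deriv γ s) (O - γ s) := by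
    have := hγ.continuous; have := hγ.continuous_deriv
    fun_prop
  have hne (s : ℝ) : det (deriv γ s) (O - γ s) ≠ 0 := by
    obtain ⟨k, -, h⟩ := key s
    intro e; simp [e] at h
  have hsign : (∀ s, 0 < det (deriv γ s) (O - γ s)) ∨ ∀ s, det (deriv γ s) (O - γ s) < 0 := by
    rcases lt_or_gt_of_ne (hne 0) with h | h
    · right; intro s
      by_contra hs
      obtain ⟨t, ht⟩ := mem_range_of_exists_le_of_exists_ge hc ⟨0, h.le⟩ ⟨s, not_lt.1 hs⟩
      exact hne t ht
    · left; intro s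
      by_contra hs
      obtain ⟨t, ht⟩ := mem_range_of_exists_le_of_exists_ge hc ⟨s, not_lt.1 hs⟩ ⟨0, h.le⟩
      exact hne t ht
  refine hsign.imp (fun h s w hw => ?_) (fun h s w hw => ?_)
  · obtain ⟨k, h1, h2⟩ := key s
    have := pos_of_mul_pos_left h2 (h s).le
    exact nonneg_of_mul_nonneg_right (h1 w hw) this
  · obtain ⟨k, h1, h2⟩ := key s
    have h3 : k < 0 := by
      by_contra hk
      nlinarith [h s, not_lt.1 hk]
    have := h1 w hw
    nlinarith

end IsC2BoundaryParam

namespace IsCcwParam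

variable {K : Set Plane} {γ : ℝ → Plane} {L : ℝ} (h : IsCcwParam K γ L)
include h

lemma mem (s : ℝ) : γ s ∈ K := h.body.frontier_subset (h.param.mem_frontier s)

lemma notMem_interior (s : ℝ) : γ s ∉ interior K := (h.param.mem_frontier s).2

lemma interior_pos {w : Plane} (hw : w ∈ interior K) (s : ℝ) : 0 < det (deriv γ s) (w - γ s) := by
  obtain ⟨f, hf, hf'⟩ := h.body.exists_support (h.param.mem_frontier s)
  have h0 := h.param.support_deriv h.body hf
  refine lt_of_le_of_ne (h.ccw s w (interior_subset hw)) fun e => ?_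
  have := h.param.support_eq h0 (w - γ s)
  rw [← e, zero_mul] at this
  have hn : ‖deriv γ s‖ ^ 2 ≠ 0 := by have := h.param.regular s; positivity
  have h1 := (mul_eq_zero.1 this).resolve_right hn
  rw [map_sub] at h1
  linarith [hf' w hw]

/-- Points of the body on a tangent line are boundary points. -/
lemma mem_frontier_of_det_eq_zero {w : Plane} (hw : w ∈ K) {s : ℝ}
    (h0 : det (deriv γ s) (w - γ s) = 0) : w ∈ frontier K :=
  ⟨subset_closure hw, fun hi => (h.interior_pos hi s).ne' h0⟩

lemma segment_subset_frontier {s : ℝ} {y : Plane} (hy : y ∈ K)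
    (h0 : det (deriv γ s) (y - γ s) = 0) : segment ℝ (γ s) y ⊆ frontier K := by
  intro w hw
  refine h.mem_frontier_of_det_eq_zero (s := s)
    (h.body.convex.segment_subset (h.mem s) hy hw) ?_
  rw [segment_eq_image'] at hw
  obtain ⟨t, -, rfl⟩ := hw
  rw [add_sub_cancel_left, det_smul_right, h0, mul_zero]

/-- The supporting line at a boundary point is unique. -/
lemma support_unique {s : ℝ} {n : Plane} (hn : ∀ w ∈ K, 0 ≤ det n (w - γ s)) :
    det n (deriv γ s) = 0 := by
  have h1 : HasDerivAt (fun σ => det n (γ σ - γ s)) (det 0 (γ s - γ s) + det n (deriv γ s)) s :=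
    hasDerivAt_det (hasDerivAt_const s n) ((h.param.hasDerivAt s).sub_const _)
  have h2 := IsLocalMin.hasDerivAt_eq_zero (Filter.Eventually.of_forall fun σ => by
    simpa using hn _ (h.mem σ)) h1
  simpa using h2

/-! ### Chords through the interior -/

section Chord

variable {s t : ℝ} (h1 : s < t) (h2 : t < s + L) {O : Plane} (hO : O ∈ interior K)
  {τ : ℝ} (hτ : O = γ s + τ • (γ t - γ s)) (hτ0 : 0 < τ) (hτ1 : τ < 1)
include h1 h2 hO hτ hτ0 hτ1

lemma chord_det_left : 0 < det (deriv γ s) (γ t - γ s) := by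
  have := h.interior_pos hO s
  rw [hτ, add_sub_cancel_left, det_smul_right] at this
  exact pos_of_mul_pos_right this hτ0.le

lemma chord_det_right : 0 < det (γ t - γ s) (deriv γ t) := by
  have := h.interior_pos hO t
  have e : O - γ t = (1 - τ) • (γ s - γ t) := by rw [hτ]; module
  rw [e, det_smul_right] at this
  have := pos_of_mul_pos_right this (by linarith)
  rw [det_swap, ← neg_sub, det_neg_left] at this
  simpa using this

/-- A line through an interior point of a convex body meets the body in the chord. -/
lemma mem_segment_of_det_eq_zero {w : Plane} (hw : w ∈ K) (hd : det (γ t - γ s) (w - γ s) = 0) :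
    ∃ r ∈ Icc (0 : ℝ) 1, w = γ s + r • (γ t - γ s) := by
  have hc : γ t - γ s ≠ 0 := sub_ne_zero.2 (h.param.ne_of_lt h1 h2).symm
  obtain ⟨r, hr⟩ := exists_smul_of_det_eq_zero hc hd
  rw [sub_eq_iff_eq_add'] at hr
  refine ⟨r, ⟨?_, ?_⟩, hr⟩
  · by_contra hneg
    push Not at hneg
    have := h.body.combo_interior hO hw (t := τ / (τ - r)) (by apply div_nonneg <;> linarith)
      (by rw [div_lt_one (by linarith)]; linarith)
    apply h.notMem_interior s
    convert this using 1
    rw [hr, hτ]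
    have : τ - r ≠ 0 := by linarith
    match_scalars <;> field_simp <;> ring
  · by_contra hneg
    push Not at hneg
    have := h.body.combo_interior hO hw (t := (1 - τ) / (r - τ)) (by apply div_nonneg <;> linarith)
      (by rw [div_lt_one (by linarith)]; linarith)
    apply h.notMem_interior t
    convert this using 1
    rw [hr, hτ]
    have : r - τ ≠ 0 := by linarith
    match_scalars <;> field_simp <;> ring

lemma chord_det_ne {σ : ℝ} (hσ : σ ∈ Ioo s (s + L)) (hne : σ ≠ t) :
    det (γ t - γ s) (γ σ - γ s) ≠ 0 := by
  intro hd
  obtain ⟨r, ⟨hr0, hr1⟩, hr⟩ := h.mem_segment_of_det_eq_zero h1 h2 hO hτ hτ0 hτ1 (h.mem σ) hd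
  have hI := h.param.injOn_Ico s
  rcases hr0.eq_or_lt with rfl | hr0
  · rw [zero_smul, add_zero] at hr
    exact hσ.1.ne' (hI ⟨hσ.1.le, hσ.2⟩ ⟨le_rfl, by linarith⟩ hr)
  rcases hr1.eq_or_lt with rfl | hr1
  · rw [one_smul, add_sub_cancel] at hr
    exact hne (hI ⟨hσ.1.le, hσ.2⟩ ⟨h1.le, h2⟩ hr)
  apply h.notMem_interior σ
  rcases le_or_gt r τ with hrt | hrt
  · have := h.body.combo_interior hO (h.mem s) (t := (τ - r) / τ)
      (div_nonneg (by linarith) hτ0.le) (by rw [div_lt_one hτ0]; linarith)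
    convert this using 1
    rw [hr, hτ]
    match_scalars <;> field_simp <;> ring
  · have h1τ : 0 < 1 - τ := by linarith
    have := h.body.combo_interior hO (h.mem t) (t := (r - τ) / (1 - τ))
      (div_nonneg (by linarith) h1τ.le) (by rw [div_lt_one h1τ]; linarith)
    convert this using 1
    rw [hr, hτ]
    match_scalars <;> field_simp <;> ring

/-- The arc from `γ s` to `γ t` lies to the right of the chord. -/
lemma arc_neg {σ : ℝ} (hσ : σ ∈ Ioo s t) : det (γ t - γ s) (γ σ - γ s) < 0 := by
  by_contra hcon
  have hcont : Continuous fun σ => det (γ t - γ s) (γ σ - γ s) := by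
    have := h.param.continuous; fun_prop
  have hd : HasDerivAt (fun σ => det (γ t - γ s) (γ σ - γ s))
      (det (γ t - γ s) (deriv γ s)) s := by
    have := hasDerivAt_det (hasDerivAt_const s (γ t - γ s))
      ((h.param.hasDerivAt s).sub_const (γ s))
    simpa using this
  have hneg : det (γ t - γ s) (deriv γ s) < 0 := by
    rw [det_swap]; linarith [h.chord_det_left h1 h2 hO hτ hτ0 hτ1]
  have hev := (hasDerivAt_iff_tendsto_slope.1 hd).eventually (gt_mem_nhds hneg)
  have hev2 : ∀ᶠ σ' in nhdsWithin s (Ioi s), slope (fun σ => det (γ t - γ s) (γ σ - γ s)) s σ' < 0 :=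
    hev.filter_mono (nhdsWithin_mono _ fun x hx => ne_of_gt hx)
  obtain ⟨σ', hs', hσ'⟩ := (hev2.and (Ioo_mem_nhdsGT hσ.1)).exists
  rw [slope_def_field, sub_self, det_zero_right, sub_zero] at hs'
  have hs2 : det (γ t - γ s) (γ σ' - γ s) < 0 := by
    have : 0 < σ' - s := sub_pos.2 hσ'.1
    by_contra hc
    exact absurd (div_nonneg (not_lt.1 hc) this.le) (not_le.2 hs')
  obtain ⟨ρ, hρ, hρ0⟩ := intermediate_value_Icc hσ'.2.le hcont.continuousOn
    ⟨hs2.le, not_lt.1 hcon⟩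
  exact h.chord_det_ne h1 h2 hO hτ hτ0 hτ1 ⟨hσ'.1.trans_le hρ.1, by linarith [hρ.2, hσ.2]⟩
    (by linarith [hρ.2, hσ.2] : ρ < t).ne hρ0

end Chord

/-- The arc from `γ t` to `γ (s + L)` lies to the left of the chord. -/
lemma arc_pos {s t : ℝ} (h1 : s < t) (h2 : t < s + L) {O : Plane} (hO : O ∈ interior K)
    {τ : ℝ} (hτ : O = γ s + τ • (γ t - γ s)) (hτ0 : 0 < τ) (hτ1 : τ < 1) {σ : ℝ}
    (hσ : σ ∈ Ioo t (s + L)) : 0 < det (γ t - γ s) (γ σ - γ s) := by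
  have := h.arc_neg (s := t) (t := s + L) h2 (by linarith) hO (τ := 1 - τ)
    (by rw [h.param.periodic, hτ]; module) (by linarith) (by linarith) hσ
  rw [h.param.periodic] at this
  have e : det (γ t - γ s) (γ σ - γ s) = - det (γ s - γ t) (γ σ - γ t) := by
    simp [det]; ring
  linarith

end IsCcwParam

/-! ### Areas and first moments of the parts cut off by chords -/

/-- The part of `K` to the right of the line from `x` to `y`. -/
def cap (K : Set Plane) (x y : Plane) : Set Plane := {w ∈ K | det (y - x) (w - x) ≤ 0}

/-- The area enclosed by the arc of `γ` from `s` to `t` and its chord, by Green's formula. -/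
def arcArea (γ : ℝ → Plane) (s t : ℝ) : ℝ :=
  1 / 2 * ((∫ σ in s..t, det (γ σ) (deriv γ σ)) + det (γ t) (γ s))

/-- The first moment of the region enclosed by the arc of `γ` from `s` to `t` and its chord, by
Green's formula. -/
def arcMoment (γ : ℝ → Plane) (s t : ℝ) : Plane :=
  (1 / 3 : ℝ) • (∫ σ in s..t, det (γ σ) (deriv γ σ) • γ σ) +
    (1 / 6 * det (γ t) (γ s)) • (γ s + γ t)

namespace IsCcwParam

variable {K : Set Plane} {γ : ℝ → Plane} {L : ℝ} (h : IsCcwParam K γ L)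
include h

section Chord

variable {s t : ℝ} (h1 : s < t) (h2 : t < s + L) {O : Plane} (hO : O ∈ interior K)
  {τ : ℝ} (hτ : O = γ s + τ • (γ t - γ s)) (hτ0 : 0 < τ) (hτ1 : τ < 1)
include h1 h2 hO hτ hτ0 hτ1

omit hτ hτ0 hτ1 h1 in
lemma injOn_cone : InjOn (fun z : ℝ × ℝ => O + z.2 • (γ z.1 - O)) (Ioo s t ×ˢ Ioo 0 1) := by
  have aux (σ σ' r r' : ℝ) (hr : 0 < r) (hr' : 0 < r')
      (e : O + r • (γ σ - O) = O + r' • (γ σ' - O)) : r' ≤ r := by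
    by_contra hlt
    push Not at hlt
    have := h.body.combo_interior hO (h.mem σ) (t := r / r') (by positivity)
      (by rwa [div_lt_one hr'])
    apply h.notMem_interior σ'
    convert this using 1
    have e2 := add_left_cancel e
    have : γ σ' - O = (r / r') • (γ σ - O) := by
      rw [div_eq_inv_mul, mul_smul, e2, smul_smul, inv_mul_cancel₀ hr'.ne', one_smul]
    rw [← this]; abel
  rintro ⟨σ, r⟩ ⟨hσ, hr⟩ ⟨σ', r'⟩ ⟨hσ', hr'⟩ e
  simp only at e hσ hr hσ' hr'
  have er : r = r' := le_antisymm (aux σ' σ r' r hr'.1 hr.1 e.symm) (aux σ σ' r r' hr.1 hr'.1 e)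
  subst er
  have e2 := smul_right_injective _ hr.1.ne' (add_left_cancel e)
  have := h.param.injOn_Ico s ⟨hσ.1.le, by linarith [hσ.2]⟩ ⟨hσ'.1.le, by linarith [hσ'.2]⟩
    (sub_left_injective e2)
  rw [this]

/-- The part of `K` cut off by a chord is, up to a null set, swept by the segments that join an
interior point `O` on the chord to the points of the arc. -/
lemma cap_ae_eq_cone : cap K (γ s) (γ t) =ᵐ[volume]
    (fun z : ℝ × ℝ => O + z.2 • (γ z.1 - O)) '' (Ioo s t ×ˢ Ioo 0 1) := by
  have hc : γ t - γ s ≠ 0 := sub_ne_zero.2 (h.param.ne_of_lt h1 h2).symm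
  have hOd : det (γ t - γ s) (O - γ s) = 0 := by
    rw [hτ, add_sub_cancel_left, det_smul_right, det_self, mul_zero]
  have hdet (r : ℝ) (w : Plane) : det (γ t - γ s) (O + r • (w - O) - γ s) =
      r * det (γ t - γ s) (w - γ s) := by
    have : O + r • (w - O) - γ s = (1 - r) • (O - γ s) + r • (w - γ s) := by module
    rw [this, det_add_right, det_smul_right, det_smul_right, hOd]; ring
  rw [ae_eq_set]
  constructor
  · refine measure_mono_null (t := frontier K ∪ {w | det (γ t - γ s) (w - γ s) = 0}) ?_ ?_
    · rintro w ⟨⟨hwK, hwd⟩, hw⟩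
      by_contra hcon
      rw [mem_union, not_or] at hcon
      have hwi : w ∈ interior K := by
        by_contra hc; exact hcon.1 ⟨subset_closure hwK, hc⟩
      have hwO : w ≠ O := by rintro rfl; exact hcon.2 hOd
      obtain ⟨ρ, hρ0, hρ, hρ1⟩ := h.body.exists_exit hO hwO
      obtain ⟨σ, hσ, e⟩ := h.param.exists_param hρ s
      have hneg : det (γ t - γ s) (γ σ - γ s) < 0 := by
        rw [e, hdet]
        exact mul_neg_of_pos_of_neg hρ0 (lt_of_le_of_ne hwd hcon.2)
      have hσs : s < σ := by
        refine lt_of_le_of_ne hσ.1 ?_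
        rintro rfl; simp at hneg
      have hσt : σ < t := by
        by_contra hc
        rcases (not_lt.1 hc).eq_or_lt with rfl | hc
        · simp at hneg
        · exact absurd (h.arc_pos h1 h2 hO hτ hτ0 hτ1 ⟨hc, hσ.2⟩) hneg.not_gt
      apply hw
      refine ⟨(σ, ρ⁻¹), ⟨⟨hσs, hσt⟩, inv_pos.2 hρ0, inv_lt_one_of_one_lt₀ (hρ1 hwi)⟩, ?_⟩
      simp only [e, add_sub_cancel_left]
      rw [smul_smul, inv_mul_cancel₀ hρ0.ne', one_smul]; abel
    · rw [measure_union_null_iff]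
      exact ⟨h.body.convex.addHaar_frontier volume, volume_line hc _⟩
  · convert measure_empty (μ := (volume : Measure Plane)) using 2
    rw [sdiff_eq_empty]
    rintro _ ⟨⟨σ, r⟩, ⟨hσ, hr⟩, rfl⟩
    refine ⟨interior_subset (h.body.combo_interior hO (h.mem σ) hr.1.le hr.2), ?_⟩
    simp only
    rw [hdet]
    exact mul_nonpos_of_nonneg_of_nonpos hr.1.le (h.arc_neg h1 h2 hO hτ hτ0 hτ1 hσ).le

omit h1 h2 hτ hτ0 hτ1 in
lemma cone_det_nonneg (σ : ℝ) : 0 ≤ det (γ σ - O) (deriv γ σ) := by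
  have := h.interior_pos hO σ
  have e : det (γ σ - O) (deriv γ σ) = det (deriv γ σ) (O - γ σ) := by simp [det]; ring
  rw [e]; exact this.le

lemma volume_real_cap : volume.real (cap K (γ s) (γ t)) = arcArea γ s t := by
  have hγc := h.param.continuous
  have hγ'c := h.param.continuous_deriv
  rw [measureReal_congr (h.cap_ae_eq_cone h1 h2 hO hτ hτ0 hτ1),
    volume_real_cone h.param.hasDerivAt hγ'c O h1.le
      (fun σ _ => h.cone_det_nonneg hO σ) (h.injOn_cone h2 hO), arcArea]
  have e1 : ∫ σ in s..t, det (γ σ - O) (deriv γ σ) =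
      (∫ σ in s..t, det (γ σ) (deriv γ σ)) - ∫ σ in s..t, det O (deriv γ σ) := by
    rw [← intervalIntegral.integral_sub (Continuous.intervalIntegrable (by fun_prop) _ _)
      (Continuous.intervalIntegrable (by fun_prop) _ _)]
    simp only [det_sub_left]
  have e2 : ∫ σ in s..t, det O (deriv γ σ) = det O (γ t) - det O (γ s) := by
    refine intervalIntegral.integral_eq_sub_of_hasDerivAt (f := fun σ => det O (γ σ)) (fun σ _ => ?_)
      (Continuous.intervalIntegrable (by fun_prop) _ _)
    simpa using hasDerivAt_det (hasDerivAt_const σ O) (h.param.hasDerivAt σ)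
  rw [e1, e2, hτ]
  simp [det]; ring

lemma moment_cap : ∫ w in cap K (γ s) (γ t), w = arcMoment γ s t := by
  have hγc := h.param.continuous
  have hγ'c := h.param.continuous_deriv
  rw [setIntegral_congr_set (h.cap_ae_eq_cone h1 h2 hO hτ hτ0 hτ1),
    moment_cone h.param.hasDerivAt hγ'c O h1.le
      (fun σ _ => h.cone_det_nonneg hO σ) (h.injOn_cone h2 hO), arcMoment]
  -- the integrands differ by a derivative, because `O, γ, γ'` are linearly dependent
  have hd (σ : ℝ) : HasDerivAt (fun σ => (1 / 6 * det (γ σ) O) • (γ σ + O))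
      (det (γ σ - O) (deriv γ σ) • ((1 / 3 : ℝ) • γ σ + (1 / 6 : ℝ) • O) -
        (1 / 3 : ℝ) • det (γ σ) (deriv γ σ) • γ σ) σ := by
    have h3 := ((hasDerivAt_det (h.param.hasDerivAt σ) (hasDerivAt_const σ O)).const_mul
      (1 / 6 : ℝ)).smul ((h.param.hasDerivAt σ).add_const O)
    convert! h3 using 1
    apply ext_plane <;> simp [det] <;> ring
  have e1 := intervalIntegral.integral_eq_sub_of_hasDerivAt (fun σ _ => hd σ)
      (Continuous.intervalIntegrable (by fun_prop) s t)
  rw [intervalIntegral.integral_sub (Continuous.intervalIntegrable (by fun_prop) _ _)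
      (Continuous.intervalIntegrable (by fun_prop) _ _), sub_eq_iff_eq_add,
      intervalIntegral.integral_smul] at e1
  rw [e1, add_comm]
  congr 1
  rw [hτ]
  apply ext_plane <;> simp [det] <;> ring

end Chord

end IsCcwParam

/-- If the chord moves such that the area cut off is stationary, then the moment of the part cut off
moves in the direction of the chord. -/
lemma hasDerivAt_arcMoment {γ : ℝ → Plane} (hγ : ∀ s, HasDerivAt γ (deriv γ s) s)
    (hγ' : Continuous (deriv γ)) {φ : ℝ → ℝ} {φ' s : ℝ} (hφ : HasDerivAt φ φ' s)
    (hrel : det (γ (φ s) - γ s) (deriv γ (φ s)) * φ' = det (deriv γ s) (γ (φ s) - γ s)) :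
    HasDerivAt (fun s => arcMoment γ s (φ s))
      ((1 / 6 * det (deriv γ s) (γ (φ s) - γ s)) • (γ (φ s) - γ s)) s := by
  have hγc : Continuous γ := continuous_iff_continuousAt.2 fun s => (hγ s).continuousAt
  have hc : Continuous fun σ => det (γ σ) (deriv γ σ) • γ σ := by fun_prop
  have hF (x : ℝ) : HasDerivAt (fun x => ∫ σ in (0 : ℝ)..x, det (γ σ) (deriv γ σ) • γ σ)
      (det (γ x) (deriv γ x) • γ x) x :=
    intervalIntegral.integral_hasDerivAt_right (hc.intervalIntegrable _ _)
      (hc.stronglyMeasurableAtFilter _ _) hc.continuousAt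
  have e : (fun s => arcMoment γ s (φ s)) = fun s => (1 / 3 : ℝ) • ((∫ σ in (0 : ℝ)..φ s,
      det (γ σ) (deriv γ σ) • γ σ) - ∫ σ in (0 : ℝ)..s, det (γ σ) (deriv γ σ) • γ σ) +
      (1 / 6 * det (γ (φ s)) (γ s)) • (γ s + γ (φ s)) := by
    ext1 s
    rw [arcMoment, intervalIntegral.integral_interval_sub_left (hc.intervalIntegrable _ _)
      (hc.intervalIntegrable _ _)]
  rw [e]
  convert! ((((hF (φ s)).scomp s hφ).sub (hF s)).const_smul (1 / 3 : ℝ)).add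
    (((hasDerivAt_det ((hγ (φ s)).scomp s hφ) (hγ s)).const_mul (1 / 6 : ℝ)).smul
    ((hγ s).add ((hγ (φ s)).scomp s hφ))) using 1
  set x := γ s
  set y := γ (φ s)
  set v := deriv γ s
  set w := deriv γ (φ s)
  simp only [det, PiLp.sub_apply] at hrel
  apply ext_plane <;> simp [det]
  · linear_combination (-(1 / 6) * (x 0 + 2 * y 0)) * hrel
  · linear_combination (-(1 / 6) * (x 1 + 2 * y 1)) * hrel

/-! ### Two facts on implicit functions -/

/-- A continuous function that solves an equation `Q (x, φ x) = const` is differentiable where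
`Q` is differentiable with non-zero second partial derivative. -/
lemma hasDerivAt_of_implicit {Q : ℝ × ℝ → ℝ} {φ : ℝ → ℝ} {s A B : ℝ}
    (hQ : DifferentiableAt ℝ Q (s, φ s)) (hA : HasDerivAt (fun x => Q (x, φ s)) A s)
    (hB : HasDerivAt (fun y => Q (s, y)) B (φ s)) (hB0 : B ≠ 0) (hφ : ContinuousAt φ s)
    (h0 : ∀ x, Q (x, φ x) = Q (s, φ s)) : HasDerivAt φ (-A / B) s := by
  have hQ' := hQ.hasFDerivAt
  set Q' := fderiv ℝ Q (s, φ s)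
  have e1 : Q' (1, 0) = A := by
    have : HasDerivAt (fun x : ℝ => (x, φ s)) (1, 0) s :=
      (hasDerivAt_id s).prodMk (hasDerivAt_const s (φ s))
    exact (hQ'.comp_hasDerivAt s this).unique hA
  have e2 : Q' (0, 1) = B := by
    have : HasDerivAt (fun y : ℝ => (s, y)) (0, 1) (φ s) :=
      (hasDerivAt_const (φ s) s).prodMk (hasDerivAt_id (φ s))
    exact (hQ'.comp_hasDerivAt (φ s) this).unique hB
  have hlin (a b : ℝ) : Q' (a, b) = a * A + b * B := by
    have : ((a, b) : ℝ × ℝ) = a • (1, 0) + b • (0, 1) := by simp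
    rw [this, map_add, map_smul, map_smul, e1, e2]; simp
  have ht : Filter.Tendsto (fun x => (x, φ x)) (nhds s) (nhds (s, φ s)) :=
    (continuousAt_id.prodMk hφ)
  have ho := hQ'.isLittleO.comp_tendsto ht
  have ho1 : (fun x => (x - s) * A + (φ x - φ s) * B) =o[nhds s]
      fun x => (x - s, φ x - φ s) := by
    refine ho.neg_left.congr (fun x => ?_) (fun x => ?_)
    · simp [h0 x, hlin]
    · simp
  have hO : (fun x => φ x - φ s) =O[nhds s] fun x => x - s := by
    have hb := ho1.def (show 0 < |B| / 2 by positivity)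
    rw [Asymptotics.isBigO_iff]
    refine ⟨2 * |A| / |B| + 1, ?_⟩
    filter_upwards [hb] with x hx
    have hBp : 0 < |B| := abs_pos.2 hB0
    simp only [Real.norm_eq_abs, Prod.norm_mk] at hx ⊢
    have h3 : |φ x - φ s| * |B| ≤ |(x - s) * A + (φ x - φ s) * B| + |x - s| * |A| := by
      rw [← abs_mul, ← abs_mul]
      calc |(φ x - φ s) * B| = |((x - s) * A + (φ x - φ s) * B) - (x - s) * A| := by congr 1; ring
        _ ≤ _ := abs_sub _ _
    rw [show (2 * |A| / |B| + 1) * |x - s| = ((2 * |A| + |B|) * |x - s|) / |B| by field_simp,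
      le_div_iff₀ hBp]
    rcases le_total |x - s| |φ x - φ s| with hm | hm
    · rw [max_eq_right hm] at hx
      nlinarith [abs_nonneg (x - s)]
    · rw [max_eq_left hm] at hx
      nlinarith [abs_nonneg (x - s), abs_nonneg A]
  have ho2 : (fun x => (x - s) * A + (φ x - φ s) * B) =o[nhds s] fun x => x - s :=
    ho1.trans_isBigO ((Asymptotics.isBigO_refl _ _).prod_left hO)
  rw [hasDerivAt_iff_isLittleO]
  refine (ho2.const_mul_left B⁻¹).congr_left fun x => ?_
  simp only [smul_eq_mul]
  field_simp
  ring

/-- A real function with closed graph at bounded distance from the identity is continuous. -/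
lemma continuous_of_closed_graph {f : ℝ → ℝ} {C : Set (ℝ × ℝ)} (hC : IsClosed C) {B : ℝ}
    (hf : ∀ s, (s, f s) ∈ C) (huniq : ∀ s t, (s, t) ∈ C → t = f s) (hB : ∀ s, |f s - s| ≤ B) :
    Continuous f := by
  rw [continuous_iff_continuousAt]
  intro s
  apply Filter.tendsto_of_subseq_tendsto
  intro ns hns
  have hbd : Bornology.IsBounded (range fun n => f (ns n)) := by
    obtain ⟨M, hM⟩ := (Metric.isBounded_range_of_tendsto ns hns).exists_norm_le
    rw [isBounded_iff_forall_norm_le]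
    refine ⟨B + M, ?_⟩
    rintro _ ⟨n, rfl⟩
    have h1 := hM _ (mem_range_self n)
    have h2 := hB (ns n)
    rw [Real.norm_eq_abs] at h1 ⊢
    calc |f (ns n)| = |(f (ns n) - ns n) + ns n| := by congr 1; ring
      _ ≤ _ := (abs_add_le _ _).trans (by linarith)
  obtain ⟨a, -, φ, hφ, ha⟩ := tendsto_subseq_of_bounded hbd fun n => mem_range_self n
  refine ⟨φ, ?_⟩
  have h1 : Filter.Tendsto (fun n => (ns (φ n), f (ns (φ n)))) Filter.atTop (nhds (s, a)) :=
    (hns.comp hφ.tendsto_atTop).prodMk_nhds ha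
  have h2 := hC.mem_of_tendsto h1 (Filter.Eventually.of_forall fun n => hf _)
  rw [← huniq s a h2]
  exact ha

/-! ### The chords that cut off a given area -/

section ArcArea

variable {γ : ℝ → Plane} (hγ : ∀ s, HasDerivAt γ (deriv γ s) s) (hγ' : Continuous (deriv γ))
include hγ hγ'

lemma hasDerivAt_primitive (x : ℝ) :
    HasDerivAt (fun x => ∫ σ in (0 : ℝ)..x, det (γ σ) (deriv γ σ)) (det (γ x) (deriv γ x)) x := by
  have hγc : Continuous γ := continuous_iff_continuousAt.2 fun s => (hγ s).continuousAt
  have hc : Continuous fun σ => det (γ σ) (deriv γ σ) := by fun_prop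
  exact intervalIntegral.integral_hasDerivAt_right (hc.intervalIntegrable _ _)
      (hc.stronglyMeasurableAtFilter _ _) hc.continuousAt

lemma arcArea_eq (s t : ℝ) : arcArea γ s t = 1 / 2 * (((∫ σ in (0 : ℝ)..t,
      det (γ σ) (deriv γ σ)) - ∫ σ in (0 : ℝ)..s, det (γ σ) (deriv γ σ)) + det (γ t) (γ s)) := by
  have hγc : Continuous γ := continuous_iff_continuousAt.2 fun s => (hγ s).continuousAt
  have hc : Continuous fun σ => det (γ σ) (deriv γ σ) := by fun_prop
  rw [arcArea, intervalIntegral.integral_interval_sub_left (hc.intervalIntegrable _ _)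
      (hc.intervalIntegrable _ _)]

lemma hasDerivAt_arcArea_right (s t : ℝ) :
    HasDerivAt (fun t => arcArea γ s t) (1 / 2 * det (γ t - γ s) (deriv γ t)) t := by
  simp only [arcArea_eq hγ hγ']
  convert! (((hasDerivAt_primitive hγ hγ' t).sub_const _).add
    (hasDerivAt_det (hγ t) (hasDerivAt_const t (γ s)))).const_mul (1 / 2 : ℝ) using 1
  simp [det]; ring

lemma hasDerivAt_arcArea_left (s t : ℝ) :
    HasDerivAt (fun s => arcArea γ s t) (-(1 / 2 * det (deriv γ s) (γ t - γ s))) s := by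
  simp only [arcArea_eq hγ hγ']
  convert! (((hasDerivAt_primitive hγ hγ' s).const_sub _).add
    (hasDerivAt_det (hasDerivAt_const s (γ t)) (hγ s))).const_mul (1 / 2 : ℝ) using 1
  simp [det]; ring

lemma differentiable_arcArea : Differentiable ℝ fun z : ℝ × ℝ => arcArea γ z.1 z.2 := by
  simp only [arcArea_eq hγ hγ', det]
  have h1 : Differentiable ℝ fun x => ∫ σ in (0 : ℝ)..x, det (γ σ) (deriv γ σ) :=
    fun x => (hasDerivAt_primitive hγ hγ' x).differentiableAt
  have h2 (i : Fin 2) : Differentiable ℝ fun x => γ x i :=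
    fun x => ((hγ x).coord i).differentiableAt
  have h3 := h1.comp (differentiable_fst (𝕜 := ℝ) (E := ℝ) (F := ℝ))
  have h4 := h1.comp (differentiable_snd (𝕜 := ℝ) (E := ℝ) (F := ℝ))
  have h5 (i : Fin 2) := (h2 i).comp (differentiable_fst (𝕜 := ℝ) (E := ℝ) (F := ℝ))
  have h6 (i : Fin 2) := (h2 i).comp (differentiable_snd (𝕜 := ℝ) (E := ℝ) (F := ℝ))
  exact ((h4.sub h3).add (((h6 0).mul (h5 1)).sub ((h6 1).mul (h5 0)))).const_mul _

omit hγ hγ' in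
lemma arcArea_self (s : ℝ) : arcArea γ s s = 0 := by simp [arcArea]

/-- An arc that lies on its chord encloses no area. -/
lemma arcArea_eq_zero {s t : ℝ} (hst : s < t) (hc : γ t - γ s ≠ 0)
    (hflat : ∀ σ ∈ Icc s t, det (γ t - γ s) (γ σ - γ s) = 0) : arcArea γ s t = 0 := by
  obtain ⟨u, hu, e⟩ := exists_hasDerivAt_eq_slope (fun u => arcArea γ s u) _ hst
    (continuous_iff_continuousAt.2 fun u =>
      (hasDerivAt_arcArea_right hγ hγ' s u).continuousAt).continuousOn
    (fun u _ => hasDerivAt_arcArea_right hγ hγ' s u)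
  obtain ⟨k, hk⟩ := exists_smul_of_det_eq_zero hc (hflat u ⟨hu.1.le, hu.2.le⟩)
  have hd : HasDerivAt (fun σ => det (γ t - γ s) (γ σ - γ s)) (det (γ t - γ s) (deriv γ u)) u := by
    simpa using hasDerivAt_det (hasDerivAt_const u (γ t - γ s)) ((hγ u).sub_const (γ s))
  have hz : HasDerivAt (fun σ => det (γ t - γ s) (γ σ - γ s)) 0 u := by
    refine (hasDerivAt_const u (0 : ℝ)).congr_of_eventuallyEq ?_
    filter_upwards [Ioo_mem_nhds hu.1 hu.2] with σ hσ
    exact hflat σ ⟨hσ.1.le, hσ.2.le⟩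
  rw [hk, det_smul_left, hd.unique hz, arcArea_self, eq_div_iff (by linarith)] at e
  linarith

end ArcArea

namespace IsCcwParam

variable {K : Set Plane} {γ : ℝ → Plane} {L : ℝ} (h : IsCcwParam K γ L)
include h

lemma arcArea_add {s t : ℝ} : arcArea γ s t + arcArea γ t (s + L) =
    1 / 2 * ∫ σ in (0 : ℝ)..L, det (γ σ) (deriv γ σ) := by
  have hγc := h.param.continuous
  have hγ'c := h.param.continuous_deriv
  have hc : Continuous fun σ => det (γ σ) (deriv γ σ) := by fun_prop
  have hp : Function.Periodic (fun σ => det (γ σ) (deriv γ σ)) L := fun σ => by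
    simp only [h.param.periodic σ, h.param.deriv_periodic σ]
  have e := hp.intervalIntegral_add_eq 0 s
  rw [zero_add] at e
  rw [e, ← intervalIntegral.integral_add_adjacent_intervals (b := t)
    (hc.intervalIntegrable _ _) (hc.intervalIntegrable _ _), arcArea, arcArea, h.param.periodic,
    det_swap (γ s)]
  ring

/-- The parts cut off on both sides of a chord add up to the body. -/
lemma volume_cap_add {x y : Plane} (hxy : x ≠ y) :
    volume.real (cap K x y) + volume.real (cap K y x) = volume.real K := by
  have hfin (A : Set Plane) (hA : A ⊆ K) : volume A ≠ ⊤ :=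
    ((measure_mono hA).trans_lt h.body.isCompact.measure_lt_top).ne
  have e : cap K x y ∪ cap K y x = K := by
    ext w
    constructor
    · rintro (hw | hw) <;> exact hw.1
    · intro hw
      rcases le_total (det (y - x) (w - x)) 0 with h1 | h1
      · exact Or.inl ⟨hw, h1⟩
      · refine Or.inr ⟨hw, ?_⟩
        have : det (x - y) (w - y) = - det (y - x) (w - x) := by simp [det]; ring
        linarith
  have hm : MeasurableSet (cap K y x) :=
    h.body.isClosed.measurableSet.inter (isClosed_le
      (f := fun w => det (x - y) (w - y)) (by fun_prop) continuous_const).measurableSet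
  have h1 := measureReal_union_add_inter (μ := volume) (s := cap K x y) hm
    (hfin _ fun w hw => hw.1) (hfin _ fun w hw => hw.1)
  have h2 : volume.real (cap K x y ∩ cap K y x) = 0 := by
    rw [Measure.real, measure_mono_null (t := {w | det (y - x) (w - x) = 0}) ?_
      (volume_line (sub_ne_zero.2 hxy.symm) x), ENNReal.toReal_zero]
    rintro w ⟨hw1, hw2⟩
    have : det (x - y) (w - y) = - det (y - x) (w - x) := by simp [det]; ring
    have := hw2.2
    exact le_antisymm hw1.2 (by linarith)
  rw [e, h2] at h1
  linarith

/-- Through each interior point and each boundary point there is a chord. -/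
lemma exists_proper_chord {O : Plane} (hO : O ∈ interior K) (s : ℝ) :
    ∃ t τ : ℝ, s < t ∧ t < s + L ∧ O = γ s + τ • (γ t - γ s) ∧ 0 < τ ∧ τ < 1 := by
  have hne : γ s ≠ O := by rintro e; exact h.notMem_interior s (e ▸ hO)
  obtain ⟨ρ, hρ0, hρ, -⟩ := h.body.exists_exit hO (w := O + (O - γ s))
    (by simpa [sub_eq_zero] using hne.symm)
  obtain ⟨t, ht, e⟩ := h.param.exists_param hρ s
  rw [add_sub_cancel_left] at e
  refine ⟨t, 1 / (1 + ρ), lt_of_le_of_ne ht.1 ?_, ht.2, ?_, by positivity, ?_⟩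
  · rintro rfl
    have : (1 + ρ) • (O - γ s) = 0 := by
      have e' := sub_eq_zero.2 e
      rw [← neg_eq_zero, ← e']; module
    rcases smul_eq_zero.1 this with h1 | h1
    · linarith
    · exact hne (sub_eq_zero.1 h1).symm
  · rw [e]
    have : 1 + ρ ≠ 0 := by positivity
    match_scalars
    · field_simp
    · field_simp; ring
  · rw [div_lt_one (by positivity)]; linarith

lemma arcArea_add_arcArea (s t : ℝ) : arcArea γ s t + arcArea γ t (s + L) = volume.real K := by
  obtain ⟨O, hO⟩ := h.body.interior_nonempty
  obtain ⟨u, τ, h1, h2, hτ, h3, h4⟩ := h.exists_proper_chord hO 0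
  rw [h.arcArea_add, ← h.arcArea_add (s := 0) (t := u), ← h.volume_real_cap h1 h2 hO hτ h3 h4,
    ← h.volume_real_cap (s := u) (t := 0 + L) (τ := 1 - τ) h2 (by linarith) hO
    (by rw [h.param.periodic, hτ]; module) (by linarith) (by linarith), h.param.periodic]
  exact h.volume_cap_add (h.param.ne_of_lt h1 h2)

lemma arcArea_period (s : ℝ) : arcArea γ s (s + L) = volume.real K := by
  rw [← h.arcArea_add_arcArea s s, arcArea_self, zero_add]

/-- A chord that cuts off some but not all of the area runs through the interior. -/
lemma proper_of_arcArea {s t : ℝ} (h1 : s < t) (h2 : t < s + L) (ha0 : 0 < arcArea γ s t)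
    (ha1 : arcArea γ s t < volume.real K) :
    ∃ τ : ℝ, γ s + τ • (γ t - γ s) ∈ interior K ∧ 0 < τ ∧ τ < 1 := by
  have hc : γ t - γ s ≠ 0 := sub_ne_zero.2 (h.param.ne_of_lt h1 h2).symm
  have hcol {w : Plane} (hw : w ∈ segment ℝ (γ s) (γ t)) : det (γ t - γ s) (w - γ s) = 0 := by
    rw [segment_eq_image'] at hw
    obtain ⟨r, -, rfl⟩ := hw
    rw [add_sub_cancel_left, det_smul_right, det_self, mul_zero]
  by_cases hseg : segment ℝ (γ s) (γ t) ⊆ frontier K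
  · exfalso
    rcases h.param.flat_arc h1 h2 hseg with hf | hf
    · exact ha0.ne' (arcArea_eq_zero h.param.hasDerivAt h.param.continuous_deriv h1 hc
        fun σ hσ => hcol (hf σ hσ))
    · have := arcArea_eq_zero h.param.hasDerivAt h.param.continuous_deriv h2
        (by rw [h.param.periodic, ← neg_sub]; exact neg_ne_zero.2 hc) (fun σ hσ => by
          have := hcol (hf σ hσ)
          rw [h.param.periodic]
          simp only [det, PiLp.sub_apply] at this ⊢
          linarith)
      have := h.arcArea_add_arcArea s t
      linarith
  · rw [not_subset] at hseg
    obtain ⟨O, hO, hOf⟩ := hseg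
    have hOK := h.body.convex.segment_subset (h.mem s) (h.mem t) hO
    have hOi : O ∈ interior K := by
      by_contra hcon; exact hOf ⟨subset_closure hOK, hcon⟩
    rw [segment_eq_image'] at hO
    obtain ⟨τ, ⟨hτ0, hτ1⟩, rfl⟩ := hO
    refine ⟨τ, hOi, lt_of_le_of_ne hτ0 ?_, lt_of_le_of_ne hτ1 ?_⟩
    · rintro rfl; simp only [zero_smul, add_zero] at hOi; exact h.notMem_interior s hOi
    · rintro rfl
      simp only [one_smul, add_sub_cancel] at hOi; exact h.notMem_interior t hOi

lemma arcArea_add_period (s t : ℝ) : arcArea γ (s + L) (t + L) = arcArea γ s t := by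
  rw [arcArea, arcArea, h.param.periodic, h.param.periodic,
    ← intervalIntegral.integral_comp_add_right]
  simp only [h.param.periodic _, h.param.deriv_periodic _]

/-- The end point of the chord that starts at `γ s` and cuts off the area `δ` is a differentiable
function of `s`. -/
lemma exists_flotation_map {δ : ℝ} (hδ0 : 0 < δ) (hδ1 : δ < volume.real K) :
    ∃ φ : ℝ → ℝ, (∀ s, s < φ s ∧ φ s < s + L ∧ arcArea γ s (φ s) = δ) ∧
      (∀ s, φ (s + L) = φ s + L) ∧ ∀ s, HasDerivAt φ (det (deriv γ s) (γ (φ s) - γ s) /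
        det (γ (φ s) - γ s) (deriv γ (φ s))) s := by
  have hγd := h.param.hasDerivAt
  have hγ'c := h.param.continuous_deriv
  have hL := h.param.period_pos
  have hcont : Continuous fun z : ℝ × ℝ => arcArea γ z.1 z.2 :=
    (differentiable_arcArea hγd hγ'c).continuous
  have hcr (s : ℝ) : Continuous fun t => arcArea γ s t :=
    hcont.comp (Continuous.prodMk_right s)
  have hex (s : ℝ) : ∃ t, s < t ∧ t < s + L ∧ arcArea γ s t = δ := by
    obtain ⟨t, ht, e⟩ := intermediate_value_Icc (show s ≤ s + L by linarith)
      (hcr s).continuousOn (show δ ∈ Icc (arcArea γ s s) (arcArea γ s (s + L)) by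
        rw [arcArea_self, h.arcArea_period]; exact ⟨hδ0.le, hδ1.le⟩)
    refine ⟨t, lt_of_le_of_ne ht.1 ?_, lt_of_le_of_ne ht.2 ?_, e⟩
    · rintro rfl; simp only [arcArea_self] at e; linarith
    · rintro rfl; simp only [h.arcArea_period] at e; linarith
  -- chords that cut off the area `δ` are transversal to the boundary
  have hright (s t : ℝ) (h1 : s < t) (h2 : t < s + L) (h3 : arcArea γ s t = δ) :
      0 < det (γ t - γ s) (deriv γ t) := by
    obtain ⟨τ, hO, h4, h5⟩ := h.proper_of_arcArea h1 h2 (h3 ▸ hδ0) (h3 ▸ hδ1)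
    exact h.chord_det_right h1 h2 hO rfl h4 h5
  have hmono (s : ℝ) : Monotone fun t => arcArea γ s t := by
    refine monotone_of_deriv_nonneg
      (fun t => (hasDerivAt_arcArea_right hγd hγ'c s t).differentiableAt) fun t => ?_
    rw [(hasDerivAt_arcArea_right hγd hγ'c s t).deriv]
    have := h.ccw t _ (h.mem s)
    have e : det (γ t - γ s) (deriv γ t) = det (deriv γ t) (γ s - γ t) := by simp [det]; ring
    rw [e]; positivity
  -- if two chords from `γ s` cut off the same area, then so do all chords in between, and all of
  -- them are transversal, which makes the area strictly increasing
  have huniq (s t t' : ℝ) (h1 : s < t) (h3 : arcArea γ s t = δ)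
      (h2' : t' < s + L) (h3' : arcArea γ s t' = δ) (hlt : t < t') : False := by
    have hst := strictMonoOn_of_deriv_pos (convex_Icc t t') (hcr s).continuousOn (fun u hu => by
      rw [interior_Icc] at hu
      rw [(hasDerivAt_arcArea_right hγd hγ'c s u).deriv]
      have := hright s u (h1.trans hu.1) (hu.2.trans h2') (le_antisymm
        ((hmono s hu.2.le).trans_eq h3') (h3.symm.le.trans (hmono s hu.1.le)))
      positivity)
    have := hst ⟨le_rfl, hlt.le⟩ ⟨hlt.le, le_rfl⟩ hlt
    simp only [h3, h3', lt_self_iff_false] at this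
  choose φ hφ1 hφ2 hφ3 using hex
  have hφc : Continuous φ := by
    refine continuous_of_closed_graph (C := {z : ℝ × ℝ | z.1 ≤ z.2 ∧ z.2 ≤ z.1 + L ∧
      arcArea γ z.1 z.2 = δ}) ?_ (B := L) (fun s => ⟨(hφ1 s).le, (hφ2 s).le, hφ3 s⟩) ?_ ?_
    · exact (isClosed_le continuous_fst continuous_snd).inter
        ((isClosed_le continuous_snd (by fun_prop)).inter (isClosed_eq hcont continuous_const))
    · rintro s t ⟨h1, h2, h3⟩
      simp only at h1 h2 h3
      have h1' : s < t := by
        refine lt_of_le_of_ne h1 ?_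
        rintro rfl; simp only [arcArea_self] at h3; linarith
      have h2' : t < s + L := by
        refine lt_of_le_of_ne h2 ?_
        rintro rfl; simp only [h.arcArea_period] at h3; linarith
      rcases lt_trichotomy t (φ s) with hlt | he | hlt
      · exact (huniq s t (φ s) h1' h3 (hφ2 s) (hφ3 s) hlt).elim
      · exact he
      · exact (huniq s (φ s) t (hφ1 s) (hφ3 s) h2' h3 hlt).elim
    · intro s
      rw [abs_of_nonneg (by linarith [hφ1 s])]
      linarith [hφ2 s]
  refine ⟨φ, fun s => ⟨hφ1 s, hφ2 s, hφ3 s⟩, fun s => ?_, fun s => ?_⟩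
  · have e := h.arcArea_add_period s (φ s)
    rw [hφ3] at e
    rcases lt_trichotomy (φ (s + L)) (φ s + L) with hlt | he | hlt
    · exact (huniq _ _ _ (hφ1 _) (hφ3 _) (by linarith [hφ2 s]) e hlt).elim
    · exact he
    · exact (huniq _ _ _ (by linarith [hφ1 s]) e (hφ2 _) (hφ3 _) hlt).elim
  have hpos := hright s (φ s) (hφ1 s) (hφ2 s) (hφ3 s)
  have := hasDerivAt_of_implicit (Q := fun z => arcArea γ z.1 z.2) (φ := φ) (s := s)
    (differentiable_arcArea hγd hγ'c _) (hasDerivAt_arcArea_left hγd hγ'c s (φ s))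
    (hasDerivAt_arcArea_right hγd hγ'c s (φ s)) (by positivity) hφc.continuousAt
    (fun x => by rw [hφ3, hφ3])
  convert! this using 1
  field_simp

end IsCcwParam

/-! ### Curves described by the direction of their tangents -/

/-- The unit vector `dir θ` turned counterclockwise by a right angle. -/
def tang (θ : ℝ) : Plane := !₂[-Real.sin θ, Real.cos θ]

lemma hasDerivAt_dir (θ : ℝ) : HasDerivAt dir (tang θ) θ :=
  (pairL : (ℝ × ℝ) →L[ℝ] Plane).hasFDerivAt.comp_hasDerivAt θ
    ((Real.hasDerivAt_cos θ).prodMk (Real.hasDerivAt_sin θ))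

lemma hasDerivAt_tang (θ : ℝ) : HasDerivAt tang (-dir θ) θ := by
  have h := (pairL : (ℝ × ℝ) →L[ℝ] Plane).hasFDerivAt.comp_hasDerivAt θ
    ((Real.hasDerivAt_sin θ).neg.prodMk (Real.hasDerivAt_cos θ))
  convert! h using 1
  apply ext_plane <;> simp [dir]

@[simp] lemma dir_zero (θ : ℝ) : dir θ 0 = Real.cos θ := rfl
@[simp] lemma dir_one (θ : ℝ) : dir θ 1 = Real.sin θ := rfl
@[simp] lemma tang_zero (θ : ℝ) : tang θ 0 = -Real.sin θ := rfl
@[simp] lemma tang_one (θ : ℝ) : tang θ 1 = Real.cos θ := rfl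

lemma dir_add_pi (θ : ℝ) : dir (θ + Real.pi) = -dir θ := by
  apply ext_plane <;> simp

lemma dir_add_two_pi (θ : ℝ) : dir (θ + 2 * Real.pi) = dir θ := by
  apply ext_plane <;> simp

lemma inner_tang_dir (φ θ : ℝ) : inner ℝ (tang φ) (dir θ) = -Real.sin (φ - θ) := by
  rw [inner_eq, Real.sin_sub]; simp; ring

lemma det_tang (θ : ℝ) (w : Plane) : det (tang θ) w = -inner ℝ w (dir θ) := by
  rw [inner_eq]; simp [det]; ring

lemma norm_dir (θ : ℝ) : ‖dir θ‖ = 1 := by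
  have : ‖dir θ‖ ^ 2 = 1 := by rw [norm_sq_eq]; simp
  nlinarith [norm_nonneg (dir θ)]

/-- A plane point is determined by its components along `dir θ` and `tang θ`. -/
lemma eq_of_inner_eq {θ : ℝ} {a b : Plane} (h1 : inner ℝ a (dir θ) = inner ℝ b (dir θ))
    (h2 : inner ℝ a (tang θ) = inner ℝ b (tang θ)) : a = b := by
  simp only [inner_eq, dir_zero, dir_one, tang_zero, tang_one] at h1 h2
  have hcs := Real.sin_sq_add_cos_sq θ
  apply ext_plane
  · linear_combination (Real.cos θ) * h1 - Real.sin θ * h2 - (a 0 - b 0) * hcs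
  · linear_combination (Real.sin θ) * h1 + Real.cos θ * h2 - (a 1 - b 1) * hcs

lemma exists_eq_norm_smul_tang (c : Plane) : ∃ θ : ℝ, c = ‖c‖ • tang θ := by
  have hn : ‖(⟨c 1, -c 0⟩ : ℂ)‖ = ‖c‖ := by
    rw [← sq_eq_sq₀ (norm_nonneg _) (norm_nonneg _), norm_sq_eq, ← Complex.normSq_eq_norm_sq,
      Complex.normSq_mk]; ring
  refine ⟨Complex.arg ⟨c 1, -c 0⟩, ext_plane ?_ ?_⟩
  · have := Complex.norm_mul_sin_arg ⟨c 1, -c 0⟩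
    rw [hn] at this
    simp [this]
  · have := Complex.norm_mul_cos_arg ⟨c 1, -c 0⟩
    rw [hn] at this
    simp [this]

/-- A closed curve of vectors that turns counterclockwise with positive speed may be parametrized
by the direction of the vectors. -/
lemma exists_angle_param {c c' : ℝ → Plane} (hc : ∀ s, HasDerivAt c (c' s) s)
    (hc' : Continuous c') (hpos : ∀ s, 0 < det (c s) (c' s)) {L : ℝ} (hL : 0 < L)
    (hp : Function.Periodic c L) (hp' : Function.Periodic c' L) :
    ∃ S S' : ℝ → ℝ, Function.Surjective S ∧ (∀ θ, HasDerivAt S (S' θ) θ) ∧ (∀ θ, 0 < S' θ) ∧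
      ∀ θ, c (S θ) = ‖c (S θ)‖ • tang θ := by
  have hcc : Continuous c := continuous_iff_continuousAt.2 fun s => (hc s).continuousAt
  have hne (s : ℝ) : c s ≠ 0 := by
    intro e; have := hpos s; simp [e] at this
  have hn (s : ℝ) : 0 < ‖c s‖ ^ 2 := by have := hne s; positivity
  set q : ℝ → ℝ := fun s => det (c s) (c' s) / ‖c s‖ ^ 2 with hq
  have hqpos (s : ℝ) : 0 < q s := div_pos (hpos s) (hn s)
  have hqc : Continuous q := Continuous.div (by fun_prop) (by fun_prop) fun s => (hn s).ne'
  have hqp : Function.Periodic q L := fun s => by simp only [hq, hp s, hp' s]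
  obtain ⟨θ₀, hθ₀⟩ := exists_eq_norm_smul_tang (c 0)
  set Θ : ℝ → ℝ := fun s => θ₀ + ∫ σ in (0 : ℝ)..s, q σ with hΘ
  have hΘd (s : ℝ) : HasDerivAt Θ (q s) s :=
    (intervalIntegral.integral_hasDerivAt_right (hqc.intervalIntegrable _ _)
      (hqc.stronglyMeasurableAtFilter _ _) hqc.continuousAt).const_add θ₀
  have hΘc : Continuous Θ := continuous_iff_continuousAt.2 fun s => (hΘd s).continuousAt
  have hmono : StrictMono Θ := strictMono_of_hasDerivAt_pos hΘd hqpos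
  have hsurj : Function.Surjective Θ := by
    refine hΘc.surjective ?_ ?_
    · exact Filter.tendsto_atTop_add_const_left _ _
        (hqp.tendsto_atTop_intervalIntegral_of_pos' (hqc.intervalIntegrable _ _) hqpos hL)
    · exact Filter.tendsto_atBot_add_const_left _ _
        (hqp.tendsto_atBot_intervalIntegral_of_pos' (hqc.intervalIntegrable _ _) hqpos hL)
  -- the components of `c` in the rotating frame
  set f : ℝ → ℝ := fun s => det (tang (Θ s)) (c s)
  set g : ℝ → ℝ := fun s => det (dir (Θ s)) (c s)
  have hN (s : ℝ) : HasDerivAt (fun s => ‖c s‖ ^ 2) (2 * (c s 0 * c' s 0 + c s 1 * c' s 1)) s := by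
    simp only [norm_sq_eq]
    convert! (((hc s).coord 0).pow 2).add (((hc s).coord 1).pow 2) using 1
    simp; ring
  have hf (s : ℝ) : HasDerivAt f ((c s 0 * c' s 0 + c s 1 * c' s 1) / ‖c s‖ ^ 2 * f s) s := by
    have h1 := hasDerivAt_det ((hasDerivAt_tang (Θ s)).scomp s (hΘd s)) (hc s)
    convert! h1 using 1
    have := (hn s).ne'
    rw [norm_sq_eq] at this
    simp only [hq, f, norm_sq_eq, det_smul_left, det_neg_left]
    field_simp
    simp [det]
    ring
  have hfz (s : ℝ) : f s = 0 := by
    have hd (s : ℝ) : HasDerivAt (fun s => f s ^ 2 / ‖c s‖ ^ 2) 0 s := by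
      convert! ((hf s).pow 2).div (hN s) (hn s).ne' using 1
      have := norm_ne_zero_iff.2 (hne s)
      simp only [Pi.pow_apply]
      field_simp
      push_cast
      ring
    have := is_const_of_deriv_eq_zero (fun s => (hd s).differentiableAt) (fun s => (hd s).deriv) s 0
    have h0 : f 0 = 0 := by
      simp only [f, hΘ, intervalIntegral.integral_same, add_zero]
      rw [hθ₀, det_smul_right, det_self, mul_zero]
    rw [h0] at this
    have h3 := (hn s).ne'
    simpa [hne s] using this
  have hframe (s : ℝ) : c s = g s • tang (Θ s) := by
    have h1 := cramer (dir (Θ s)) (tang (Θ s)) (c s)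
    have e1 : det (dir (Θ s)) (tang (Θ s)) = 1 := by
      simp [det]
      nlinarith [Real.sin_sq_add_cos_sq (Θ s)]
    have e2 : det (c s) (tang (Θ s)) = 0 := by rw [det_swap]; simpa [f] using hfz s
    rw [e1, e2, one_smul, zero_smul, zero_add] at h1
    exact h1
  have hnt (θ : ℝ) : ‖tang θ‖ = 1 := by
    have : ‖tang θ‖ ^ 2 = 1 := by rw [norm_sq_eq]; simp
    nlinarith [norm_nonneg (tang θ)]
  have hgpos (s : ℝ) : 0 < g s := by
    have hdc : Continuous dir := continuous_iff_continuousAt.2 fun θ => (hasDerivAt_dir θ).continuousAt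
    have hgc : Continuous g := continuous_det (hdc.comp hΘc) hcc
    by_contra hs
    have h0 : 0 ≤ g 0 := by
      have : g 0 = ‖c 0‖ := by
        simp only [g, hΘ, intervalIntegral.integral_same, add_zero]
        nth_rewrite 1 [hθ₀]
        rw [det_smul_right, det_swap, det_tang, neg_neg, real_inner_self_eq_norm_sq, norm_dir]
        ring
      rw [this]; positivity
    obtain ⟨t, ht⟩ := mem_range_of_exists_le_of_exists_ge hgc ⟨s, not_lt.1 hs⟩ ⟨0, h0⟩
    apply hne t
    rw [hframe t, ht, zero_smul]
  have hgn (s : ℝ) : g s = ‖c s‖ := by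
    have := congrArg norm (hframe s)
    rw [norm_smul, hnt, mul_one, Real.norm_of_nonneg (hgpos s).le] at this
    exact this.symm
  let e := hmono.orderIsoOfSurjective Θ hsurj
  refine ⟨e.symm, fun θ => (q (e.symm θ))⁻¹, e.symm.surjective, fun θ => ?_,
    fun θ => inv_pos.2 (hqpos _), fun θ => ?_⟩
  · exact HasDerivAt.of_local_left_inverse e.symm.continuous.continuousAt (hΘd _) (hqpos _).ne'
      (Filter.Eventually.of_forall fun y => e.apply_symm_apply y)
  · have h1 := hframe (e.symm θ)
    rw [hgn] at h1
    have h2 : Θ (e.symm θ) = θ := e.apply_symm_apply θ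
    rwa [h2] at h1

/-! ### Recovering a parametrization from its range -/

section Strict

variable {q : ℝ → Plane} {ρ : ℝ → ℝ} (hq : ∀ θ, HasDerivAt q (ρ θ • tang θ) θ)
  (hρ : ∀ θ, 0 < ρ θ) (hq2 : ∀ θ, q (θ + 2 * Real.pi) = q θ)
include hq hρ hq2

/-- A closed curve with tangent direction `tang θ` at `θ` is strictly convex: the functional
`⟨·, dir θ⟩` is maximal exactly at `q θ`. -/
lemma inner_dir_lt {θ φ : ℝ} (h1 : θ < φ) (h2 : φ < θ + 2 * Real.pi) :
    inner ℝ (q φ) (dir θ) < inner ℝ (q θ) (dir θ) := by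
  have hd (φ : ℝ) : HasDerivAt (fun φ => inner ℝ (q φ) (dir θ)) (-(ρ φ * Real.sin (φ - θ))) φ := by
    have := (hq φ).inner ℝ (hasDerivAt_const φ (dir θ))
    convert! this using 1
    rw [inner_zero_right, zero_add, real_inner_smul_left, inner_tang_dir]; ring
  have hc : Continuous fun φ => inner ℝ (q φ) (dir θ) :=
    continuous_iff_continuousAt.2 fun φ => (hd φ).continuousAt
  rcases le_total φ (θ + Real.pi) with hφ | hφ
  · have : StrictAntiOn (fun φ => inner ℝ (q φ) (dir θ)) (Icc θ (θ + Real.pi)) := by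
      refine strictAntiOn_of_deriv_neg (convex_Icc _ _) hc.continuousOn fun φ hφ => ?_
      rw [interior_Icc] at hφ
      rw [(hd φ).deriv]
      have := Real.sin_pos_of_pos_of_lt_pi (x := φ - θ) (by linarith [hφ.1]) (by linarith [hφ.2])
      have := hρ φ
      rw [neg_lt_zero]; positivity
    exact this ⟨le_rfl, by linarith [Real.pi_pos]⟩ ⟨h1.le, hφ⟩ h1
  · have : StrictMonoOn (fun φ => inner ℝ (q φ) (dir θ))
        (Icc (θ + Real.pi) (θ + 2 * Real.pi)) := by
      refine strictMonoOn_of_deriv_pos (convex_Icc _ _) hc.continuousOn fun φ hφ => ?_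
      rw [interior_Icc] at hφ
      rw [(hd φ).deriv]
      have := Real.sin_pos_of_pos_of_lt_pi (x := φ - θ - Real.pi) (by linarith [hφ.1])
        (by linarith [hφ.2])
      rw [Real.sin_sub_pi] at this
      nlinarith [hρ φ]
    have h3 := this ⟨hφ, h2.le⟩ ⟨by linarith [Real.pi_pos], le_rfl⟩ h2
    simpa only [hq2] using h3

lemma add_int_two_pi (θ : ℝ) (n : ℤ) : q (θ + n * (2 * Real.pi)) = q θ :=
  (show Function.Periodic q (2 * Real.pi) from hq2).int_mul n θ

lemma inner_dir_le (θ φ : ℝ) : inner ℝ (q φ) (dir θ) ≤ inner ℝ (q θ) (dir θ) := by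
  obtain ⟨φ', hφ', e⟩ := (show Function.Periodic q (2 * Real.pi) from hq2).exists_mem_Ico
    Real.two_pi_pos φ θ
  rw [e]
  rcases hφ'.1.eq_or_lt with h | h
  · rw [← h]
  · exact (inner_dir_lt hq hρ hq2 h hφ'.2).le

lemma ne_of_lt_two_pi {θ φ : ℝ} (h1 : θ < φ) (h2 : φ < θ + 2 * Real.pi) : q φ ≠ q θ := by
  intro e
  have := inner_dir_lt hq hρ hq2 h1 h2
  rw [e] at this
  exact lt_irrefl _ this

/-- Let `p` and `q` be closed curves with tangents parallel to `tang θ` at `θ`, let `q` be strictly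
convex, and let the lines through the points `p θ` orthogonal to `dir θ` be ordered as water
surfaces of at most half the area are. If the curves have the same range, they agree. -/
theorem eq_of_range_eq {p : ℝ → Plane} {r : ℝ → ℝ} (hp : ∀ θ, HasDerivAt p (r θ • tang θ) θ)
    (h1 : ∀ θ, 0 ≤ inner ℝ (p θ) (dir θ) + inner ℝ (p (θ + Real.pi)) (dir (θ + Real.pi)))
    (h2 : ∀ θ, inner ℝ (p θ) (dir θ) + inner ℝ (p (θ + Real.pi)) (dir (θ + Real.pi)) = 0 →
      ∀ φ, p (φ + Real.pi) = p φ)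
    (hrange : range p = range q) (θ : ℝ) : p θ = q θ := by
  have hpi := Real.pi_pos
  have hpc : Continuous p := continuous_iff_continuousAt.2 fun s => (hp s).continuousAt
  have hqc : Continuous q := continuous_iff_continuousAt.2 fun s => (hq s).continuousAt
  have hpq (θ : ℝ) : ∃ ψ, q ψ = p θ := by
    have : p θ ∈ range q := hrange ▸ mem_range_self θ
    exact this
  have hint (ψ : ℝ) (n : ℤ) : q (ψ + n * Real.pi) = q ψ ∨ q (ψ + n * Real.pi) = q (ψ + Real.pi) := by
    rcases Int.even_or_odd' n with ⟨k, rfl | rfl⟩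
    · left
      rw [← add_int_two_pi hq hρ hq2 ψ k]; congr 1; push_cast; ring
    · right
      rw [← add_int_two_pi hq hρ hq2 (ψ + Real.pi) k]; congr 1; push_cast; ring
  -- a regular point of `p` is the point of `q` with the same or the opposite normal
  have hreg (θ : ℝ) (hr : r θ ≠ 0) : p θ = q θ ∨ p θ = q (θ + Real.pi) := by
    obtain ⟨ψ, hψ⟩ := hpq θ
    -- `⟨p, dir ψ⟩` is maximal at `θ`, so that the tangent `tang θ` there is orthogonal to `dir ψ`
    have hd : HasDerivAt (fun φ => inner ℝ (p φ) (dir ψ)) (-(r θ * Real.sin (θ - ψ))) θ := by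
      have := (hp θ).inner ℝ (hasDerivAt_const θ (dir ψ))
      convert! this using 1
      rw [inner_zero_right, zero_add, real_inner_smul_left, inner_tang_dir]; ring
    have hmax : IsLocalMax (fun φ => inner ℝ (p φ) (dir ψ)) θ :=
      Filter.Eventually.of_forall fun φ => by
        obtain ⟨ψ', hψ'⟩ := hpq φ
        simp only
        rw [← hψ', ← hψ]
        exact inner_dir_le hq hρ hq2 ψ ψ'
    have := hmax.hasDerivAt_eq_zero hd
    rw [neg_eq_zero, mul_eq_zero, or_iff_right hr, Real.sin_eq_zero_iff] at this
    obtain ⟨n, hn⟩ := this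
    rw [← hψ]
    have e : ψ = θ + (-n : ℤ) * Real.pi := by push_cast; linarith
    rw [e]
    exact hint θ (-n)
  set F : Set ℝ := {θ | p θ = q θ} ∪ {θ | p θ = q (θ + Real.pi)} with hF
  have hFc : IsClosed F :=
    (isClosed_eq hpc hqc).union (isClosed_eq hpc (hqc.comp (continuous_add_const Real.pi)))
  have hFuniv (θ : ℝ) : θ ∈ F := by
    by_contra hθ
    obtain ⟨ψ₀, hψ₀⟩ := hpq θ
    -- `p` is constant on an interval of length `π` around `θ`
    obtain ⟨ψ, ⟨n, hn⟩, hψ⟩ : ∃ ψ, (∃ n : ℤ, ψ₀ = ψ + n * Real.pi) ∧ θ ∈ Ico ψ (ψ + Real.pi) := by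
      refine ⟨ψ₀ + toIcoDiv hpi ψ₀ θ * Real.pi, ⟨-toIcoDiv hpi ψ₀ θ, by push_cast; ring⟩, ?_⟩
      have := toIcoMod_mem_Ico hpi ψ₀ θ
      rw [toIcoMod, zsmul_eq_mul] at this
      exact ⟨by linarith [this.1], by linarith [this.2]⟩
    have hP : p θ = q ψ ∨ p θ = q (ψ + Real.pi) := by
      rw [← hψ₀, hn]; exact hint ψ n
    have hnotF (φ : ℝ) (hφ : φ ∈ Ioo ψ (ψ + Real.pi)) (e : p φ = p θ) : φ ∉ F := by
      have hφ1 := hφ.1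
      have hφ2 := hφ.2
      rintro (h3 | h3) <;> rw [mem_ofPred_eq, e] at h3 <;> rcases hP with h4 | h4 <;> rw [h4] at h3
      · exact ne_of_lt_two_pi hq hρ hq2 hφ1 (by linarith) h3.symm
      · exact ne_of_lt_two_pi hq hρ hq2 hφ2 (by linarith) h3
      · exact ne_of_lt_two_pi hq hρ hq2 (θ := ψ) (φ := φ + Real.pi) (by linarith) (by linarith)
          h3.symm
      · exact ne_of_lt_two_pi hq hρ hq2 (θ := ψ + Real.pi) (φ := φ + Real.pi) (by linarith)
          (by linarith) h3.symm
    -- points outside the closed set `F` are not regular, so `p` is locally constant there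
    have hloc (φ : ℝ) (hφ : φ ∈ Ioo ψ (ψ + Real.pi)) (e : p φ = p θ) :
        φ ∈ interior {φ | p φ = p θ} := by
      obtain ⟨ε, hε, hb⟩ := Metric.isOpen_iff.1 hFc.isOpen_compl φ (hnotF φ hφ e)
      rw [mem_interior_iff_mem_nhds, Metric.mem_nhds_iff]
      refine ⟨ε, hε, fun x hx => ?_⟩
      have hz (y : ℝ) (hy : y ∈ Metric.ball φ ε) : HasDerivAt p 0 y := by
        have : r y = 0 := by
          by_contra hr
          exact hb hy (hreg y hr)
        simpa [this] using hp y
      have := (convex_ball φ ε).is_const_of_fderivWithin_eq_zero (𝕜 := ℝ) (f := p)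
        (fun y hy => (hz y hy).differentiableAt.differentiableWithinAt) (fun y hy => by
          rw [fderivWithin_of_isOpen Metric.isOpen_ball hy]
          ext; simp [(hz y hy).deriv]) hx (Metric.mem_ball_self hε)
      simpa [e] using this
    have hθψ : θ ∈ Ioo ψ (ψ + Real.pi) := by
      refine ⟨lt_of_le_of_ne hψ.1 ?_, hψ.2⟩
      rintro rfl
      exact hθ hP
    have hclosed : IsClosed {φ | p φ = p θ} := isClosed_eq hpc continuous_const
    have hsub : Ioo ψ (ψ + Real.pi) ⊆ interior {φ | p φ = p θ} := by
      refine isPreconnected_Ioo.subset_of_closure_inter_subset isOpen_interior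
        ⟨θ, hθψ, hloc θ hθψ rfl⟩ ?_
      rintro φ ⟨hφ1, hφ2⟩
      exact hloc φ hφ2 (closure_minimal interior_subset hclosed hφ1)
    have hIcc : Icc ψ (ψ + Real.pi) ⊆ {φ | p φ = p θ} := by
      rw [← closure_Ioo (by linarith)]
      exact closure_minimal (hsub.trans interior_subset) hclosed
    have e1 : p ψ = p θ := hIcc ⟨le_rfl, by linarith⟩
    have e2 : p (ψ + Real.pi) = p θ := hIcc ⟨by linarith, le_rfl⟩
    have hper : Function.Periodic p Real.pi := h2 ψ (by rw [e1, e2, dir_add_pi, inner_neg_right]; ring)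
    have hconst (φ : ℝ) : p φ = p θ := by
      obtain ⟨φ', hφ', e⟩ := hper.exists_mem_Ico hpi φ ψ
      rw [e]; exact hIcc ⟨hφ'.1, hφ'.2.le⟩
    have hqconst (φ : ℝ) : q φ = p θ := by
      have : q φ ∈ range p := hrange ▸ mem_range_self φ
      obtain ⟨y, hy⟩ := this
      rw [← hy, hconst]
    exact ne_of_lt_two_pi hq hρ hq2 (θ := 0) (φ := Real.pi) hpi (by linarith)
      ((hqconst _).trans (hqconst _).symm)
  -- by connectedness one of the two cases occurs for all `θ`; the second would interchange opposite
  -- supporting lines, against the order `h1` of the water surfaces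
  have hsplit := isPreconnected_closed_iff.1 (isPreconnected_univ (α := ℝ)) {θ | p θ = q θ}
    {θ | p θ = q (θ + Real.pi)} (isClosed_eq hpc hqc)
    (isClosed_eq hpc (hqc.comp (continuous_add_const Real.pi))) (fun θ _ => hFuniv θ)
  by_contra hθ
  have hθ' : p θ = q (θ + Real.pi) := (hFuniv θ).resolve_left hθ
  have hnone : ¬ (univ ∩ {θ | p θ = q θ}).Nonempty := by
    intro hne
    obtain ⟨x, -, hx1, hx2⟩ := hsplit hne ⟨θ, trivial, hθ'⟩
    rw [mem_ofPred_eq] at hx1 hx2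
    exact ne_of_lt_two_pi hq hρ hq2 (θ := x) (φ := x + Real.pi) (by linarith) (by linarith)
      (hx2.symm.trans hx1)
  have hθ'' : p (θ + Real.pi) = q (θ + Real.pi + Real.pi) :=
    (hFuniv _).resolve_left fun hx => hnone ⟨_, trivial, hx⟩
  have h3 := h1 θ
  rw [hθ', hθ'', dir_add_pi, inner_neg_right, add_assoc, ← two_mul, hq2] at h3
  linarith [inner_dir_lt hq hρ hq2 (θ := θ) (φ := θ + Real.pi) (by linarith) (by linarith)]

end Strict

/-! ### Centroids and water surfaces -/

lemma centroid_eq (D : Set Plane) : centroid D = (volume.real D)⁻¹ • ∫ w in D, w := by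
  rw [centroid, setAverage_eq]

/-- The centroid of a region of positive area lies strictly inside each half-plane that contains
the region. -/
lemma lt_det_centroid {K D : Set Plane} (hK : IsCompact K) (hDK : D ⊆ K) (hDm : MeasurableSet D)
    (hD : 0 < volume.real D) {v : Plane} (hv : v ≠ 0) {m : ℝ} (hm : ∀ w ∈ D, m ≤ det v w) :
    m < det v (centroid D) := by
  have hint : IntegrableOn (fun w : Plane => w) D :=
    (continuous_id.continuousOn.integrableOn_compact hK).mono_set hDK
  have hint2 : IntegrableOn (fun w : Plane => det v w) D :=
    ((continuous_det continuous_const continuous_id).continuousOn.integrableOn_compact hK).mono_set hDK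
  have hfin : volume D ≠ ⊤ := ((measure_mono hDK).trans_lt hK.measure_lt_top).ne
  have hfin' : IsFiniteMeasure (volume.restrict D) := ⟨by simpa using hfin.lt_top⟩
  have e1 : det v (∫ w in D, w) = ∫ w in D, det v w := by
    have := (detL v).integral_comp_comm hint
    simpa using this.symm
  have e2 : 0 < ∫ w in D, (det v w - m) := by
    rw [setIntegral_pos_iff_support_of_nonneg_ae]
    · by_contra hcon
      have h0 := nonpos_iff_eq_zero.1 (not_lt.1 hcon)
      obtain ⟨p, hp⟩ : ∃ p : Plane, det v p = m := by
        refine ⟨(m / ‖v‖ ^ 2) • !₂[-v 1, v 0], ?_⟩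
        have hn : ‖v‖ ^ 2 ≠ 0 := by positivity
        rw [det_smul_right, show det v !₂[-v 1, v 0] = ‖v‖ ^ 2 by
          rw [norm_sq_eq]; simp [det]; ring]
        field_simp
      have : volume D = 0 := by
        refine measure_mono_null (fun w hw => ?_) (measure_union_null h0 (volume_line hv p))
        by_cases hw0 : det v w - m = 0
        · exact Or.inr (by rw [mem_ofPred_eq, det_sub_right, hp, hw0])
        · exact Or.inl ⟨hw0, hw⟩
      simp [Measure.real, this] at hD
    · filter_upwards [ae_restrict_mem hDm] with w hw
      simpa using hm w hw
    · exact hint2.sub (integrable_const m)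
  rw [integral_sub hint2 (integrable_const m), setIntegral_const, ← e1, smul_eq_mul] at e2
  rw [centroid_eq, det_smul_right, inv_mul_eq_div, lt_div_iff₀ hD]
  linarith

lemma isClosed_underwater {K : Set Plane} (hK : IsConvexBody K) (θ h : ℝ) :
    IsClosed (underwater K θ h) :=
  hK.isClosed.inter (isClosed_le (f := fun _ : Plane => h) continuous_const
    (g := fun x : Plane => inner ℝ x (dir θ)) (by fun_prop))

namespace IsConvexBody

variable {K : Set Plane} (hK : IsConvexBody K)
include hK

/-- Between two different water surfaces of the same direction there would be a strip without
interior points of `K`, with interior points on both sides of it. -/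
lemma water_not_lt {δ : ℝ} (hδ0 : 0 < δ) (hδ1 : δ < volume.real K) {θ h₁ h₂ : ℝ}
    (w1 : IsWaterSurface K δ θ h₁) (w2 : IsWaterSurface K δ θ h₂) : ¬ h₁ < h₂ := by
  intro hlt
  have hcont : Continuous fun w : Plane => inner ℝ w (dir θ) := by fun_prop
  have hsub : underwater K θ h₂ ⊆ underwater K θ h₁ := fun w hw => ⟨hw.1, hlt.le.trans hw.2⟩
  have hdiff : volume (underwater K θ h₁ \ underwater K θ h₂) = 0 := by
    rw [measure_sdiff hsub (isClosed_underwater hK θ h₂).nullMeasurableSet, w1, w2, tsub_self]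
    rw [w2]; exact ENNReal.ofReal_ne_top
  have hU : ∀ w ∈ interior K, ¬ (h₁ < inner ℝ w (dir θ) ∧ inner ℝ w (dir θ) < h₂) := by
    intro w hw hw'
    have ho : IsOpen (interior K ∩ {w | h₁ < inner ℝ w (dir θ) ∧ inner ℝ w (dir θ) < h₂}) :=
      isOpen_interior.inter ((isOpen_lt continuous_const hcont).inter
        (isOpen_lt hcont continuous_const))
    refine (ho.measure_pos volume ⟨w, hw, hw'⟩).ne' (measure_mono_null ?_ hdiff)
    rintro x ⟨hx, hx1, hx2⟩
    exact ⟨⟨interior_subset hx, hx1.le⟩, fun hx3 => hx2.not_ge hx3.2⟩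
  obtain ⟨a, ha, ha'⟩ : ∃ a ∈ interior K, inner ℝ a (dir θ) ≤ h₁ := by
    by_contra hcon
    push Not at hcon
    have hall : K ⊆ underwater K θ h₂ := by
      intro w hw
      refine ⟨hw, ?_⟩
      rw [← hK.closure_interior] at hw
      refine closure_minimal (fun w hw => ?_) (isClosed_le continuous_const hcont) hw
      by_contra hc
      exact hU w hw ⟨hcon w hw, not_le.1 hc⟩
    have : volume.real K ≤ δ := by
      have := measureReal_mono (μ := volume) hall (by rw [w2]; exact ENNReal.ofReal_ne_top)
      rwa [Measure.real, Measure.real, w2, ENNReal.toReal_ofReal hδ0.le] at this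
    linarith
  obtain ⟨b, hb, hb'⟩ : ∃ b ∈ interior K, h₂ ≤ inner ℝ b (dir θ) := by
    by_contra hcon
    push Not at hcon
    have hall (w : Plane) (hw : w ∈ K) : inner ℝ w (dir θ) ≤ h₁ := by
      rw [← hK.closure_interior] at hw
      refine closure_minimal (fun w hw => ?_) (isClosed_le hcont continuous_const) hw
      by_contra hc
      exact hU w hw ⟨not_le.1 hc, hcon w hw⟩
    have : underwater K θ h₂ = ∅ := by
      ext w
      simp only [underwater, mem_ofPred_eq, mem_empty_iff_false, iff_false, not_and, not_le]
      intro hw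
      linarith [hall w hw]
    rw [IsWaterSurface, this, measure_empty] at w2
    exact hδ0.not_ge (ENNReal.ofReal_eq_zero.1 w2.symm)
  obtain ⟨c, hc, hc'⟩ := (hK.convex.interior.isPreconnected.image _ hcont.continuousOn).Icc_subset
    (mem_image_of_mem _ ha) (mem_image_of_mem _ hb)
    (show (h₁ + h₂) / 2 ∈ Icc _ _ from ⟨by linarith, by linarith⟩)
  simp only at hc'
  exact hU c hc (by rw [hc']; constructor <;> linarith)

/-- The water surface of a given direction is unique. -/
lemma water_unique {δ : ℝ} (hδ0 : 0 < δ) (hδ1 : δ < volume.real K) {θ h₁ h₂ : ℝ}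
    (w1 : IsWaterSurface K δ θ h₁) (w2 : IsWaterSurface K δ θ h₂) : h₁ = h₂ :=
  le_antisymm (not_lt.1 (hK.water_not_lt hδ0 hδ1 w2 w1))
    (not_lt.1 (hK.water_not_lt hδ0 hδ1 w1 w2))

lemma underwater_add (θ h : ℝ) :
    volume.real (underwater K θ h) + volume.real (underwater K (θ + Real.pi) (-h)) =
      volume.real K := by
  have hfin (A : Set Plane) (hA : A ⊆ K) : volume A ≠ ⊤ :=
    ((measure_mono hA).trans_lt hK.isCompact.measure_lt_top).ne
  have hmem (w : Plane) : w ∈ underwater K (θ + Real.pi) (-h) ↔ w ∈ K ∧ inner ℝ w (dir θ) ≤ h := by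
    simp only [underwater, mem_ofPred_eq, dir_add_pi, inner_neg_right, neg_le_neg_iff]
  have e : underwater K θ h ∪ underwater K (θ + Real.pi) (-h) = K := by
    ext w
    rw [mem_union, hmem]
    constructor
    · rintro (hw | hw) <;> exact hw.1
    · intro hw
      rcases le_total h (inner ℝ w (dir θ)) with h1 | h1
      · exact Or.inl ⟨hw, h1⟩
      · exact Or.inr ⟨hw, h1⟩
  have h1 := measureReal_union_add_inter (μ := volume) (s := underwater K θ h)
    (isClosed_underwater hK (θ + Real.pi) (-h)).measurableSet
    (hfin _ fun w hw => hw.1) (hfin _ fun w hw => hw.1)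
  have ht : tang θ ≠ 0 := by
    intro e
    have := det_tang θ (dir θ)
    rw [e, det_zero_left, real_inner_self_eq_norm_sq, norm_dir] at this
    norm_num at this
  have h2 : volume.real (underwater K θ h ∩ underwater K (θ + Real.pi) (-h)) = 0 := by
    rw [Measure.real, measure_mono_null (t := {w | det (tang θ) (w - h • dir θ) = 0}) ?_
      (volume_line ht _), ENNReal.toReal_zero]
    rintro w ⟨hw1, hw2⟩
    have := ((hmem w).1 hw2).2
    have := hw1.2
    rw [mem_ofPred_eq, det_tang, inner_sub_left, real_inner_smul_left, real_inner_self_eq_norm_sq,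
      norm_dir]
    linarith
  rw [e, h2] at h1
  linarith

/-- Opposite water surfaces for at most half the area: the underwater parts do not overlap, and
they touch only if they are complementary. -/
lemma water_opposite {δ : ℝ} (hδ0 : 0 < δ) (hδ1 : δ ≤ volume.real K / 2) {θ h₁ h₂ : ℝ}
    (w1 : IsWaterSurface K δ θ h₁) (w2 : IsWaterSurface K δ (θ + Real.pi) h₂) :
    0 ≤ h₁ + h₂ ∧ (h₁ + h₂ = 0 → δ = volume.real K / 2) := by
  have hV := hK.volume_real_pos
  have hw {θ h : ℝ} (w : IsWaterSurface K δ θ h) : volume.real (underwater K θ h) = δ := by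
    rw [Measure.real, w, ENNReal.toReal_ofReal hδ0.le]
  have hfin {θ h : ℝ} : volume (underwater K θ h) ≠ ⊤ :=
    ((measure_mono fun w hw => hw.1).trans_lt hK.isCompact.measure_lt_top).ne
  constructor
  · by_contra hcon
    have h3 := hK.underwater_add θ (-h₂)
    rw [neg_neg, hw w2] at h3
    have h4 : volume.real (underwater K θ (-h₂)) ≤ δ := by
      rw [← hw w1]
      exact measureReal_mono (fun w hw => ⟨hw.1, by linarith [hw.2]⟩) hfin
    have h5 : volume.real (underwater K θ (-h₂)) = δ := by linarith
    have h6 : IsWaterSurface K δ θ (-h₂) := by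
      rw [IsWaterSurface, ← h5, Measure.real, ENNReal.ofReal_toReal hfin]
    have := hK.water_unique hδ0 (by linarith) w1 h6
    linarith
  · intro h0
    have h3 := hK.underwater_add θ h₁
    rw [show -h₁ = h₂ by linarith, hw w1, hw w2] at h3
    linarith

end IsConvexBody

/-! ### The curves of flotation and of buoyancy -/

/-- The endpoints of a segment are determined by the segment and its orientation. -/
lemma segment_endpoints_eq {n a b a' b' : Plane} (hs : segment ℝ a b = segment ℝ a' b')
    (h1 : 0 < det n (b - a)) (h2 : 0 < det n (b' - a')) : a = a' ∧ b = b' := by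
  have key {a b a' b' : Plane} (hs : segment ℝ a b = segment ℝ a' b')
      (h1 : 0 < det n (b - a)) (h2 : 0 < det n (b' - a')) :
      ∃ τ : ℝ, 0 ≤ τ ∧ τ ≤ 1 ∧ a = a' + τ • (b' - a') := by
    have : a ∈ segment ℝ a' b' := hs ▸ left_mem_segment ℝ a b
    rw [segment_eq_image'] at this
    obtain ⟨τ, ⟨h3, h4⟩, e⟩ := this
    exact ⟨τ, h3, h4, e.symm⟩
  have left {a b a' b' : Plane} (hs : segment ℝ a b = segment ℝ a' b')
      (h1 : 0 < det n (b - a)) (h2 : 0 < det n (b' - a')) : a = a' := by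
    obtain ⟨τ, h3, -, e⟩ := key hs h1 h2
    obtain ⟨τ', h3', -, e'⟩ := key hs.symm h2 h1
    have e1 : det n a = det n a' + τ * det n (b' - a') := by
      conv_lhs => rw [e]
      rw [det_add_right, det_smul_right]
    have e2 : det n a' = det n a + τ' * det n (b - a) := by
      conv_lhs => rw [e']
      rw [det_add_right, det_smul_right]
    have : τ = 0 := by
      have := mul_nonneg h3' h1.le
      by_contra hne
      have := mul_pos (lt_of_le_of_ne h3 (Ne.symm hne)) h2
      linarith
    rw [e, this]; simp
  have ea := left hs h1 h2
  subst ea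
  have hb : b ∈ segment ℝ a b' := hs ▸ right_mem_segment ℝ a b
  have hb' : b' ∈ segment ℝ a b := hs ▸ right_mem_segment ℝ a b'
  rw [segment_eq_image'] at hb hb'
  obtain ⟨τ, ⟨h3, h4⟩, e⟩ := hb
  obtain ⟨τ', ⟨h3', h4'⟩, e'⟩ := hb'
  simp only at e e'
  have f1 : b - a = τ • (b' - a) := by rw [← e]; abel
  have f2 : b' - a = τ' • (b - a) := by rw [← e']; abel
  have g1 : det n (b - a) = τ * det n (b' - a) := by rw [← det_smul_right, ← f1]
  have g2 : det n (b' - a) = τ' * det n (b - a) := by rw [← det_smul_right, ← f2]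
  have : τ = 1 := by nlinarith
  rw [this, one_smul] at f1
  exact ⟨rfl, sub_left_injective f1⟩

/-- A parametrization, by the normal angle of the water surface, of the midpoints `p` of the chords
of flotation and of the centroids `b` of the underwater parts, with signed speeds `r` and `ρ`. -/
structure IsFlotationFamily (K : Set Plane) (γ : ℝ → Plane) (δ : ℝ) (p b : ℝ → Plane)
    (r ρ : ℝ → ℝ) : Prop where
  hasDerivAt_p : ∀ θ, HasDerivAt p (r θ • tang θ) θ
  hasDerivAt_b : ∀ θ, HasDerivAt b (ρ θ • tang θ) θ
  pos : ∀ θ, 0 < ρ θ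
  water : ∀ θ h, IsWaterSurface K δ θ h ↔ h = inner ℝ (p θ) (dir θ)
  centroid_eq : ∀ θ, centroid (underwater K θ (inner ℝ (p θ) (dir θ))) = b θ
  exists_chord : ∀ θ, ∃ s t, {q ∈ K | inner ℝ q (dir θ) = inner ℝ (p θ) (dir θ)} =
    segment ℝ (γ s) (γ t) ∧ 0 < det (dir θ) (γ t - γ s)
  chord_rel : ∀ θ s t, {q ∈ K | inner ℝ q (dir θ) = inner ℝ (p θ) (dir θ)} =
    segment ℝ (γ s) (γ t) → 0 < det (dir θ) (γ t - γ s) →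
    0 < det (deriv γ s) (γ t - γ s) ∧ 0 < det (γ t - γ s) (deriv γ t) ∧
    r θ * (det (deriv γ s) (γ t - γ s) * det (γ t - γ s) (deriv γ t)) =
      3 * δ * det (deriv γ s) (deriv γ t) * ρ θ

/-- The chords of flotation are parametrized by the point `γ s` at which the underwater arc begins.
The chord turns with positive speed, so that its angle may serve as the parameter. The derivatives
of the midpoint and of the centroid are multiples of the chord because the area is constant. -/
lemma IsCcwParam.exists_flotationFamily {K : Set Plane} {γ : ℝ → Plane} {L : ℝ}
    (h : IsCcwParam K γ L) {δ : ℝ} (hδ0 : 0 < δ) (hδ1 : δ < volume.real K) :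
    ∃ p b r ρ, IsFlotationFamily K γ δ p b r ρ := by
  obtain ⟨φ, hφ, hφL, hφd⟩ := h.exists_flotation_map hδ0 hδ1
  have hγd := h.param.hasDerivAt
  have hγc := h.param.continuous
  have hγ'c := h.param.continuous_deriv
  have hφc : Continuous φ := continuous_iff_continuousAt.2 fun s => (hφd s).continuousAt
  have hprop (s : ℝ) := h.proper_of_arcArea (hφ s).1 (hφ s).2.1 ((hφ s).2.2.symm ▸ hδ0)
    ((hφ s).2.2.symm ▸ hδ1)
  have hl (s : ℝ) : 0 < det (deriv γ s) (γ (φ s) - γ s) := by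
    obtain ⟨τ, hO, h1, h2⟩ := hprop s
    exact h.chord_det_left (hφ s).1 (hφ s).2.1 hO rfl h1 h2
  have hr (s : ℝ) : 0 < det (γ (φ s) - γ s) (deriv γ (φ s)) := by
    obtain ⟨τ, hO, h1, h2⟩ := hprop s
    exact h.chord_det_right (hφ s).1 (hφ s).2.1 hO rfl h1 h2
  set φ' : ℝ → ℝ := fun s => det (deriv γ s) (γ (φ s) - γ s) /
        det (γ (φ s) - γ s) (deriv γ (φ s)) with hφ'
  have hφ'c : Continuous φ' := Continuous.div (by fun_prop) (by fun_prop) fun s => (hr s).ne'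
  have hyd (s : ℝ) : HasDerivAt (fun s => γ (φ s)) (φ' s • deriv γ (φ s)) s :=
    (hγd (φ s)).scomp s (hφd s)
  set c : ℝ → Plane := fun s => γ (φ s) - γ s with hc
  have hcd (s : ℝ) : HasDerivAt c (φ' s • deriv γ (φ s) - deriv γ s) s := (hyd s).sub (hγd s)
  have hrel (s : ℝ) : det (c s) (deriv γ (φ s)) * φ' s = det (deriv γ s) (c s) := by
    have := (hr s).ne'
    simp only [hφ', c]; field_simp
  have hγφ (s : ℝ) : γ (φ (s + L)) = γ (φ s) := by rw [hφL, h.param.periodic]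
  have hγφ' (s : ℝ) : deriv γ (φ (s + L)) = deriv γ (φ s) := by rw [hφL, h.param.deriv_periodic]
  obtain ⟨S, S', -, hSd, hS', hS⟩ := exists_angle_param hcd (by fun_prop) (fun s => by
      rw [det_sub_right, det_smul_right, mul_comm, hrel, det_swap (c s)]
      have := hl s
      simp only [c]; linarith) h.param.period_pos
    (fun s => by simp only [hc, hγφ, h.param.periodic s])
    (fun s => by simp only [hφ', hγφ, hγφ', h.param.periodic s, h.param.deriv_periodic s])
  have hcn (θ : ℝ) : 0 < ‖c (S θ)‖ :=
    norm_pos_iff.2 (sub_ne_zero.2 (h.param.ne_of_lt (hφ _).1 (hφ _).2.1).symm)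
  -- the water surface through `γ (S θ)`
  have hdetc (θ : ℝ) (w : Plane) : det (c (S θ)) w = -(‖c (S θ)‖ * inner ℝ w (dir θ)) := by
    rw [hS θ, det_smul_left, det_tang, ← hS θ]; ring
  have hcinner (θ : ℝ) : inner ℝ (c (S θ)) (dir θ) = 0 := by
    have := hdetc θ (c (S θ))
    rw [det_self, zero_eq_neg, mul_eq_zero] at this
    exact this.resolve_left (hcn θ).ne'
  have hpin (θ : ℝ) : inner ℝ ((1 / 2 : ℝ) • (γ (S θ) + γ (φ (S θ)))) (dir θ) =
      inner ℝ (γ (S θ)) (dir θ) := by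
    have : (1 / 2 : ℝ) • (γ (S θ) + γ (φ (S θ))) = γ (S θ) + (1 / 2 : ℝ) • c (S θ) := by
      simp only [c]; module
    rw [this, inner_add_left, real_inner_smul_left, hcinner]; ring
  have hcap (θ : ℝ) : underwater K θ (inner ℝ (γ (S θ)) (dir θ)) =
      cap K (γ (S θ)) (γ (φ (S θ))) := by
    ext w
    simp only [underwater, cap, mem_ofPred_eq]
    have := hdetc θ (w - γ (S θ))
    simp only [c] at this
    rw [this, inner_sub_left, neg_nonpos, mul_nonneg_iff_of_pos_left (hcn θ), sub_nonneg]
  have hvol (θ : ℝ) : volume.real (cap K (γ (S θ)) (γ (φ (S θ)))) = δ := by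
    obtain ⟨τ, hO, h1, h2⟩ := hprop (S θ)
    rw [h.volume_real_cap (hφ _).1 (hφ _).2.1 hO rfl h1 h2, (hφ _).2.2]
  have hwater (θ : ℝ) : IsWaterSurface K δ θ (inner ℝ (γ (S θ)) (dir θ)) := by
    rw [IsWaterSurface, hcap, ← hvol θ, Measure.real, ENNReal.ofReal_toReal]
    exact ((measure_mono fun w hw => hw.1).trans_lt h.body.isCompact.measure_lt_top).ne
  have hseg (θ : ℝ) : {q ∈ K | inner ℝ q (dir θ) = inner ℝ (γ (S θ)) (dir θ)} =
      segment ℝ (γ (S θ)) (γ (φ (S θ))) := by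
    ext w
    constructor
    · rintro ⟨hw, hw'⟩
      obtain ⟨τ, hO, h1, h2⟩ := hprop (S θ)
      have h0 : det (c (S θ)) (w - γ (S θ)) = 0 := by
        rw [hdetc, inner_sub_left, hw']; ring
      obtain ⟨r, hr, e⟩ := h.mem_segment_of_det_eq_zero (hφ _).1 (hφ _).2.1 hO rfl h1 h2 hw h0
      rw [segment_eq_image']
      exact ⟨r, hr, e.symm⟩
    · intro hw
      refine ⟨h.body.convex.segment_subset (h.mem _) (h.mem _) hw, ?_⟩
      rw [segment_eq_image'] at hw
      obtain ⟨r, -, rfl⟩ := hw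
      have := hcinner θ
      simp only [c] at this
      rw [inner_add_left, real_inner_smul_left, this]; ring
  have hdirc (θ : ℝ) : 0 < det (dir θ) (γ (φ (S θ)) - γ (S θ)) := by
    have := hdetc θ (dir θ)
    simp only [c] at this
    rw [det_swap, this, neg_neg, real_inner_self_eq_norm_sq, norm_dir]
    have := hcn θ
    simp only [c] at this
    linarith
  refine ⟨fun θ => (1 / 2 : ℝ) • (γ (S θ) + γ (φ (S θ))),
    fun θ => δ⁻¹ • arcMoment γ (S θ) (φ (S θ)),
    fun θ => S' θ * (1 / 2 * (det (deriv γ (S θ)) (deriv γ (φ (S θ))) /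
      det (c (S θ)) (deriv γ (φ (S θ))))) * ‖c (S θ)‖,
    fun θ => S' θ * (δ⁻¹ * (1 / 6 * det (deriv γ (S θ)) (c (S θ)))) * ‖c (S θ)‖, ?_⟩
  constructor
  · intro θ
    have h1 := (((hγd (S θ)).add (hyd (S θ))).const_smul (1 / 2 : ℝ)).scomp θ (hSd θ)
    convert! h1 using 1
    have h2 := cramer (deriv γ (S θ)) (deriv γ (φ (S θ))) (c (S θ))
    rw [mul_smul, mul_smul, ← hS θ, mul_smul, div_eq_inv_mul (det _ _), mul_smul, h2]
    have := (hr (S θ)).ne'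
    simp only [hφ', c]
    congr 2
    rw [smul_add, smul_smul, smul_smul, inv_mul_cancel₀ this, one_smul, div_eq_inv_mul]
  · intro θ
    have h1 := ((hasDerivAt_arcMoment hγd hγ'c (hφd (S θ)) (hrel (S θ))).const_smul δ⁻¹).scomp θ
      (hSd θ)
    convert! h1 using 1
    rw [mul_smul, mul_smul, ← hS θ, mul_smul]
  · intro θ
    have := hl (S θ)
    have := hS' θ
    have := hcn θ
    simp only [c] at this ⊢
    positivity
  · intro θ h'
    simp only [hpin]
    constructor
    · intro hw
      exact h.body.water_unique hδ0 hδ1 hw (hwater θ)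
    · rintro rfl
      exact hwater θ
  · intro θ
    simp only [hpin]
    obtain ⟨τ, hO, h1, h2⟩ := hprop (S θ)
    rw [Flotation.centroid_eq, hcap, hvol, h.moment_cap (hφ _).1 (hφ _).2.1 hO rfl h1 h2]
  · intro θ
    simp only [hpin]
    exact ⟨S θ, φ (S θ), hseg θ, hdirc θ⟩
  · intro θ s t h1 h2
    simp only [hpin] at h1 ⊢
    rw [hseg] at h1
    obtain ⟨e1, e2⟩ := segment_endpoints_eq h1 (hdirc θ) h2
    have d1 : deriv γ s = deriv γ (S θ) := by
      obtain ⟨n, hn⟩ := h.param.eq_add_of_eq e1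
      rw [hn, h.param.deriv_add_int_mul]
    have d2 : deriv γ t = deriv γ (φ (S θ)) := by
      obtain ⟨n, hn⟩ := h.param.eq_add_of_eq e2
      rw [hn, h.param.deriv_add_int_mul]
    rw [← e1, ← e2, d1, d2]
    refine ⟨hl _, hr _, ?_⟩
    have := (hr (S θ)).ne'
    have := hδ0.ne'
    simp only [c]
    field_simp
    ring

/-! ### Homothety of the curves of flotation and of buoyancy -/

lemma cbrt_pow_three (a : ℝ) : cbrt a ^ 3 = a := by
  have h3 : (|a| ^ (1 / 3 : ℝ)) ^ 3 = |a| := by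
    rw [← Real.rpow_natCast, ← Real.rpow_mul (abs_nonneg a)]; norm_num
  rw [cbrt, mul_pow, h3]
  rcases lt_trichotomy a 0 with ha | rfl | ha
  · rw [sign_neg ha, abs_of_neg ha, SignType.coe_neg_one]; ring
  · simp
  · rw [sign_pos ha, abs_of_pos ha]; simp

lemma affineDist_pow_three (x x' y y' : Plane) :
    affineDist x x' y y' ^ 3 = 4 * (det x' (y - x) * det (y - x) y' / det x' y') := by
  rw [affineDist, mul_pow, cbrt_pow_three, triangleArea]; ring

lemma tang_ne_zero (θ : ℝ) : tang θ ≠ 0 := by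
  intro e
  have := det_tang θ (dir θ)
  rw [e, det_zero_left, real_inner_self_eq_norm_sq, norm_dir] at this
  norm_num at this

lemma tang_add_pi (θ : ℝ) : tang (θ + Real.pi) = -tang θ := by
  apply ext_plane <;> simp

namespace IsFlotationFamily

variable {K : Set Plane} {γ : ℝ → Plane} {L δ : ℝ} {p b : ℝ → Plane} {r ρ : ℝ → ℝ}
  (F : IsFlotationFamily K γ δ p b r ρ)
include F

lemma hasDerivAt_height (θ : ℝ) :
    HasDerivAt (fun θ => inner ℝ (p θ) (dir θ)) (inner ℝ (p θ) (tang θ)) θ := by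
  have := (F.hasDerivAt_p θ).inner ℝ (hasDerivAt_dir θ)
  convert! this using 1
  rw [real_inner_smul_left, inner_tang_dir, sub_self, Real.sin_zero]; ring

lemma isWaterSurface (θ : ℝ) : IsWaterSurface K δ θ (inner ℝ (p θ) (dir θ)) :=
  (F.water θ _).2 rfl

lemma flotationCurve_eq : flotationCurve K δ = range p := by
  ext q
  constructor
  · rintro ⟨h, hw, θ, h0, hd⟩
    have e : h = fun θ => inner ℝ (p θ) (dir θ) := by
      ext φ; exact (F.water φ _).1 (hw φ)
    subst e
    refine ⟨θ, (eq_of_inner_eq (θ := θ) (by linarith) ?_).symm⟩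
    have h1 := ((hasDerivAt_const θ q).inner ℝ (hasDerivAt_dir θ)).sub (F.hasDerivAt_height θ)
    have h2 := h1.unique hd
    rw [inner_zero_left, add_zero] at h2
    linarith
  · rintro ⟨θ, rfl⟩
    refine ⟨fun θ => inner ℝ (p θ) (dir θ), F.isWaterSurface, θ, sub_self _, ?_⟩
    have h1 := ((hasDerivAt_const θ (p θ)).inner ℝ (hasDerivAt_dir θ)).sub (F.hasDerivAt_height θ)
    convert! h1 using 1
    rw [inner_zero_left]; ring

lemma buoyancyCurve_eq : buoyancyCurve K δ = range b := by
  ext q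
  constructor
  · rintro ⟨θ, h, hw, rfl⟩
    rw [(F.water θ h).1 hw, F.centroid_eq]
    exact mem_range_self θ
  · rintro ⟨θ, rfl⟩
    exact ⟨θ, _, F.isWaterSurface θ, (F.centroid_eq θ).symm⟩

lemma b_add_two_pi (θ : ℝ) : b (θ + 2 * Real.pi) = b θ := by
  have hu (h : ℝ) : underwater K (θ + 2 * Real.pi) h = underwater K θ h := by
    simp only [underwater, dir_add_two_pi]
  have h1 := F.isWaterSurface (θ + 2 * Real.pi)
  rw [IsWaterSurface, hu] at h1
  rw [← F.centroid_eq, ← F.centroid_eq, hu, (F.water θ _).1 h1]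

lemma p_add_pi (hper : ∀ θ, inner ℝ (p (θ + Real.pi)) (dir (θ + Real.pi)) =
    -inner ℝ (p θ) (dir θ)) (θ : ℝ) : p (θ + Real.pi) = p θ := by
  have h1 : HasDerivAt (fun θ => inner ℝ (p (θ + Real.pi)) (dir (θ + Real.pi)))
      (inner ℝ (p (θ + Real.pi)) (tang (θ + Real.pi))) θ :=
    (F.hasDerivAt_height (θ + Real.pi)).comp_add_const θ Real.pi
  have h2 : HasDerivAt (fun θ => inner ℝ (p (θ + Real.pi)) (dir (θ + Real.pi)))
      (-inner ℝ (p θ) (tang θ)) θ := by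
    simp only [hper]
    exact (F.hasDerivAt_height θ).neg
  have h3 := h1.unique h2
  have h4 := hper θ
  rw [tang_add_pi, inner_neg_right] at h3
  rw [dir_add_pi, inner_neg_right] at h4
  exact eq_of_inner_eq (θ := θ) (by linarith) (by linarith)

variable (hK : IsConvexBody K) (hδ0 : 0 < δ) (hδ1 : δ ≤ volume.real K / 2)
include hK hδ0 hδ1

/-- If the water surfaces of one pair of opposite directions coincide, then `δ` is half the area,
and all pairs coincide. -/
lemma height_add_pi {θ : ℝ}
    (h0 : inner ℝ (p θ) (dir θ) + inner ℝ (p (θ + Real.pi)) (dir (θ + Real.pi)) = 0) (φ : ℝ) :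
    p (φ + Real.pi) = p φ := by
  have hδ := (hK.water_opposite hδ0 hδ1 (F.isWaterSurface θ) (F.isWaterSurface _)).2 h0
  refine F.p_add_pi (fun φ => ((F.water _ _).1 ?_).symm) φ
  have h1 := hK.underwater_add φ (inner ℝ (p φ) (dir φ))
  have h2 : volume.real (underwater K φ (inner ℝ (p φ) (dir φ))) = δ := by
    rw [Measure.real, F.isWaterSurface, ENNReal.toReal_ofReal hδ0.le]
  have h3 : volume.real (underwater K (φ + Real.pi) (-inner ℝ (p φ) (dir φ))) = δ := by linarith
  rw [IsWaterSurface, ← h3, Measure.real, ENNReal.ofReal_toReal]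
  exact ((measure_mono fun w hw => hw.1).trans_lt hK.isCompact.measure_lt_top).ne

omit hδ1 in
/-- The centroid of the underwater part lies below the water surface. -/
lemma height_lt (θ : ℝ) : inner ℝ (p θ) (dir θ) < inner ℝ (b θ) (dir θ) := by
  have e (w : Plane) : det (-tang θ) w = inner ℝ w (dir θ) := by
    rw [det_neg_left, det_tang, neg_neg]
  have h2 : volume.real (underwater K θ (inner ℝ (p θ) (dir θ))) = δ := by
    rw [Measure.real, F.isWaterSurface, ENNReal.toReal_ofReal hδ0.le]
  have := lt_det_centroid hK.isCompact (D := underwater K θ (inner ℝ (p θ) (dir θ)))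
    (fun w hw => hw.1) (isClosed_underwater hK _ _).measurableSet (by rw [h2]; exact hδ0)
    (neg_ne_zero.2 (tang_ne_zero θ)) (m := inner ℝ (p θ) (dir θ)) (fun w hw => by
      rw [e]; exact hw.2)
  rwa [F.centroid_eq, e] at this

end IsFlotationFamily

/-- The part of the result on flotation, for counterclockwise parametrizations. -/
theorem IsCcwParam.flotation {K : Set Plane} {γ : ℝ → Plane} {L : ℝ} (h : IsCcwParam K γ L)
    {δ lam : ℝ} (hδ0 : 0 < δ) (hδ1 : δ ≤ volume.real K / 2) :
    (1 < lam ∧ IsHomothetic (flotationCurve K δ) (buoyancyCurve K δ) lam) ↔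
      ∀ s t : ℝ, IsFlotationChord K δ (γ s) (γ t) → det (deriv γ s) (deriv γ t) ≠ 0 ∧
        affineDist (γ s) (deriv γ s) (γ t) (deriv γ t) ^ 3 = 12 * δ * lam := by
  have hV := h.body.volume_real_pos
  obtain ⟨p, b, r, ρ, F⟩ := h.exists_flotationFamily hδ0 (by linarith)
  rw [F.flotationCurve_eq, F.buoyancyCurve_eq]
  constructor
  · rintro ⟨hlam, z, hz⟩ s t ⟨θ, h', hw, hseg, hdet⟩
    have hlam0 : lam ≠ 0 := by linarith
    have hq (θ : ℝ) : HasDerivAt (fun θ => AffineMap.homothety z lam⁻¹ (b θ))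
        ((lam⁻¹ * ρ θ) • tang θ) θ := by
      simp only [AffineMap.homothety_apply, vsub_eq_sub, vadd_eq_add]
      rw [mul_smul]
      exact (((F.hasDerivAt_b θ).sub_const z).const_smul lam⁻¹).add_const z
    have hrange : range p = range fun θ => AffineMap.homothety z lam⁻¹ (b θ) := by
      rw [show (fun θ => AffineMap.homothety z lam⁻¹ (b θ)) =
        (AffineMap.homothety z lam⁻¹ : Plane →ᵃ[ℝ] Plane) ∘ b from rfl, range_comp, ← hz,
        ← image_comp]
      convert! (image_id (range p)).symm using 2
      ext1 w
      simp [AffineMap.homothety_apply, smul_smul, hlam0]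
    -- a homothety of the point sets is a homothety of the parametrizations
    have hpq := eq_of_range_eq hq (fun θ => mul_pos (inv_pos.2 (by linarith)) (F.pos θ))
      (fun θ => by rw [F.b_add_two_pi]) F.hasDerivAt_p
      (fun θ => (h.body.water_opposite hδ0 hδ1 (F.isWaterSurface θ) (F.isWaterSurface _)).1)
      (fun θ h0 => F.height_add_pi h.body hδ0 hδ1 h0) hrange
    have hr (θ : ℝ) : r θ = lam⁻¹ * ρ θ := by
      have h1 := F.hasDerivAt_p θ
      rw [funext hpq] at h1
      exact smul_left_injective ℝ (tang_ne_zero θ) (h1.unique (hq θ))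
    rw [(F.water θ h').1 hw] at hseg
    obtain ⟨h1, h2, h3⟩ := F.chord_rel θ s t hseg hdet
    have hρ := F.pos θ
    rw [hr] at h3
    have h4 : det (deriv γ s) (γ t - γ s) * det (γ t - γ s) (deriv γ t) =
        3 * δ * lam * det (deriv γ s) (deriv γ t) := by
      field_simp at h3
      linarith
    have h5 : det (deriv γ s) (deriv γ t) ≠ 0 := by
      intro e
      rw [e, mul_zero] at h4
      have := mul_pos h1 h2
      linarith
    refine ⟨h5, ?_⟩
    rw [affineDist_pow_three, h4]
    field_simp
    ring
  · intro hall
    have hr (θ : ℝ) : ρ θ = lam * r θ := by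
      obtain ⟨s, t, h1, h2⟩ := F.exists_chord θ
      obtain ⟨h3, h4⟩ := hall s t ⟨θ, _, F.isWaterSurface θ, h1, h2⟩
      obtain ⟨h5, h6, h7⟩ := F.chord_rel θ s t h1 h2
      rw [affineDist_pow_three] at h4
      have h8 : det (deriv γ s) (γ t - γ s) * det (γ t - γ s) (deriv γ t) =
          3 * δ * lam * det (deriv γ s) (deriv γ t) := by
        field_simp at h4
        linarith
      rw [h8] at h7
      have h9 : (3 * δ * det (deriv γ s) (deriv γ t)) * (ρ θ - lam * r θ) = 0 := by linarith
      have := (mul_eq_zero.1 h9).resolve_left (by positivity)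
      linarith
    have hd (θ : ℝ) : HasDerivAt (fun θ => b θ - lam • p θ) 0 θ := by
      convert! (F.hasDerivAt_b θ).sub ((F.hasDerivAt_p θ).const_smul lam) using 1
      rw [smul_smul, hr, sub_self]
    obtain ⟨k, hk⟩ : ∃ k, ∀ θ, b θ = lam • p θ + k := by
      refine ⟨b 0 - lam • p 0, fun θ => ?_⟩
      have := is_const_of_deriv_eq_zero (fun θ => (hd θ).differentiableAt)
        (fun θ => (hd θ).deriv) θ 0
      rw [← this]; abel
    -- sum over two opposite directions: the width of the curve of buoyancy exceeds that of the
    -- curve of flotation, which is non-negative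
    have hlam : 1 < lam := by
      have h1 := F.height_lt h.body hδ0 0
      have h2 := F.height_lt h.body hδ0 (0 + Real.pi)
      have h3 := (h.body.water_opposite hδ0 hδ1 (F.isWaterSurface 0) (F.isWaterSurface _)).1
      rw [hk, inner_add_left, real_inner_smul_left] at h1 h2
      have h4 : inner ℝ k (dir (0 + Real.pi)) = -inner ℝ k (dir 0) := by
        rw [dir_add_pi, inner_neg_right]
      rw [h4] at h2
      by_contra hcon
      nlinarith
    refine ⟨hlam, (1 - lam)⁻¹ • k, ?_⟩
    rw [← range_comp]
    congr 1
    ext1 θ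
    have : 1 - lam ≠ 0 := by linarith
    simp only [Function.comp, AffineMap.homothety_apply, vsub_eq_sub, vadd_eq_add, hk]
    match_scalars
    · ring
    · field_simp; ring

/-! ### Tangents from an exterior point -/

/-- `x` is a point of contact of the tangent from `p` that has `K` on its left-hand side when run
from `x` to `p`. The arc of the boundary facing `p` begins there, if it is run counterclockwise. -/
def IsFirstContact (K : Set Plane) (p x : Plane) : Prop :=
  x ∈ K ∧ ∀ w ∈ K, 0 ≤ det (w - p) (x - p)

/-- `y` is a point of contact of the other tangent from `p`, where the arc of the boundary facing
`p` ends. -/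
def IsLastContact (K : Set Plane) (p y : Plane) : Prop :=
  y ∈ K ∧ ∀ w ∈ K, 0 ≤ det (y - p) (w - p)

namespace IsConvexBody

variable {K : Set Plane} (hK : IsConvexBody K)
include hK

/-- A convex body does not lie on a line. -/
lemma exists_det_ne {v : Plane} (hv : v ≠ 0) (p : Plane) : ∃ w ∈ K, det v (w - p) ≠ 0 := by
  by_contra! hcon
  have : volume K = 0 := measure_mono_null (fun w hw => hcon w hw) (volume_line hv p)
  have h2 := hK.volume_real_pos
  simp [Measure.real, this] at h2

/-- A linear functional attains its minimum on a convex body at boundary points only. -/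
lemma mem_frontier_of_det {n x : Plane} (hn : n ≠ 0) (hx : x ∈ K)
    (h : ∀ w ∈ K, 0 ≤ det n (w - x)) : x ∈ frontier K := by
  refine ⟨subset_closure hx, fun hi => ?_⟩
  obtain ⟨k, hk, hk0⟩ := hK.exists_det_ne hn x
  have hpos := lt_of_le_of_ne (h k hk) hk0.symm
  have hkx : x - (k - x) ≠ x := by
    intro e
    rw [sub_eq_self] at e
    rw [e, det_zero_right] at hpos
    exact lt_irrefl _ hpos
  obtain ⟨τ, hτ, hτf, -⟩ := hK.exists_exit hi hkx
  have := h _ (hK.frontier_subset hτf)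
  rw [add_sub_cancel_left, sub_right_comm, sub_self, zero_sub, smul_neg, det_neg_right,
    det_smul_right] at this
  nlinarith

/-- The two tangents from an exterior point exist: the points of contact maximize and minimize the
slope of the ray from `p`, relative to a direction `n` that separates `p` from `K`. -/
lemma exists_contacts {p : Plane} (hp : p ∉ K) :
    ∃ x y, IsFirstContact K p x ∧ IsLastContact K p y := by
  obtain ⟨f, u, hu, hf⟩ := geometric_hahn_banach_point_closed hK.convex hK.isClosed hp
  set n := (InnerProductSpace.toDual ℝ Plane).symm f
  have hfn (w : Plane) : f w = inner ℝ n w := (InnerProductSpace.toDual_symm_apply).symm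
  have hpos (w : Plane) (hw : w ∈ K) : 0 < inner ℝ n (w - p) := by
    rw [inner_sub_right, ← hfn, ← hfn]; linarith [hf w hw]
  have hn : 0 < ‖n‖ ^ 2 := by
    obtain ⟨w, hw⟩ := hK.interior_nonempty
    have := hpos w (interior_subset hw)
    have : n ≠ 0 := fun e => by simp [e] at this
    positivity
  -- the determinant compares the slopes `det n w / ⟨n, w⟩`
  have key (A B : Plane) : inner ℝ n A * det n B - inner ℝ n B * det n A =
      ‖n‖ ^ 2 * det A B := by
    rw [inner_eq, inner_eq, norm_sq_eq]; simp only [det]; ring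
  have hc : ContinuousOn (fun w => det n (w - p) / inner ℝ n (w - p)) K := by
    apply ContinuousOn.div
    · fun_prop
    · fun_prop
    · exact fun w hw => (hpos w hw).ne'
  have hne : K.Nonempty := hK.interior_nonempty.mono interior_subset
  obtain ⟨x, hx, hxm⟩ := hK.isCompact.exists_isMaxOn hne hc
  obtain ⟨y, hy, hym⟩ := hK.isCompact.exists_isMinOn hne hc
  refine ⟨x, y, ⟨hx, fun w hw => ?_⟩, hy, fun w hw => ?_⟩
  · have := isMaxOn_iff.1 hxm w hw
    rw [div_le_div_iff₀ (hpos w hw) (hpos x hx)] at this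
    have h2 := key (w - p) (x - p)
    exact nonneg_of_mul_nonneg_right (by linarith) hn
  · have := isMinOn_iff.1 hym w hw
    rw [div_le_div_iff₀ (hpos y hy) (hpos w hw)] at this
    have h2 := key (y - p) (w - p)
    exact nonneg_of_mul_nonneg_right (by linarith) hn

end IsConvexBody

/-- The two tangents from `p` touch `K` at `x` and `y`; the arc of the boundary facing `p` leads
counterclockwise from `x` to `y`. -/
structure IsContactPair (K : Set Plane) (p x y : Plane) : Prop where
  body : IsConvexBody K
  notMem : p ∉ K
  first : IsFirstContact K p x
  last : IsLastContact K p y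

/-- The part of `K` on the far side of the chord `[x, y]`. -/
def far (K : Set Plane) (x y : Plane) : Set Plane := {w ∈ K | 0 ≤ det (y - x) (w - x)}

/-- The convex hull of a set and a further point. -/
def hull (K : Set Plane) (p : Plane) : Set Plane := convexHull ℝ (insert p K)

lemma subset_hull (K : Set Plane) (p : Plane) : K ⊆ hull K p :=
  (subset_insert p K).trans (subset_convexHull ℝ _)

lemma mem_hull (K : Set Plane) (p : Plane) : p ∈ hull K p :=
  subset_convexHull ℝ _ (mem_insert p K)

namespace IsConvexBody

variable {K : Set Plane} (hK : IsConvexBody K)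
include hK

lemma mem_hull_iff {p w : Plane} :
    w ∈ Flotation.hull K p ↔ ∃ k ∈ K, ∃ r ∈ Icc (0 : ℝ) 1, w = p + r • (k - p) := by
  rw [Flotation.hull, convexHull_insert (hK.interior_nonempty.mono interior_subset),
    hK.convex.convexHull_eq, mem_convexJoin]
  simp only [mem_singleton_iff, segment_eq_image', mem_image]
  constructor
  · rintro ⟨_, rfl, k, hk, r, hr, e⟩
    exact ⟨k, hk, r, hr, e.symm⟩
  · rintro ⟨k, hk, r, hr, e⟩
    exact ⟨p, rfl, k, hk, r, hr, e.symm⟩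

lemma hull (p : Plane) : IsConvexBody (hull K p) where
  convex := convex_convexHull ℝ _
  isCompact := by
    have e : Flotation.hull K p =
        (fun z : ℝ × Plane => p + z.1 • (z.2 - p)) '' (Icc (0 : ℝ) 1 ×ˢ K) := by
      ext w
      rw [hK.mem_hull_iff]
      constructor
      · rintro ⟨k, hk, r, hr, rfl⟩
        exact ⟨(r, k), ⟨hr, hk⟩, rfl⟩
      · rintro ⟨⟨r, k⟩, ⟨hr, hk⟩, rfl⟩
        exact ⟨k, hk, r, hr, rfl⟩
    rw [e]
    exact (isCompact_Icc.prod hK.isCompact).image (by fun_prop)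
  interior_nonempty := hK.interior_nonempty.mono (interior_mono (subset_hull K p))

lemma hull_eq_of_mem {p : Plane} (hp : p ∈ K) : Flotation.hull K p = K := by
  rw [Flotation.hull, insert_eq_of_mem hp, hK.convex.convexHull_eq]

/-- A closed subset of full area of a convex body is the whole body. -/
lemma eq_of_volume_le {A : Set Plane} (hA : IsClosed A) (hAK : A ⊆ K)
    (hv : volume.real K ≤ volume.real A) : A = K := by
  by_contra hne
  have h1 : ¬ interior K ⊆ A := fun hs => hne (hAK.antisymm (by
    rw [← hK.closure_interior]; exact closure_minimal hs hA))
  obtain ⟨w, hw, hwA⟩ := not_subset.1 h1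
  have h2 : 0 < volume (interior K \ A) :=
    (isOpen_interior.sdiff hA).measure_pos volume ⟨w, hw, hwA⟩
  have h3 : volume (K \ A) = 0 := by
    have e := measureReal_sdiff_add_inter (μ := volume) (s := K) (t := A) hA.measurableSet
      hK.isCompact.measure_lt_top.ne
    rw [inter_eq_right.2 hAK] at e
    have h4 : volume.real (K \ A) = 0 :=
      le_antisymm (by linarith) measureReal_nonneg
    rwa [measureReal_eq_zero_iff
      ((measure_mono sdiff_subset).trans_lt hK.isCompact.measure_lt_top).ne] at h4
  exact h2.ne' (measure_mono_null (sdiff_subset_sdiff_left interior_subset) h3)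

lemma isClosed_far (x y : Plane) : IsClosed (far K x y) :=
  hK.isClosed.inter (isClosed_le (f := fun _ : Plane => (0 : ℝ)) continuous_const
    (g := fun w => det (y - x) (w - x)) (by fun_prop))

lemma far_union_subset {x y : Plane} (hx : x ∈ K) (hy : y ∈ K) (q : Plane) :
    far K x y ∪ convexHull ℝ {q, y, x} ⊆ Flotation.hull K q := by
  refine union_subset (fun w hw => subset_hull K q hw.1) (convexHull_mono ?_)
  rintro w (rfl | rfl | rfl)
  · exact mem_insert _ _
  · exact mem_insert_of_mem _ hy
  · exact mem_insert_of_mem _ hx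

lemma volume_far_inter {q x y : Plane} (hq : 0 < det (y - q) (x - q)) :
    volume (far K x y ∩ convexHull ℝ {q, y, x}) = 0 := by
  have hxy : y - x ≠ 0 := fun e => by
    rw [sub_eq_zero.1 e, det_self] at hq; exact lt_irrefl _ hq
  refine measure_mono_null ?_ (volume_line hxy x)
  rintro w ⟨⟨-, h1⟩, h2⟩
  obtain ⟨-, -, h3⟩ := (mem_triangle_iff hq).1 h2
  have e : det (w - q) (x - q) + det (y - q) (w - q) - det (y - q) (x - q) =
      det (y - x) (w - x) := by simp only [det, PiLp.sub_apply]; ring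
  exact le_antisymm (by linarith) h1

omit hK in
lemma isClosed_triangle (q x y : Plane) : IsClosed (convexHull ℝ {q, y, x} : Set Plane) :=
  (Set.Finite.isCompact_convexHull ℝ (Set.toFinite _)).isClosed

lemma volume_real_far_union {q x y : Plane} (hq : 0 < det (y - q) (x - q)) :
    volume.real (far K x y ∪ convexHull ℝ {q, y, x}) =
      volume.real (far K x y) + 1 / 2 * det (y - q) (x - q) := by
  have hfin : volume (far K x y) ≠ ⊤ :=
    ((measure_mono fun w hw => hw.1).trans_lt hK.isCompact.measure_lt_top).ne
  have hfin2 : volume (convexHull ℝ {q, y, x}) ≠ ⊤ :=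
    (Set.Finite.isCompact_convexHull ℝ (Set.toFinite _)).measure_lt_top.ne
  have h1 := measureReal_union_add_inter (μ := volume) (s := far K x y)
    (isClosed_triangle q x y).measurableSet hfin hfin2
  rw [← volume_real_triangle hq, ← h1, Measure.real, Measure.real, hK.volume_far_inter hq]
  simp

lemma moment_far_union {q x y : Plane} (hq : 0 < det (y - q) (x - q)) :
    ∫ w in far K x y ∪ convexHull ℝ {q, y, x}, w =
      (∫ w in far K x y, w) +
        (1 / 2 * det (y - q) (x - q)) • ((1 / 3 : ℝ) • (q + y + x)) := by
  rw [← moment_triangle hq]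
  apply setIntegral_union₀
  · exact hK.volume_far_inter hq
  · exact (isClosed_triangle q x y).measurableSet.nullMeasurableSet
  · exact (continuous_id.continuousOn.integrableOn_compact hK.isCompact).mono_set fun w hw => hw.1
  · exact continuous_id.continuousOn.integrableOn_compact (Set.Finite.isCompact_convexHull ℝ (Set.toFinite _))

end IsConvexBody

namespace IsContactPair

variable {K : Set Plane} {p x y : Plane} (C : IsContactPair K p x y)
include C

lemma det_pos : 0 < det (y - p) (x - p) := by
  refine lt_of_le_of_ne (C.last.2 x C.first.1) fun e => ?_
  have hx : x - p ≠ 0 := fun e => C.notMem (sub_eq_zero.1 e ▸ C.first.1)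
  have hy : y - p ≠ 0 := fun e => C.notMem (sub_eq_zero.1 e ▸ C.last.1)
  obtain ⟨k, hk⟩ := exists_smul_of_det_eq_zero hx (b := y - p) (by rw [det_swap, ← e, neg_zero])
  have hk0 : 0 < k := by
    by_contra hneg
    rcases (not_lt.1 hneg).eq_or_lt with rfl | hneg
    · exact hy (by rw [hk, zero_smul])
    · apply C.notMem
      apply C.body.convex.segment_subset C.first.1 C.last.1
      rw [segment_eq_image']
      refine ⟨1 / (1 - k), ⟨by apply div_nonneg <;> linarith, by
        rw [div_le_one (by linarith)]; linarith⟩, ?_⟩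
      have : 1 - k ≠ 0 := by linarith
      have e2 : y - x = -(1 - k) • (x - p) := by
        rw [show y - x = (y - p) - (x - p) by abel, hk]; module
      simp only [e2]
      match_scalars <;> field_simp
      ring
  obtain ⟨w, hw, hw0⟩ := C.body.exists_det_ne hx p
  have h1 := C.first.2 w hw
  have h2 := C.last.2 w hw
  rw [hk, det_smul_left] at h2
  rw [det_swap] at h1
  have h3 := nonneg_of_mul_nonneg_right h2 hk0
  exact hw0 (le_antisymm (by linarith) h3)

/-- The hull of `K` and `p` consists of the triangle formed by `p` and its points of contact and of
the part of `K` beyond the chord of contact. -/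
lemma hull_eq : hull K p = far K x y ∪ convexHull ℝ {p, y, x} := by
  refine Subset.antisymm ?_ (C.body.far_union_subset C.first.1 C.last.1 p)
  intro w hw
  obtain ⟨k, hk, r, ⟨hr0, hr1⟩, rfl⟩ := C.body.mem_hull_iff.1 hw
  have hD := C.det_pos
  have e : det (p + r • (k - p) - p) (x - p) + det (y - p) (p + r • (k - p) - p) -
      det (y - p) (x - p) = det (y - x) (p + r • (k - p) - x) := by
    simp only [det, PiLp.sub_apply]; ring
  have ha := C.first.2 k hk
  have hb := C.last.2 k hk
  rcases le_or_gt (det (y - x) (p + r • (k - p) - x)) 0 with h0 | h0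
  · right
    rw [mem_triangle_iff hD]
    rw [add_sub_cancel_left, det_smul_left, det_smul_right] at e ⊢
    exact ⟨by positivity, by positivity, by linarith⟩
  · left
    refine ⟨?_, h0.le⟩
    rw [add_sub_cancel_left, det_smul_left, det_smul_right] at e
    set D := det (y - p) (x - p)
    set a := det (k - p) (x - p)
    set b := det (y - p) (k - p)
    have hcr : D • (k - p) = b • (x - p) + a • (y - p) := by
      rw [cramer (y - p) (x - p) (k - p), add_comm]
    have hr : D < r * (a + b) := by linarith
    have hab : 0 < a + b := by
      by_contra hc
      have : r * (a + b) ≤ 0 := mul_nonpos_of_nonneg_of_nonpos hr0 (not_lt.1 hc)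
      linarith
    have hle : r * (a + b) ≤ a + b := by nlinarith
    -- the segment from `p` to `k` meets the chord of contact in a point of `K`
    have hz : x + (a / (a + b)) • (y - x) ∈ K := by
      apply C.body.convex.add_smul_sub_mem C.first.1 C.last.1
      exact ⟨by positivity, by rw [div_le_one hab]; linarith⟩
    have hab2 : 0 < a + b - D := by linarith
    have := C.body.convex.add_smul_sub_mem hz hk (t := (r * (a + b) - D) / (a + b - D))
      ⟨by apply div_nonneg <;> linarith, by rw [div_le_one hab2]; linarith⟩
    convert this using 1
    have hk' : k = p + (b / D) • (x - p) + (a / D) • (y - p) := by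
      have : k - p = D⁻¹ • (b • (x - p) + a • (y - p)) := by
        rw [← hcr, smul_smul, inv_mul_cancel₀ hD.ne', one_smul]
      rw [← sub_add_cancel k p, this]
      match_scalars
      · field_simp
      · field_simp; ring
      · field_simp
    rw [hk']
    have := hD.ne'; have := hab.ne'; have := hab2.ne'
    match_scalars
    · field_simp; ring
    · field_simp; ring
    · field_simp; ring

lemma volume_hull : volume.real (hull K p) =
    volume.real (far K x y) + 1 / 2 * det (y - p) (x - p) := by
  rw [C.hull_eq, C.body.volume_real_far_union C.det_pos]

lemma moment_hull : ∫ w in hull K p, w =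
    (∫ w in far K x y, w) + (1 / 2 * det (y - p) (x - p)) • ((1 / 3 : ℝ) • (p + y + x)) := by
  rw [C.hull_eq, C.body.moment_far_union C.det_pos]

omit C in
lemma det_sub_eq (p q x y : Plane) :
    det (y - q) (x - q) = det (y - p) (x - p) + det (q - p) (y - x) := by
  simp only [det, PiLp.sub_apply]; ring

/-- The chord of contact is a subgradient of the area of the convex hull. -/
lemma le_volume_hull (q : Plane) :
    volume.real (hull K p) + 1 / 2 * det (q - p) (y - x) ≤ volume.real (hull K q) := by
  have hfin : volume (hull K q) ≠ ⊤ := (C.body.hull q).isCompact.measure_lt_top.ne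
  rw [C.volume_hull]
  have e := det_sub_eq p q x y
  rcases lt_or_ge 0 (det (y - q) (x - q)) with h | h
  · have h1 := measureReal_mono (μ := volume)
      (C.body.far_union_subset C.first.1 C.last.1 q) hfin
    rw [C.body.volume_real_far_union h] at h1
    linarith
  · have h1 := measureReal_mono (s₁ := far K x y) (s₂ := hull K q) (μ := volume)
      (fun w hw => subset_hull K q hw.1) hfin
    linarith

end IsContactPair

namespace IsConvexBody

variable {K : Set Plane} (hK : IsConvexBody K)
include hK

lemma volume_le_hull (p : Plane) : volume.real K ≤ volume.real (Flotation.hull K p) :=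
  measureReal_mono (subset_hull K p) (hK.hull p).isCompact.measure_lt_top.ne

lemma exists_contactPair {p : Plane} (hp : p ∉ K) : ∃ x y, IsContactPair K p x y := by
  obtain ⟨x, y, hx, hy⟩ := hK.exists_contacts hp
  exact ⟨x, y, hK, hp, hx, hy⟩

lemma continuous_volume_hull : Continuous fun p => volume.real (Flotation.hull K p) := by
  have hb := hK.isCompact.isBounded
  refine (LipschitzWith.of_le_add_mul (Real.toNNReal (Metric.diam K)) fun p q => ?_).continuous
  rw [Real.coe_toNNReal _ Metric.diam_nonneg]
  by_cases hp : p ∈ K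
  · rw [hK.hull_eq_of_mem hp]
    have := mul_nonneg (Metric.diam_nonneg (s := K)) (dist_nonneg (x := p) (y := q))
    linarith [hK.volume_le_hull q]
  · obtain ⟨x, y, C⟩ := hK.exists_contactPair hp
    have h1 := C.le_volume_hull q
    have h2 := (abs_le.1 (abs_det_le (q - p) (y - x))).1
    have h3 : ‖y - x‖ ≤ Metric.diam K := by
      rw [← dist_eq_norm]; exact Metric.dist_le_diam_of_mem hb C.last.1 C.first.1
    rw [← dist_eq_norm q p, dist_comm q p] at h2
    have h4 : dist p q * ‖y - x‖ ≤ Metric.diam K * dist p q := by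
      rw [mul_comm]; exact mul_le_mul_of_nonneg_right h3 dist_nonneg
    have h5 := mul_nonneg (Metric.diam_nonneg (s := K)) (dist_nonneg (x := p) (y := q))
    linarith

end IsConvexBody

/-- First order expansion of the moment of the convex hull along a curve of constant area of the
hull, with an explicit remainder. -/
lemma IsContactPair.moment_hull_sub_le {K : Set Plane} {p x y p' x' y' : Plane}
    (C : IsContactPair K p x y) (C' : IsContactPair K p' x' y')
    (hF : volume.real (hull K p') = volume.real (hull K p)) {R : ℝ}
    (hR : ∀ w ∈ K, ‖w‖ ≤ R) (hp' : ‖p'‖ ≤ R) (hpos : 0 < det (y - p') (x - p')) :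
    ‖(∫ w in hull K p', w) - (∫ w in hull K p, w) -
      (det (y - p) (x - p) / 6) • (p' - p)‖ ≤ R * (‖p' - p‖ * ‖(y' - x') - (y - x)‖) := by
  have hR0 : 0 ≤ R := (norm_nonneg p').trans hp'
  -- the hull of `p'` is compared with its part `A`, in which the points of contact `x`, `y` of `p`
  -- are kept; the missing area `ε` is of second order by convexity of the area of the hull
  set A := far K x y ∪ convexHull ℝ {p', y, x} with hA
  have hAs : A ⊆ hull K p' := C.body.far_union_subset C.first.1 C.last.1 p'
  have hAc : IsClosed A := (C.body.isClosed_far x y).union (IsConvexBody.isClosed_triangle p' x y)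
  have hH := C.body.hull p'
  have hHR : ∀ w ∈ hull K p', ‖w‖ ≤ R := by
    have : hull K p' ⊆ Metric.closedBall 0 R := by
      refine convexHull_min ?_ (convex_closedBall 0 R)
      rintro w (rfl | hw)
      · simpa using hp'
      · simpa using hR w hw
    intro w hw; simpa using this hw
  have hint : IntegrableOn (fun w : Plane => w) (hull K p') :=
    continuous_id.continuousOn.integrableOn_compact hH.isCompact
  have e1 : ∫ w in hull K p', w = (∫ w in A, w) + ∫ w in hull K p' \ A, w := by
    rw [setIntegral_sdiff hAc.measurableSet hint hAs]; abel
  have hvA : volume.real A = volume.real (hull K p) + 1 / 2 * det (p' - p) (y - x) := by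
    rw [hA, C.body.volume_real_far_union hpos, C.volume_hull, IsContactPair.det_sub_eq p p']; ring
  have hvD : volume.real (hull K p' \ A) = -(1 / 2 * det (p' - p) (y - x)) := by
    have h1 := measureReal_sdiff_add_inter (μ := volume) (s := hull K p') (t := A)
      hAc.measurableSet hH.isCompact.measure_lt_top.ne
    rw [inter_eq_right.2 hAs] at h1
    linarith
  set ε := -(1 / 2 * det (p' - p) (y - x)) with hε
  have hε0 : 0 ≤ ε := hvD ▸ measureReal_nonneg
  have hε1 : 2 * ε ≤ ‖p' - p‖ * ‖(y' - x') - (y - x)‖ := by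
    have h1 := C'.le_volume_hull p
    have h2 : det (p - p') (y' - x') = -det (p' - p) (y' - x') := by
      rw [← neg_sub, det_neg_left]
    have h3 := (abs_le.1 (abs_det_le (p' - p) ((y' - x') - (y - x)))).2
    rw [det_sub_right] at h3
    linarith
  have h2 : ‖∫ w in hull K p' \ A, w‖ ≤ R * ε := by
    rw [← hvD]
    exact norm_setIntegral_le_of_norm_le_const
      ((measure_mono sdiff_subset).trans_lt hH.isCompact.measure_lt_top) fun w hw => hHR w hw.1
  have e2 : (∫ w in A, w) - (∫ w in hull K p, w) - (det (y - p) (x - p) / 6) • (p' - p) =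
      -((ε / 3) • (p' + y + x)) := by
    rw [hA, C.body.moment_far_union hpos, C.moment_hull, IsContactPair.det_sub_eq p p']
    have : det (p' - p) (y - x) = -2 * ε := by rw [hε]; ring
    rw [this]
    module
  have h3 : ‖(ε / 3) • (p' + y + x)‖ ≤ R * ε := by
    rw [norm_smul, Real.norm_of_nonneg (by positivity)]
    have : ‖p' + y + x‖ ≤ R + R + R :=
      norm_add₃_le.trans (add_le_add (add_le_add hp' (hR y C.last.1)) (hR x C.first.1))
    nlinarith
  rw [e1, show (∫ w in A, w) + (∫ w in hull K p' \ A, w) - (∫ w in hull K p, w) -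
      (det (y - p) (x - p) / 6) • (p' - p) = ((∫ w in A, w) - (∫ w in hull K p, w) -
      (det (y - p) (x - p) / 6) • (p' - p)) + ∫ w in hull K p' \ A, w by abel, e2]
  calc _ ≤ ‖-((ε / 3) • (p' + y + x))‖ + ‖∫ w in hull K p' \ A, w‖ := norm_add_le _ _
    _ ≤ R * ε + R * ε := by rw [norm_neg]; exact add_le_add h3 h2
    _ = R * (2 * ε) := by ring
    _ ≤ _ := mul_le_mul_of_nonneg_left hε1 hR0

/-! ### Comparison of regions by their sections -/

lemma isCompact_section {A : Set (ℝ × ℝ)} (hA : IsCompact A) (l : ℝ) :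
    IsCompact {m | (l, m) ∈ A} := by
  have : {m | (l, m) ∈ A} = Prod.snd '' (A ∩ {z | z.1 = l}) := by
    ext m
    constructor
    · intro hm
      exact ⟨(l, m), ⟨hm, rfl⟩, rfl⟩
    · rintro ⟨⟨a, b⟩, ⟨h1, h2⟩, rfl⟩
      obtain rfl : a = l := h2
      exact h1
  rw [this]
  exact (hA.inter_right (isClosed_eq continuous_fst continuous_const)).image continuous_snd

/-- Cavalieri's principle for a function of the height. -/
lemma setIntegral_height {A : Set (ℝ × ℝ)} (hA : IsCompact A) {g : ℝ → ℝ} (hg : Continuous g) :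
    Integrable (fun l => g l * volume.real {m | (l, m) ∈ A}) ∧
      ∫ z in A, g z.1 = ∫ l, g l * volume.real {m | (l, m) ∈ A} := by
  have hm := hA.isClosed.measurableSet
  have hi : Integrable (A.indicator fun z : ℝ × ℝ => g z.1) (volume.prod volume) :=
    (integrable_indicator_iff hm).2
      (((hg.comp continuous_fst).continuousOn).integrableOn_compact hA)
  have e (l : ℝ) : ∫ m, A.indicator (fun z : ℝ × ℝ => g z.1) (l, m) =
      g l * volume.real {m | (l, m) ∈ A} := by
    have h1 : (fun m => A.indicator (fun z : ℝ × ℝ => g z.1) (l, m)) =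
        {m | (l, m) ∈ A}.indicator fun _ => g l := rfl
    rw [h1, integral_indicator (isCompact_section hA l).isClosed.measurableSet,
      setIntegral_const, smul_eq_mul, mul_comm]
  refine ⟨hi.integral_prod_left.congr (Filter.Eventually.of_forall e), ?_⟩
  rw [← integral_indicator hm, Measure.volume_eq_prod, integral_prod _ hi]
  exact integral_congr_ae (Filter.Eventually.of_forall e)

/-- The region `A` has, above height `0`, the sections of a triangle with apex at height `1`. A
convex region `A'` of the same area that contains the base of the triangle and the part of `A`
below the base, but stays strictly below the apex, has a lower centroid. The reason is that the
lengths of the sections of `A'` exceed those of `A` up to some height and fall short of them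
above it. -/
lemma integral_height_lt {A A' : Set (ℝ × ℝ)} (hA : IsCompact A) (hA' : IsCompact A')
    (hconv : Convex ℝ A') (h0 : ((0, 0) : ℝ × ℝ) ∈ A') (h1 : ((0, 1) : ℝ × ℝ) ∈ A')
    (hlow : ∀ z ∈ A, z.1 ≤ 0 → z ∈ A')
    (hup : ∀ l m, 0 < l → ((l, m) ∈ A ↔ 0 ≤ m ∧ m ≤ 1 - l)) {L : ℝ} (hL0 : 0 ≤ L) (hL : L < 1)
    (hmax : ∀ z ∈ A', z.1 ≤ L) (hvol : volume.real A' = volume.real A) :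
    ∫ z in A', z.1 < ∫ z in A, z.1 := by
  set f : ℝ → ℝ := fun l => volume.real {m | (l, m) ∈ A} with hf
  set f' : ℝ → ℝ := fun l => volume.real {m | (l, m) ∈ A'} with hf'
  have fin' (l : ℝ) : volume {m | (l, m) ∈ A'} ≠ ⊤ := (isCompact_section hA' l).measure_lt_top.ne
  have hf0 (l : ℝ) (hl : 0 < l) : f l = max (1 - l) 0 := by
    have : {m | (l, m) ∈ A} = Icc 0 (1 - l) := by ext m; exact hup l m hl
    simp only [hf, this, Real.volume_real_Icc, sub_zero]
  have hf'0 (l : ℝ) (hl : L < l) : f' l = 0 := by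
    have : {m | (l, m) ∈ A'} = ∅ := by
      ext m
      simp only [mem_ofPred_eq, mem_empty_iff_false, iff_false]
      intro hm; exact absurd (hmax _ hm) (not_le.2 hl)
    simp only [hf', this, measureReal_empty]
  -- once the section of the convex region `A'` is shorter than that of the triangle, it stays
  -- shorter, since `A'` contains the base
  have hcross (l₁ l : ℝ) (h10 : 0 < l₁) (h1l : l₁ < l) (hlt : f' l₁ < 1 - l₁) : f' l ≤ f l := by
    rw [hf0 l (h10.trans h1l)]
    by_contra! hcon
    obtain ⟨hc1, hc2⟩ := max_lt_iff.1 hcon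
    have hI := isCompact_section hA' l
    have hne : {m | (l, m) ∈ A'}.Nonempty := by
      rw [nonempty_iff_ne_empty]
      intro e
      simp only [hf', e, measureReal_empty] at hc2
      exact lt_irrefl _ hc2
    have ha := hI.sInf_mem hne
    have hb := hI.sSup_mem hne
    set a := sInf {m | (l, m) ∈ A'}
    set b := sSup {m | (l, m) ∈ A'}
    have hab : a ≤ b := csInf_le hI.bddBelow hb
    have e1 : f' l ≤ b - a := by
      have : {m | (l, m) ∈ A'} ⊆ Icc a b :=
        fun m hm => ⟨csInf_le hI.bddBelow hm, le_csSup hI.bddAbove hm⟩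
      have := measureReal_mono (μ := volume) this isCompact_Icc.measure_lt_top.ne
      rwa [Real.volume_real_Icc_of_le hab] at this
    have hl : 0 < l := h10.trans h1l
    set τ := l₁ / l with hτ
    have hτ0 : 0 < τ := by positivity
    have hτ1 : τ < 1 := by rw [hτ, div_lt_one hl]; exact h1l
    have hτl : τ * l = l₁ := by rw [hτ]; field_simp
    have m1 : (l₁, τ * a) ∈ A' := by
      have := hconv.add_smul_sub_mem h0 ha ⟨hτ0.le, hτ1.le⟩
      convert this using 1
      simp [hτl]
    have m2 : (l₁, τ * b + (1 - τ)) ∈ A' := by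
      have := hconv.add_smul_sub_mem h1 hb ⟨hτ0.le, hτ1.le⟩
      convert this using 1
      simp only [Prod.mk_sub_mk, Prod.smul_mk, Prod.mk_add_mk, smul_eq_mul, sub_zero, zero_add, hτl]
      congr 1; ring
    have hsub : Icc (τ * a) (τ * b + (1 - τ)) ⊆ {m | (l₁, m) ∈ A'} := by
      have hc : Convex ℝ {m | (l₁, m) ∈ A'} := by
        intro u hu v hv c d hc hd hcd
        have := hconv hu hv hc hd hcd
        have e : c • (l₁, u) + d • (l₁, v) = (l₁, c • u + d • v) := by
          ext
          · simp only [Prod.smul_mk, Prod.mk_add_mk, smul_eq_mul]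
            rw [← add_mul, hcd, one_mul]
          · simp
        rwa [e] at this
      exact hc.ordConnected.out m1 m2
    have e2 := measureReal_mono (μ := volume) hsub (fin' l₁)
    rw [Real.volume_real_Icc_of_le (by nlinarith)] at e2
    have e3 : τ * b + (1 - τ) - τ * a ≤ f' l₁ := e2
    nlinarith
  -- `s` is the height at which the lengths of the sections cross
  set B := {l | 0 < l ∧ f' l < 1 - l} with hB
  have hBmem (l : ℝ) (hl : l ∈ Ioo L 1) : l ∈ B :=
    ⟨hL0.trans_lt hl.1, by rw [hf'0 l hl.1]; linarith [hl.2]⟩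
  have hBne : B.Nonempty := ⟨(L + 1) / 2, hBmem _ ⟨by linarith, by linarith⟩⟩
  have hBb : BddBelow B := ⟨0, fun l hl => hl.1.le⟩
  set s := sInf B with hs
  have hs0 : 0 ≤ s := le_csInf hBne fun l hl => hl.1.le
  have hsL : s ≤ L := by
    refine le_of_forall_pos_le_add fun ε hε => ?_
    refine (csInf_le hBb (hBmem (min (L + ε) ((L + 1) / 2)) ⟨?_, ?_⟩)).trans (min_le_left _ _)
    · rw [lt_min_iff]; constructor <;> linarith
    · exact (min_le_right _ _).trans_lt (by linarith)
  -- moments are taken about the height `s`; the areas being equal, this does not matter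
  have hsign (l : ℝ) : 0 ≤ (l - s) * f l - (l - s) * f' l := by
    rw [← mul_sub]
    rcases lt_trichotomy l s with hl | rfl | hl
    · refine mul_nonneg_of_nonpos_of_nonpos (by linarith) (sub_nonpos.2 ?_)
      rcases le_or_gt l 0 with hl0 | hl0
      · exact measureReal_mono (fun m hm => hlow _ hm hl0) (fin' l)
      · have : l ∉ B := fun hlB => absurd (csInf_le hBb hlB) (not_le.2 hl)
        simp only [hB, mem_ofPred_eq, not_and, not_lt] at this
        rw [hf0 l hl0, max_eq_left (by linarith)]
        exact this hl0
    · simp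
    · obtain ⟨l₁, hl₁, hlt⟩ := exists_lt_of_csInf_lt hBne hl
      exact mul_nonneg (by linarith) (sub_nonneg.2 (hcross l₁ l hl₁.1 hlt hl₁.2))
  have hg : Continuous fun l : ℝ => l - s := by fun_prop
  obtain ⟨i1, e1⟩ := setIntegral_height hA hg
  obtain ⟨i2, e2⟩ := setIntegral_height hA' hg
  have hpos : 0 < ∫ l, ((l - s) * f l - (l - s) * f' l) := by
    rw [integral_pos_iff_support_of_nonneg hsign (i1.sub i2)]
    refine lt_of_lt_of_le ?_ (measure_mono (s := Ioo L 1) fun l hl => ?_)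
    · simp [hL]
    · have hl0 : 0 < l := hL0.trans_lt hl.1
      rw [Function.mem_support, hf'0 l hl.1, hf0 l hl0, max_eq_left (by linarith [hl.2]), mul_zero,
        sub_zero]
      have h3 : 0 < l - s := by linarith [hl.1]
      have h4 : 0 < 1 - l := by linarith [hl.2]
      positivity
  rw [integral_sub i1 i2, ← e1, ← e2] at hpos
  have hint (E : Set (ℝ × ℝ)) (hE : IsCompact E) :
      ∫ z in E, (z.1 - s) = (∫ z in E, z.1) - volume.real E * s := by
    rw [integral_sub (continuous_fst.continuousOn.integrableOn_compact hE)
      (continuous_const.continuousOn.integrableOn_compact hE), setIntegral_const, smul_eq_mul]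
  rw [hint A hA, hint A' hA', hvol] at hpos
  linarith

namespace IsContactPair

variable {K : Set Plane} {p x y : Plane} (C : IsContactPair K p x y)
include C

lemma mem_of_mem_hull {w : Plane} (hw : w ∈ hull K p) (h0 : 0 ≤ det (y - x) (w - x)) : w ∈ K := by
  rw [C.hull_eq] at hw
  rcases hw with hw | hw
  · exact hw.1
  · have hD := C.det_pos
    obtain ⟨h1, h2, h3⟩ := (mem_triangle_iff hD).1 hw
    have e : det (w - p) (x - p) + det (y - p) (w - p) - det (y - p) (x - p) =
      det (y - x) (w - x) := by simp only [det, PiLp.sub_apply]; ring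
    have hcr := cramer (y - p) (x - p) (w - p)
    have e3 : det (y - p) (w - p) = det (y - p) (x - p) - det (w - p) (x - p) := by linarith
    have := C.body.convex.add_smul_sub_mem C.first.1 C.last.1
      (t := det (w - p) (x - p) / det (y - p) (x - p))
      ⟨by positivity, by rw [div_le_one hD]; linarith⟩
    convert this using 1
    rw [e3] at hcr
    set D := det (y - p) (x - p)
    clear_value D
    generalize det (w - p) (x - p) = a at *
    have : w - p = D⁻¹ • (D • (w - p)) := by rw [smul_smul, inv_mul_cancel₀ hD.ne', one_smul]
    rw [hcr] at this
    rw [← sub_add_cancel w p, this]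
    match_scalars <;> field_simp <;> ring

lemma height_lt {w : Plane} (hw : w ∈ K) : det (w - x) (y - x) < det (y - p) (x - p) := by
  have h1 := C.first.2 w hw
  have h2 := C.last.2 w hw
  have e : det (w - p) (x - p) + det (y - p) (w - p) - det (y - p) (x - p) =
      -det (w - x) (y - x) := by simp only [det, PiLp.sub_apply]; ring
  refine lt_of_le_of_ne (by linarith) fun e2 => C.notMem ?_
  have hcr := cramer (y - p) (x - p) (w - p)
  rw [show det (w - p) (x - p) = 0 by linarith, show det (y - p) (w - p) = 0 by linarith,
    zero_smul, zero_smul, zero_add] at hcr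
  rw [← sub_eq_zero.1 ((smul_eq_zero.1 hcr).resolve_left C.det_pos.ne')]
  exact hw

/-- Among the hulls of a given area, the one whose apex is highest over the chord of contact has
the highest centroid. -/
lemma det_moment_hull_lt {p' : Plane} (hF : volume.real (hull K p') = volume.real (hull K p))
    (hlev : det (p' - p) (y - x) < 0) :
    det ((∫ w in hull K p', w) - ∫ w in hull K p, w) (y - x) < 0 := by
  have hD := C.det_pos
  set D := det (y - p) (x - p) with hDdef
  have eD : det (p - x) (y - x) = D := by simp only [hDdef, det, PiLp.sub_apply]; ring
  -- affine coordinates with the chord of contact at height `0` and `p` at height `1`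
  set ψ : ℝ × ℝ → Plane := fun z => x + z.1 • (p - x) + z.2 • (y - x) with hψ
  set χ : Plane → ℝ × ℝ := fun w => (det (w - x) (y - x) / D, det (p - x) (w - x) / D) with hχ
  have hψl (z : ℝ × ℝ) : det (ψ z - x) (y - x) = z.1 * D := by
    rw [← eD]; simp only [hψ, det, PiLp.sub_apply, PiLp.add_apply, PiLp.smul_apply, smul_eq_mul]
    ring
  have hψm (z : ℝ × ℝ) : det (p - x) (ψ z - x) = z.2 * D := by
    rw [← eD]; simp only [hψ, det, PiLp.sub_apply, PiLp.add_apply, PiLp.smul_apply, smul_eq_mul]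
    ring
  have hχψ (z : ℝ × ℝ) : χ (ψ z) = z := by
    simp only [hχ, hψl, hψm]
    rw [mul_div_cancel_right₀ _ hD.ne', mul_div_cancel_right₀ _ hD.ne']
  have hψχ (w : Plane) : ψ (χ w) = w := by
    have hcr := cramer (p - x) (y - x) (w - x)
    rw [eD] at hcr
    have : w - x = D⁻¹ • (D • (w - x)) := by rw [smul_smul, inv_mul_cancel₀ hD.ne', one_smul]
    rw [hcr] at this
    nth_rewrite 2 [← sub_add_cancel w x]
    rw [this]
    simp only [hψ, hχ]
    match_scalars <;> field_simp
    ring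
  have hχc : Continuous χ := by
    simp only [hχ]
    fun_prop
  have hmem (S : Set Plane) (z : ℝ × ℝ) : z ∈ χ '' S ↔ ψ z ∈ S := by
    constructor
    · rintro ⟨w, hw, rfl⟩; rwa [hψχ]
    · intro hz; exact ⟨_, hz, hχψ z⟩
  have hpre (S : Set Plane) : ψ '' (χ '' S) = S := by
    rw [← image_comp]
    rw [show ψ ∘ χ = id from funext hψχ, image_id]
  have hd (z : ℝ × ℝ) : HasFDerivAt ψ ((ContinuousLinearMap.fst ℝ ℝ ℝ).smulRight (p - x) +
      (ContinuousLinearMap.snd ℝ ℝ ℝ).smulRight (y - x)) z :=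
    ((((ContinuousLinearMap.fst ℝ ℝ ℝ).smulRight (p - x)).hasFDerivAt (x := z)).const_add x).add
      (((ContinuousLinearMap.snd ℝ ℝ ℝ).smulRight (y - x)).hasFDerivAt (x := z))
  have hint (S : Set Plane) (hS : IsCompact S) (g : Plane → ℝ) :
      ∫ w in S, g w = D * ∫ z in χ '' S, g (ψ z) := by
    conv_lhs => rw [← hpre S]
    rw [setIntegral_image_plane (hS.image hχc).isClosed.measurableSet (fun z _ => hd z)
      (Function.LeftInverse.injective hχψ).injOn, ← integral_const_mul]
    congr 1
    ext1 z
    simp [eD, abs_of_pos hD]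
  have hvol (S : Set Plane) (hS : IsCompact S) : volume.real S = D * volume.real (χ '' S) := by
    have := hint S hS fun _ => 1
    simpa using this
  have hH := C.body.hull p
  have hH' := C.body.hull p'
  have hlev' : det (p' - x) (y - x) < D := by
    have : det (p' - x) (y - x) = det (p' - p) (y - x) + det (p - x) (y - x) := by
      rw [← det_add_left]; congr 1; abel
    linarith
  obtain ⟨w₀, hw₀, hmax⟩ := hH'.isCompact.exists_isMaxOn
    (hH'.interior_nonempty.mono interior_subset)
    (f := fun w => det (w - x) (y - x)) (by fun_prop)
  have hw₀D : det (w₀ - x) (y - x) < D := by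
    obtain ⟨k, hk, r, ⟨hr0, hr1⟩, rfl⟩ := C.body.mem_hull_iff.1 hw₀
    have h1 := C.height_lt hk
    have e : det (p' + r • (k - p') - x) (y - x) =
        (1 - r) * det (p' - x) (y - x) + r * det (k - x) (y - x) := by
      simp only [det, PiLp.sub_apply, PiLp.add_apply, PiLp.smul_apply, smul_eq_mul]; ring
    rw [e]
    rcases hr0.eq_or_lt with rfl | hr0
    · linarith
    · nlinarith
  have key := integral_height_lt (hH.isCompact.image hχc) (hH'.isCompact.image hχc)
    (L := max (det (w₀ - x) (y - x) / D) 0) ?_ ?_ ?_ ?_ ?_ (le_max_right _ _) ?_ ?_ ?_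
  · have hM (q : Plane) : det ((∫ w in hull K q, w) - (volume.real (hull K q)) • x) (y - x) =
        D * (D * ∫ z in χ '' hull K q, z.1) := by
      have hq := (C.body.hull q).isCompact
      have hi : IntegrableOn (fun w : Plane => w) (hull K q) :=
        continuous_id.continuousOn.integrableOn_compact hq
      have hic : IntegrableOn (fun w : Plane => w - x) (hull K q) :=
        (continuous_id.sub continuous_const).continuousOn.integrableOn_compact hq
      have e1 : (∫ w in hull K q, w) - (volume.real (hull K q)) • x =
          ∫ w in hull K q, (w - x) := by
        rw [integral_sub hi (continuous_const.continuousOn.integrableOn_compact hq),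
          setIntegral_const]
      have e2 := (detL (y - x)).integral_comp_comm hic
      have e3 : det (∫ w in hull K q, (w - x)) (y - x) =
          ∫ w in hull K q, det (w - x) (y - x) := by
        rw [det_swap, ← detL_apply, ← e2, ← integral_neg]
        congr 1; ext1 w
        rw [det_swap, detL_apply]
      rw [e1, e3, hint _ hq]
      congr 1
      rw [← integral_const_mul]
      congr 1; ext1 z
      rw [hψl, mul_comm]
    have h1 := hM p'
    have h2 := hM p
    rw [hF, det_sub_left] at h1
    rw [det_sub_left] at h2 ⊢
    have := mul_lt_mul_of_pos_left (mul_lt_mul_of_pos_left key hD) hD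
    linarith
  · intro u hu v hv a b ha hb hab
    rw [hmem] at hu hv ⊢
    have := hH'.convex hu hv ha hb hab
    convert this using 1
    simp only [hψ, Prod.fst_add, Prod.snd_add, Prod.smul_fst, Prod.smul_snd, smul_eq_mul]
    have : b = 1 - a := by linarith
    subst this
    module
  · rw [hmem]
    simpa [hψ] using subset_hull K p' C.first.1
  · rw [hmem]
    simpa [hψ] using subset_hull K p' C.last.1
  · intro z hz hz0
    rw [hmem] at hz ⊢
    refine subset_hull K p' (C.mem_of_mem_hull hz ?_)
    rw [det_swap, hψl]
    nlinarith
  · intro l m hl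
    rw [hmem]
    have e1 : det (ψ (l, m) - p) (x - p) = m * D := by
      rw [← eD]; simp only [hψ, det, PiLp.sub_apply, PiLp.add_apply, PiLp.smul_apply, smul_eq_mul]
      ring
    have e2 : det (y - p) (ψ (l, m) - p) = (1 - l - m) * D := by
      rw [← eD]; simp only [hψ, det, PiLp.sub_apply, PiLp.add_apply, PiLp.smul_apply, smul_eq_mul]
      ring
    have hfar : ψ (l, m) ∉ far K x y := by
      rintro ⟨-, h2⟩
      rw [det_swap, hψl] at h2
      have := mul_pos hl hD
      simp only at h2
      linarith
    rw [C.hull_eq, mem_union, or_iff_right hfar, mem_triangle_iff hD, e1, e2]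
    constructor
    · rintro ⟨h1, h2, -⟩
      exact ⟨nonneg_of_mul_nonneg_left h1 hD, by linarith [nonneg_of_mul_nonneg_left h2 hD]⟩
    · rintro ⟨h1, h2⟩
      refine ⟨by positivity, mul_nonneg (by linarith) hD.le, ?_⟩
      have := mul_pos hl hD
      rw [← hDdef]
      linarith
  · rw [max_lt_iff]
    exact ⟨by rwa [div_lt_one hD], zero_lt_one⟩
  · intro z hz
    rw [hmem] at hz
    refine le_max_of_le_left ?_
    have := isMaxOn_iff.1 hmax _ hz
    rw [hψl] at this
    rwa [le_div_iff₀ hD]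
  · have h1 := hvol _ hH.isCompact
    have h2 := hvol _ hH'.isCompact
    rw [hF, h1] at h2
    exact (mul_left_cancel₀ hD.ne' h2).symm

end IsContactPair

/-! ### The curve of illumination -/

namespace IsConvexBody

variable {K : Set Plane} (hK : IsConvexBody K)
include hK

lemma volume_lt_hull {p : Plane} (hp : p ∉ K) : volume.real K < volume.real (Flotation.hull K p) := by
  by_contra hcon
  apply hp
  rw [(hK.hull p).eq_of_volume_le hK.isClosed (subset_hull K p) (not_lt.1 hcon)]
  exact mem_hull K p

lemma volume_hull_of_mem {p : Plane} (hp : p ∈ K) :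
    volume.real (Flotation.hull K p) = volume.real K := by rw [hK.hull_eq_of_mem hp]

lemma mem_illuminationCurve_iff {δ : ℝ} (hδ : 0 < δ) {p : Plane} :
    p ∈ illuminationCurve K δ ↔ volume.real (Flotation.hull K p) = volume.real K + δ := by
  have hfin : volume (silhouetteCone K p) ≠ ⊤ :=
    ((measure_mono sdiff_subset).trans_lt (hK.hull p).isCompact.measure_lt_top).ne
  have h1 := measureReal_sdiff_add_inter (μ := volume) (s := Flotation.hull K p) (t := K)
    hK.isClosed.measurableSet (hK.hull p).isCompact.measure_lt_top.ne
  rw [inter_eq_right.2 (subset_hull K p)] at h1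
  rw [illuminationCurve, mem_ofPred_eq, ← ENNReal.ofReal_toReal hfin,
    ENNReal.ofReal_eq_ofReal_iff ENNReal.toReal_nonneg hδ.le]
  change volume.real (Flotation.hull K p \ K) = δ ↔ _
  constructor <;> intro h <;> linarith

lemma notMem_of_mem_illuminationCurve {δ : ℝ} (hδ : 0 < δ) {p : Plane}
    (hp : volume.real (Flotation.hull K p) = volume.real K + δ) : p ∉ K := fun h => by
  rw [hK.volume_hull_of_mem h] at hp; linarith

lemma centroid_silhouetteCone {δ : ℝ} {p : Plane}
    (hp : volume.real (Flotation.hull K p) = volume.real K + δ) :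
    centroid (silhouetteCone K p) =
      δ⁻¹ • ((∫ w in Flotation.hull K p, w) - ∫ w in K, w) := by
  have h1 := measureReal_sdiff_add_inter (μ := volume) (s := Flotation.hull K p) (t := K)
    hK.isClosed.measurableSet (hK.hull p).isCompact.measure_lt_top.ne
  rw [inter_eq_right.2 (subset_hull K p)] at h1
  have h2 : volume.real (silhouetteCone K p) = δ := by
    change volume.real (Flotation.hull K p \ K) = δ
    linarith
  rw [centroid_eq, h2]
  congr 1
  exact setIntegral_sdiff hK.isClosed.measurableSet
    (continuous_id.continuousOn.integrableOn_compact (hK.hull p).isCompact) (subset_hull K p)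

end IsConvexBody

namespace IsCcwParam

variable {K : Set Plane} {γ : ℝ → Plane} {L : ℝ} (h : IsCcwParam K γ L)
include h

lemma exists_det_pos (s : ℝ) : ∃ w ∈ K, 0 < det (deriv γ s) (w - γ s) := by
  obtain ⟨w, hw⟩ := h.body.interior_nonempty
  exact ⟨w, interior_subset hw, h.interior_pos hw s⟩

/-- The point `γ s` is the first point of contact from `p` if and only if `p` lies on the forward
half of the tangent at `γ s`. -/
lemma first_iff {p : Plane} (hp : p ∉ K) {s : ℝ} :
    IsFirstContact K p (γ s) ↔ ∃ a : ℝ, 0 < a ∧ p = γ s + a • deriv γ s := by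
  have e (w : Plane) : det (w - p) (γ s - p) = det (p - γ s) (w - γ s) := by
    simp only [det, PiLp.sub_apply]; ring
  constructor
  · rintro ⟨-, hr⟩
    simp only [e] at hr
    have h0 := h.support_unique hr
    obtain ⟨a, ha⟩ := exists_smul_of_det_eq_zero (h.param.regular s) (b := p - γ s)
      (by rw [det_swap, h0, neg_zero])
    refine ⟨a, ?_, by rw [← ha]; abel⟩
    obtain ⟨w, hw, hpos⟩ := h.exists_det_pos s
    have h1 := hr w hw
    rw [ha, det_smul_left] at h1
    refine lt_of_le_of_ne (nonneg_of_mul_nonneg_left h1 hpos) fun ha0 => hp ?_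
    rw [← ha0, zero_smul, sub_eq_zero] at ha
    rw [ha]; exact h.mem s
  · rintro ⟨a, ha, rfl⟩
    refine ⟨h.mem s, fun w hw => ?_⟩
    rw [e, add_sub_cancel_left, det_smul_left]
    exact mul_nonneg ha.le (h.ccw s w hw)

/-- The point `γ t` is the last point of contact from `p` if and only if `p` lies on the backward
half of the tangent at `γ t`. -/
lemma last_iff {p : Plane} (hp : p ∉ K) {t : ℝ} :
    IsLastContact K p (γ t) ↔ ∃ b : ℝ, 0 < b ∧ p = γ t - b • deriv γ t := by
  have e (w : Plane) : det (γ t - p) (w - p) = det (γ t - p) (w - γ t) := by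
    simp only [det, PiLp.sub_apply]; ring
  constructor
  · rintro ⟨-, hr⟩
    simp only [e] at hr
    have h0 := h.support_unique hr
    obtain ⟨b, hb⟩ := exists_smul_of_det_eq_zero (h.param.regular t) (b := γ t - p)
      (by rw [det_swap, h0, neg_zero])
    refine ⟨b, ?_, by rw [← hb]; abel⟩
    obtain ⟨w, hw, hpos⟩ := h.exists_det_pos t
    have h1 := hr w hw
    rw [hb, det_smul_left] at h1
    refine lt_of_le_of_ne (nonneg_of_mul_nonneg_left h1 hpos) fun hb0 => hp ?_
    rw [← hb0, zero_smul, sub_eq_zero] at hb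
    rw [← hb]; exact h.mem t
  · rintro ⟨b, hb, rfl⟩
    refine ⟨h.mem t, fun w hw => ?_⟩
    rw [e, sub_sub_cancel, det_smul_left]
    exact mul_nonneg hb.le (h.ccw t w hw)

lemma exists_eq_of_first {p x : Plane} (hp : p ∉ K) (hx : IsFirstContact K p x) (a : ℝ) :
    ∃ s ∈ Ico a (a + L), γ s = x := by
  refine h.param.exists_param (h.body.mem_frontier_of_det (n := p - x) ?_ hx.1 fun w hw => ?_) a
  · rw [sub_ne_zero]; rintro rfl; exact hp hx.1
  · have := hx.2 w hw
    have e : det (w - p) (x - p) = det (p - x) (w - x) := by simp only [det, PiLp.sub_apply]; ring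
    linarith

lemma exists_eq_of_last {p y : Plane} (hp : p ∉ K) (hy : IsLastContact K p y) (a : ℝ) :
    ∃ t ∈ Ico a (a + L), γ t = y := by
  refine h.param.exists_param (h.body.mem_frontier_of_det (n := y - p) ?_ hy.1 fun w hw => ?_) a
  · rw [sub_ne_zero]; rintro rfl; exact hp hy.1
  · have := hy.2 w hw
    have e : det (y - p) (w - p) = det (y - p) (w - y) := by simp only [det, PiLp.sub_apply]; ring
    linarith

lemma isContactChord_iff {p : Plane} (hp : p ∉ K) {s t : ℝ} :
    IsContactChord γ p s t ↔ IsContactPair K p (γ s) (γ t) := by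
  constructor
  · rintro ⟨h1, h2, h3⟩
    obtain ⟨a, ha⟩ := exists_smul_of_det_eq_zero (h.param.regular s) (b := p - γ s)
      (by rw [det_swap, h1, neg_zero])
    obtain ⟨b, hb⟩ := exists_smul_of_det_eq_zero (h.param.regular t) (b := γ t - p)
      (by rw [← neg_sub, det_neg_right, det_swap, h2]; simp)
    have e1 := h.ccw s _ (h.mem t)
    have e2 := h.ccw t _ (h.mem s)
    rw [show γ t - γ s = (p - γ s) + (γ t - p) by abel, ha, hb, det_add_right, det_smul_right,
      det_smul_right, det_self] at e1
    rw [show γ s - γ t = -(p - γ s) - (γ t - p) by abel, ha, hb, det_sub_right, det_neg_right,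
      det_smul_right, det_smul_right, det_self, det_swap] at e2
    rw [← neg_sub p (γ s), ha, hb, det_neg_right, det_smul_left, det_smul_right, det_swap] at h3
    set d := det (deriv γ s) (deriv γ t)
    have h3' : 0 < b * (a * d) := by linarith
    have ha0 : a ≠ 0 := by rintro rfl; simp at h3'
    have hb0 : b ≠ 0 := by rintro rfl; simp at h3'
    have hbd : 0 ≤ b * d := by linarith
    have had : 0 ≤ a * d := by linarith
    have hb1 : 0 < b := pos_of_mul_pos_left h3' had
    have ha1 : 0 < a := pos_of_mul_pos_left (by linarith : 0 < a * (b * d)) hbd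
    exact ⟨h.body, hp, (h.first_iff hp).2 ⟨a, ha1, by rw [← ha]; abel⟩,
      (h.last_iff hp).2 ⟨b, hb1, by rw [← hb]; abel⟩⟩
  · intro C
    obtain ⟨a, ha, e1⟩ := (h.first_iff hp).1 C.first
    obtain ⟨b, hb, e2⟩ := (h.last_iff hp).1 C.last
    refine ⟨?_, ?_, C.det_pos⟩
    · nth_rewrite 1 [e1]
      rw [add_sub_cancel_left, det_smul_left, det_self, mul_zero]
    · nth_rewrite 1 [e2]
      rw [sub_sub_cancel_left, det_neg_left, det_smul_left, det_self, mul_zero, neg_zero]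

/-- The chord of contact in terms of the tangents at its endpoints; the tangents are not parallel.
-/
lemma contact_coords {p : Plane} {s t : ℝ} (C : IsContactPair K p (γ s) (γ t)) :
    ∃ a b : ℝ, 0 < a ∧ 0 < b ∧ p = γ s + a • deriv γ s ∧ p = γ t - b • deriv γ t ∧
      0 < det (deriv γ s) (deriv γ t) ∧
      det (deriv γ s) (γ t - γ s) = b * det (deriv γ s) (deriv γ t) ∧
      det (γ t - γ s) (deriv γ t) = a * det (deriv γ s) (deriv γ t) ∧
      det (γ t - p) (γ s - p) = a * b * det (deriv γ s) (deriv γ t) := by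
  obtain ⟨a, ha, e1⟩ := (h.first_iff C.notMem).1 C.first
  obtain ⟨b, hb, e2⟩ := (h.last_iff C.notMem).1 C.last
  have ec : γ t - γ s = a • deriv γ s + b • deriv γ t := by
    have : γ s + a • deriv γ s = γ t - b • deriv γ t := e1.symm.trans e2
    rw [eq_sub_iff_add_eq] at this
    rw [← this]; abel
  have h4 : det (γ t - p) (γ s - p) = a * b * det (deriv γ s) (deriv γ t) := by
    rw [show γ t - p = b • deriv γ t by rw [e2]; abel,
      show γ s - p = -(a • deriv γ s) by rw [e1]; abel, det_neg_right, det_smul_left,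
      det_smul_right, det_swap]
    ring
  refine ⟨a, b, ha, hb, e1, e2, ?_, ?_, ?_, h4⟩
  · have := C.det_pos
    rw [h4] at this
    exact pos_of_mul_pos_right this (by positivity)
  · rw [ec, det_add_right, det_smul_right, det_smul_right, det_self, mul_zero, zero_add]
  · rw [ec, det_add_left, det_smul_left, det_smul_left, det_self, mul_zero, add_zero]

lemma affineDist_contact {p : Plane} {s t : ℝ} (C : IsContactPair K p (γ s) (γ t)) :
    affineDist (γ s) (deriv γ s) (γ t) (deriv γ t) ^ 3 = 4 * det (γ t - p) (γ s - p) := by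
  obtain ⟨a, b, ha, hb, -, -, hd, h1, h2, h3⟩ := h.contact_coords C
  rw [affineDist_pow_three, h1, h2, h3]
  field_simp

/-- A curve of constant area of the hull meets the line through its point `p` parallel to the chord
of contact only in `p`: the tangents to `K` at the points of contact are unique. -/
lemma det_neg_of_volume_eq {p p' x y : Plane} (C : IsContactPair K p x y)
    (hF : volume.real (hull K p') = volume.real (hull K p)) (hne : p' ≠ p) :
    det (p' - p) (y - x) < 0 := by
  have h1 := C.le_volume_hull p'
  refine lt_of_le_of_ne (by linarith) fun h0 => hne ?_
  have hD := C.det_pos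
  have hD' := IsContactPair.det_sub_eq p p' x y
  rw [h0, add_zero] at hD'
  have hp' : p' ∉ K := fun hm => by
    have := h.body.volume_lt_hull C.notMem
    rw [h.body.volume_hull_of_mem hm] at hF
    linarith
  -- otherwise the hull of `p'` is formed with the same points of contact as that of `p`, so that
  -- both points lie on the tangent at `x` and at the same distance from the chord of contact
  have hA : far K x y ∪ convexHull ℝ {p', y, x} = hull K p' := by
    apply (h.body.hull p').eq_of_volume_le
      ((h.body.isClosed_far x y).union (IsConvexBody.isClosed_triangle p' x y))
      (h.body.far_union_subset C.first.1 C.last.1 p')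
    rw [h.body.volume_real_far_union (by rw [hD']; exact hD), hF, C.volume_hull, hD']
  have hx : IsFirstContact K p' x := by
    refine ⟨C.first.1, fun k hk => ?_⟩
    by_contra! hneg
    set D := det (y - p) (x - p)
    set e := |det (y - x) (k - p')|
    have he : 0 ≤ e := abs_nonneg _
    set r := D / (2 * (e + D))
    have hr0 : 0 < r := by positivity
    have hr1 : r ≤ 1 := by
      rw [div_le_one (by positivity)]; linarith
    have hre : r * e < D := by
      have : r * e = D * (e / (2 * (e + D))) := by simp only [r]; ring
      rw [this]
      have : e / (2 * (e + D)) < 1 := by rw [div_lt_one (by positivity)]; linarith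
      nlinarith
    have hm : p' + r • (k - p') ∈ hull K p' :=
      h.body.mem_hull_iff.2 ⟨k, hk, r, ⟨hr0.le, hr1⟩, rfl⟩
    rw [← hA] at hm
    rcases hm with hm | hm
    · have := hm.2
      rw [show p' + r • (k - p') - x = (p' - x) + r • (k - p') by abel, det_add_right,
        det_smul_right] at this
      have e1 : det (y - x) (p' - x) = -D := by
        rw [← hD']; simp only [det, PiLp.sub_apply]; ring
      have := mul_le_mul_of_nonneg_left (le_abs_self (det (y - x) (k - p'))) hr0.le
      linarith
    · have := ((mem_triangle_iff (by rw [hD']; exact hD)).1 hm).1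
      rw [add_sub_cancel_left, det_smul_left] at this
      nlinarith
  obtain ⟨s, -, rfl⟩ := h.exists_eq_of_first C.notMem C.first 0
  obtain ⟨a, -, ha⟩ := (h.first_iff C.notMem).1 C.first
  obtain ⟨a', -, ha'⟩ := (h.first_iff hp').1 hx
  have ec : det (p - γ s) (y - γ s) = det (y - p) (γ s - p) := by
    simp only [det, PiLp.sub_apply]; ring
  have e3 : p' - p = (a' - a) • deriv γ s := by rw [ha, ha']; module
  have e4 : p - γ s = a • deriv γ s := by rw [ha]; abel
  rw [e3, det_smul_left] at h0
  rw [e4, det_smul_left] at ec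
  rcases mul_eq_zero.1 h0 with h5 | h5
  · rw [h5, zero_smul, sub_eq_zero] at e3; exact e3
  · rw [h5, mul_zero] at ec; linarith

/-! ### Parametrization by the point of contact -/

lemma exists_contactPair_apex {s a : ℝ} (ha : 0 < a) (hp : γ s + a • deriv γ s ∉ K) :
    ∃ y, IsContactPair K (γ s + a • deriv γ s) (γ s) y := by
  obtain ⟨x, y, C⟩ := h.body.exists_contactPair hp
  exact ⟨y, h.body, hp, (h.first_iff hp).2 ⟨a, ha, rfl⟩, C.last⟩

/-- An interior point has a positive distance from all tangents, uniformly. -/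
lemma exists_uniform_pos : ∃ O ∈ interior K, ∃ m > 0, ∀ s, m ≤ det (deriv γ s) (O - γ s) := by
  obtain ⟨O, hO⟩ := h.body.interior_nonempty
  have hγ := h.param.continuous
  have hγ' := h.param.continuous_deriv
  have hc : Continuous fun s => det (deriv γ s) (O - γ s) := by fun_prop
  obtain ⟨s₀, hs₀, hmin⟩ := isCompact_Icc.exists_isMinOn (s := Icc 0 (0 + L))
    ⟨0, by simp [h.param.period_pos.le]⟩ hc.continuousOn
  refine ⟨O, hO, _, h.interior_pos hO s₀, fun s => ?_⟩
  have hp : Function.Periodic (fun s => det (deriv γ s) (O - γ s)) L := fun s => by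
    simp only [h.param.periodic s, h.param.deriv_periodic s]
  obtain ⟨t, ht, e⟩ := hp.exists_mem_Ico h.param.period_pos s 0
  rw [e]
  exact hmin (Ico_subset_Icc_self ht)

lemma le_volume_hull_tangent {O : Plane} (hO : O ∈ interior K) {s a : ℝ} (ha : 0 ≤ a) :
    1 / 2 * (a * det (deriv γ s) (O - γ s)) ≤
      volume.real (hull K (γ s + a • deriv γ s)) := by
  rcases ha.eq_or_lt with rfl | ha
  · simp
  have hd : 0 < det (γ s + a • deriv γ s - γ s) (O - γ s) := by
    rw [add_sub_cancel_left, det_smul_left]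
    exact mul_pos ha (h.interior_pos hO s)
  have h1 := volume_real_triangle hd
  rw [add_sub_cancel_left, det_smul_left] at h1
  rw [← h1]
  refine measureReal_mono (convexHull_mono ?_) (h.body.hull _).isCompact.measure_lt_top.ne
  rintro w (rfl | rfl | rfl)
  · exact mem_insert_of_mem _ (h.mem s)
  · exact mem_insert _ _
  · exact mem_insert_of_mem _ (interior_subset hO)

/-- The area of the hull increases as the apex moves outwards on a tangent. -/
lemma volume_hull_tangent_lt {s a a' : ℝ} (ha : 0 < a) (haa : a < a')
    (hp : γ s + a • deriv γ s ∉ K) :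
    volume.real (hull K (γ s + a • deriv γ s)) < volume.real (hull K (γ s + a' • deriv γ s)) := by
  obtain ⟨y, C⟩ := h.exists_contactPair_apex ha hp
  have h1 := C.le_volume_hull (γ s + a' • deriv γ s)
  have h2 := C.det_pos
  have e1 : det (y - (γ s + a • deriv γ s)) (γ s - (γ s + a • deriv γ s)) =
      a * det (deriv γ s) (y - γ s) := by
    simp only [det, PiLp.sub_apply, PiLp.add_apply, PiLp.smul_apply, smul_eq_mul]; ring
  rw [e1] at h2
  have h3 := pos_of_mul_pos_right h2 ha.le
  rw [show γ s + a' • deriv γ s - (γ s + a • deriv γ s) = (a' - a) • deriv γ s by module,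
    det_smul_left] at h1
  have := mul_pos (sub_pos.2 haa) h3
  linarith

end IsCcwParam

/-- The curve of illumination parametrized by the points of contact: `γ s + α s • γ' s` is the
point of the curve on the forward half of the tangent at `γ s`. -/
structure IsApexFamily (K : Set Plane) (γ : ℝ → Plane) (L δ : ℝ) (α : ℝ → ℝ) : Prop where
  ccw : IsCcwParam K γ L
  area_pos : 0 < δ
  continuous : Continuous α
  pos : ∀ s, 0 < α s
  area : ∀ s, volume.real (hull K (γ s + α s • deriv γ s)) = volume.real K + δ
  uniq : ∀ s a, 0 ≤ a → volume.real (hull K (γ s + a • deriv γ s)) = volume.real K + δ → a = α s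

/-- Each half tangent carries exactly one point of the curve of illumination, which depends
continuously on the point of contact. -/
lemma IsCcwParam.exists_apexFamily {K : Set Plane} {γ : ℝ → Plane} {L : ℝ} (h : IsCcwParam K γ L)
    {δ : ℝ} (hδ : 0 < δ) : ∃ α, IsApexFamily K γ L δ α := by
  have hV := h.body.volume_real_pos
  have hγ := h.param.continuous
  have hγ' := h.param.continuous_deriv
  have hFc := h.body.continuous_volume_hull
  obtain ⟨O, hO, m, hm, hmin⟩ := h.exists_uniform_pos
  set B := 2 * (volume.real K + δ) / m with hB
  have hB0 : 0 < B := by positivity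
  have hbound (s a : ℝ) (ha : 0 ≤ a)
      (e : volume.real (hull K (γ s + a • deriv γ s)) = volume.real K + δ) : a ≤ B := by
    have h1 := h.le_volume_hull_tangent hO (s := s) ha
    have h2 := mul_le_mul_of_nonneg_left (hmin s) ha
    rw [hB, le_div_iff₀ hm]
    linarith
  have hex (s : ℝ) : ∃ a : ℝ, 0 < a ∧
      volume.real (hull K (γ s + a • deriv γ s)) = volume.real K + δ := by
    have hc : Continuous fun a : ℝ => volume.real (hull K (γ s + a • deriv γ s)) :=
      hFc.comp (by fun_prop)
    obtain ⟨a, ha, e⟩ := intermediate_value_Icc hB0.le hc.continuousOn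
      (show volume.real K + δ ∈ _ from ⟨by
        simp only [zero_smul, add_zero, h.body.volume_hull_of_mem (h.mem s)]; linarith, by
        have h1 := h.le_volume_hull_tangent hO (s := s) hB0.le
        have h2 := mul_le_mul_of_nonneg_left (hmin s) hB0.le
        have h3 : B * m = 2 * (volume.real K + δ) := by rw [hB]; field_simp
        linarith⟩)
    refine ⟨a, lt_of_le_of_ne ha.1 ?_, e⟩
    rintro rfl
    simp only [zero_smul, add_zero, h.body.volume_hull_of_mem (h.mem s)] at e
    linarith
  have huniq (s a a' : ℝ) (ha : 0 < a) (ha' : 0 ≤ a')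
      (e : volume.real (hull K (γ s + a • deriv γ s)) = volume.real K + δ)
      (e' : volume.real (hull K (γ s + a' • deriv γ s)) = volume.real K + δ) : a' = a := by
    have ha'0 : 0 < a' := by
      refine lt_of_le_of_ne ha' ?_
      rintro rfl
      simp only [zero_smul, add_zero, h.body.volume_hull_of_mem (h.mem s)] at e'
      linarith
    rcases lt_trichotomy a a' with hl | hl | hl
    · have := h.volume_hull_tangent_lt ha hl (h.body.notMem_of_mem_illuminationCurve hδ e)
      linarith
    · exact hl.symm
    · have := h.volume_hull_tangent_lt ha'0 hl (h.body.notMem_of_mem_illuminationCurve hδ e')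
      linarith
  choose α hα hαF using hex
  have hcont : Continuous fun s => s + α s := by
    refine continuous_of_closed_graph (C := {z : ℝ × ℝ | z.1 ≤ z.2 ∧
      volume.real (hull K (γ z.1 + (z.2 - z.1) • deriv γ z.1)) = volume.real K + δ}) ?_ (B := B)
      ?_ ?_ ?_
    · exact (isClosed_le continuous_fst continuous_snd).inter
        (isClosed_eq (hFc.comp (by fun_prop)) continuous_const)
    · intro s
      refine ⟨by simp [(hα s).le], ?_⟩
      simp only [add_sub_cancel_left]
      exact hαF s
    · rintro s t ⟨h1, h2⟩
      have := huniq s (α s) (t - s) (hα s) (sub_nonneg.2 h1) (hαF s) h2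
      linarith
    · intro s
      rw [add_sub_cancel_left, abs_of_pos (hα s)]
      exact hbound s _ (hα s).le (hαF s)
  refine ⟨α, h, hδ, ?_, hα, hαF, fun s a ha e => huniq s _ _ (hα s) ha (hαF s) e⟩
  convert! hcont.sub continuous_id using 1
  ext1 s; simp

/-- The point of the curve of illumination on the forward half of the tangent at `γ s`. -/
def apex (γ : ℝ → Plane) (α : ℝ → ℝ) (s : ℝ) : Plane := γ s + α s • deriv γ s

namespace IsApexFamily

variable {K : Set Plane} {γ : ℝ → Plane} {L δ : ℝ} {α : ℝ → ℝ} (A : IsApexFamily K γ L δ α)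
include A

lemma continuous_apex : Continuous (apex γ α) := by
  have := A.ccw.param.continuous
  have := A.ccw.param.continuous_deriv
  have := A.continuous
  unfold apex
  fun_prop

lemma notMem (s : ℝ) : apex γ α s ∉ K :=
  A.ccw.body.notMem_of_mem_illuminationCurve A.area_pos (A.area s)

lemma periodic : Function.Periodic α L := fun s => by
  refine A.uniq s _ (A.pos _).le ?_
  have := A.area (s + L)
  rwa [A.ccw.param.periodic, A.ccw.param.deriv_periodic] at this

lemma apex_periodic : Function.Periodic (apex γ α) L := fun s => by
  simp only [apex, A.periodic s, A.ccw.param.periodic s, A.ccw.param.deriv_periodic s]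

lemma first (s : ℝ) : IsFirstContact K (apex γ α s) (γ s) :=
  (A.ccw.first_iff (A.notMem s)).2 ⟨α s, A.pos s, rfl⟩

lemma pair {s : ℝ} {y : Plane} (hy : IsLastContact K (apex γ α s) y) :
    IsContactPair K (apex γ α s) (γ s) y := ⟨A.ccw.body, A.notMem s, A.first s, hy⟩

lemma exists_pair (s : ℝ) : ∃ y, IsContactPair K (apex γ α s) (γ s) y := by
  obtain ⟨x, y, C⟩ := A.ccw.body.exists_contactPair (A.notMem s)
  exact ⟨y, A.pair C.last⟩

lemma eq_apex {q : Plane} (hq : volume.real (hull K q) = volume.real K + δ) {s : ℝ}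
    (hx : IsFirstContact K q (γ s)) : q = apex γ α s := by
  obtain ⟨a, ha, e⟩ := (A.ccw.first_iff
    (A.ccw.body.notMem_of_mem_illuminationCurve A.area_pos hq)).1 hx
  rw [e] at hq
  rw [apex, ← A.uniq s a ha.le hq, e]

lemma illuminationCurve_eq : illuminationCurve K δ = range (apex γ α) := by
  ext q
  rw [A.ccw.body.mem_illuminationCurve_iff A.area_pos]
  constructor
  · intro hq
    have hqK := A.ccw.body.notMem_of_mem_illuminationCurve A.area_pos hq
    obtain ⟨x, y, C⟩ := A.ccw.body.exists_contactPair hqK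
    obtain ⟨s, -, rfl⟩ := A.ccw.exists_eq_of_first hqK C.first 0
    exact ⟨s, (A.eq_apex hq C.first).symm⟩
  · rintro ⟨s, rfl⟩
    exact A.area s

end IsApexFamily

/-! ### Homothety of the curve of illumination and the curve of centroids -/

/-- A homothety between the two curves matches the points with the centroids of their own
silhouette cones. -/
lemma IsCcwParam.moment_of_homothetic {K : Set Plane} {γ : ℝ → Plane} {L : ℝ}
    (h : IsCcwParam K γ L) {δ lam : ℝ} (hδ : 0 < δ) (hlam : 0 < lam)
    (hom : IsHomothetic (illuminationCurve K δ) (illuminationCentroidCurve K δ) lam) {q q' : Plane}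
    (hq : volume.real (hull K q) = volume.real K + δ)
    (hq' : volume.real (hull K q') = volume.real K + δ) :
    (∫ w in hull K q', w) - (∫ w in hull K q, w) = (δ * lam) • (q' - q) := by
  obtain ⟨z, hz⟩ := hom
  have hmem (q : Plane) := h.body.mem_illuminationCurve_iff hδ (p := q)
  have key (q : Plane) (hq : volume.real (hull K q) = volume.real K + δ) :
      (∫ w in hull K q, w) = δ • (z + lam • (q - z)) + ∫ w in K, w := by
    have hqK := h.body.notMem_of_mem_illuminationCurve hδ hq
    obtain ⟨x, y, C⟩ := h.body.exists_contactPair hqK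
    have hcen (q : Plane) (hq : volume.real (hull K q) = volume.real K + δ) :
        (∫ w in hull K q, w) = δ • centroid (silhouetteCone K q) + ∫ w in K, w := by
      rw [h.body.centroid_silhouetteCone hq, smul_smul, mul_inv_cancel₀ hδ.ne', one_smul]
      abel
    obtain ⟨q₁, hq₁, e1⟩ : AffineMap.homothety z lam q ∈ illuminationCentroidCurve K δ := by
      rw [← hz]; exact ⟨q, (hmem q).2 hq, rfl⟩
    obtain ⟨q₂, hq₂, e2⟩ : centroid (silhouetteCone K q) ∈
        AffineMap.homothety z lam '' illuminationCurve K δ := by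
      rw [hz]; exact ⟨q, (hmem q).2 hq, rfl⟩
    rw [hmem] at hq₁ hq₂
    have hhom (w : Plane) : AffineMap.homothety z lam w = z + lam • (w - z) := by
      rw [AffineMap.homothety_apply, vsub_eq_sub, vadd_eq_add, add_comm]
    simp only at e1
    rw [hhom] at e1 e2
    -- `q₁` is the point whose centroid is the image of `q`, and the centroid of `q` is the image of
    -- `q₂`; if `q₁ ≠ q`, then the centroid of `q` lies further out than the one of `q₁`, so `q₂`
    -- lies further out than `q`
    by_cases hne : q₁ = q
    · rw [hcen q hq, ← e1, hne]
    · exfalso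
      have h1 := h.det_neg_of_volume_eq C (hq₁.trans hq.symm) hne
      have h2 := C.det_moment_hull_lt (hq₁.trans hq.symm) h1
      rw [hcen q hq, hcen q₁ hq₁, e1, ← e2,
        show δ • (z + lam • (q - z)) + (∫ w in K, w) - (δ • (z + lam • (q₂ - z)) + ∫ w in K, w) =
          -((δ * lam) • (q₂ - q)) by module, det_neg_left, det_smul_left] at h2
      have h3 := C.le_volume_hull q₂
      have : 0 < det (q₂ - q) (y - x) := pos_of_mul_pos_right (by linarith)
        (mul_pos hδ hlam).le
      linarith
  rw [key q hq, key q' hq']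
  module

namespace IsApexFamily

variable {K : Set Plane} {γ : ℝ → Plane} {L δ : ℝ} {α : ℝ → ℝ} (A : IsApexFamily K γ L δ α)
include A

lemma isClosed_lastContact : IsClosed {z : ℝ × Plane | IsLastContact K (apex γ α z.1) z.2} := by
  have hc := A.continuous_apex
  have : {z : ℝ × Plane | IsLastContact K (apex γ α z.1) z.2} = {z : ℝ × Plane | z.2 ∈ K} ∩
      ⋂ w ∈ K, {z : ℝ × Plane | 0 ≤ det (z.2 - apex γ α z.1) (w - apex γ α z.1)} := by
    ext z
    simp only [IsLastContact, mem_ofPred_eq, mem_inter_iff, mem_iInter]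
  rw [this]
  refine (A.ccw.body.isClosed.preimage continuous_snd).inter (isClosed_biInter fun w _ => ?_)
  exact isClosed_le continuous_const (by fun_prop)

/-- The parameters for which the chord of contact can be chosen such that it cuts off a triangle of
the given area from the hull form a closed set. -/
lemma isClosed_exists_area (m : ℝ) : IsClosed {s | ∃ y, IsLastContact K (apex γ α s) y ∧
    det (y - apex γ α s) (γ s - apex γ α s) = m} := by
  have hc := A.continuous_apex
  have hγ := A.ccw.param.continuous
  apply IsSeqClosed.isClosed
  intro s s₀ hs hlim
  choose y hy hm using hs
  obtain ⟨y₀, hy₀, ψ, hψ, hyl⟩ := A.ccw.body.isCompact.tendsto_subseq fun n => (hy n).1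
  have hl : Filter.Tendsto (fun n => (s (ψ n), y (ψ n))) Filter.atTop (nhds (s₀, y₀)) :=
    (hlim.comp hψ.tendsto_atTop).prodMk_nhds hyl
  refine ⟨y₀, A.isClosed_lastContact.mem_of_tendsto hl (Filter.Eventually.of_forall fun n => hy _),
    ?_⟩
  have hcl : IsClosed {z : ℝ × Plane | det (z.2 - apex γ α z.1) (γ z.1 - apex γ α z.1) = m} :=
    isClosed_eq (by fun_prop) continuous_const
  exact hcl.mem_of_tendsto hl (Filter.Eventually.of_forall fun n => hm _)

lemma exists_norm_bound : ∃ R, (∀ w ∈ K, ‖w‖ ≤ R) ∧ ∀ s, ‖apex γ α s‖ ≤ R := by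
  obtain ⟨R₁, h1⟩ := A.ccw.body.isCompact.isBounded.exists_norm_le
  obtain ⟨R₂, h2⟩ := (isCompact_Icc (a := (0 : ℝ)) (b := 0 + L)).exists_bound_of_continuousOn
    A.continuous_apex.continuousOn
  refine ⟨max R₁ R₂, fun w hw => (h1 w hw).trans (le_max_left _ _), fun s => ?_⟩
  obtain ⟨t, ht, e⟩ := A.apex_periodic.exists_mem_Ico A.ccw.param.period_pos s 0
  rw [e]
  exact (h2 t (Ico_subset_Icc_self ht)).trans (le_max_right _ _)

/-- Where the curve of illumination is not locally constant, some chord of contact cuts off a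
triangle of the area that is determined by the expansion of the moment. -/
lemma exists_area_of_frequently {μ : ℝ}
    (hM : ∀ s s', (∫ w in hull K (apex γ α s'), w) - (∫ w in hull K (apex γ α s), w) =
      μ • (apex γ α s' - apex γ α s)) {s₀ : ℝ}
    (hfr : ∃ᶠ s in nhds s₀, apex γ α s ≠ apex γ α s₀) :
    ∃ y, IsLastContact K (apex γ α s₀) y ∧
      det (y - apex γ α s₀) (γ s₀ - apex γ α s₀) = 6 * μ := by
  have hc := A.continuous_apex
  have hγ := A.ccw.param.continuous
  obtain ⟨R, hR, hR'⟩ := A.exists_norm_bound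
  obtain ⟨s, hs, hne⟩ := Filter.exists_seq_forall_of_frequently hfr
  choose y C using fun n => A.exists_pair (s n)
  obtain ⟨y₀, hy₀, ψ, hψ, hyl⟩ := A.ccw.body.isCompact.tendsto_subseq fun n => (C n).last.1
  have hsl := hs.comp hψ.tendsto_atTop
  have hl : Filter.Tendsto (fun n => (s (ψ n), y (ψ n))) Filter.atTop (nhds (s₀, y₀)) :=
    hsl.prodMk_nhds hyl
  have hL : IsLastContact K (apex γ α s₀) y₀ :=
    A.isClosed_lastContact.mem_of_tendsto hl (Filter.Eventually.of_forall fun n => (C _).last)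
  have C₀ := A.pair hL
  refine ⟨y₀, hL, ?_⟩
  set D := det (y₀ - apex γ α s₀) (γ s₀ - apex γ α s₀)
  have hpos : ∀ᶠ n in Filter.atTop,
      0 < det (y₀ - apex γ α (s (ψ n))) (γ s₀ - apex γ α (s (ψ n))) := by
    have hcont : Continuous fun s => det (y₀ - apex γ α s) (γ s₀ - apex γ α s) := by fun_prop
    exact ((hcont.tendsto s₀).comp hsl).eventually (lt_mem_nhds C₀.det_pos)
  -- divide the expansion of the moment by the displacement of the apex
  have hle : ∀ᶠ n in Filter.atTop,
      |μ - D / 6| ≤ R * ‖(y (ψ n) - γ (s (ψ n))) - (y₀ - γ s₀)‖ := by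
    filter_upwards [hpos] with n hn
    have h1 := C₀.moment_hull_sub_le (C (ψ n)) ((A.area _).trans (A.area _).symm) hR (hR' _) hn
    rw [hM, ← sub_smul, norm_smul, Real.norm_eq_abs] at h1
    have h2 : 0 < ‖apex γ α (s (ψ n)) - apex γ α s₀‖ := norm_pos_iff.2 (sub_ne_zero.2 (hne _))
    refine le_of_mul_le_mul_right (h1.trans (le_of_eq ?_)) h2
    ring
  have hlim : Filter.Tendsto (fun n => R * ‖(y (ψ n) - γ (s (ψ n))) - (y₀ - γ s₀)‖)
      Filter.atTop (nhds 0) := by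
    have h1 : Continuous fun z : ℝ × Plane => R * ‖(z.2 - γ z.1) - (y₀ - γ s₀)‖ := by fun_prop
    have := (h1.tendsto (s₀, y₀)).comp hl
    simp only [sub_self, norm_zero, mul_zero] at this
    exact this
  have h0 : |μ - D / 6| ≤ 0 := le_of_tendsto_of_tendsto tendsto_const_nhds hlim hle
  have := abs_eq_zero.1 (le_antisymm h0 (abs_nonneg _))
  linarith

/-- The curve of illumination is not a point. -/
lemma not_const (a : ℝ) (q : Plane) : ¬ ∀ t ∈ Ico a (a + L), apex γ α t = q := by
  intro hq
  have ha := hq a ⟨le_rfl, by linarith [A.ccw.param.period_pos]⟩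
  obtain ⟨y, C⟩ := A.exists_pair a
  obtain ⟨t, ht, rfl⟩ := A.ccw.exists_eq_of_last C.notMem C.last a
  have hr := A.first t
  rw [hq t ht, ← ha] at hr
  have := (IsContactPair.mk C.body C.notMem hr C.last).det_pos
  rw [det_self] at this
  exact lt_irrefl _ this

/-- If the apex is the same for all tangents at an arc, then the triangles that are possible at the
endpoints of the arc are possible everywhere on the arc. -/
lemma exists_area_of_const {a b m : ℝ} (hab : a ≤ b) (hbL : b < a + L) {q : Plane}
    (hq : ∀ s ∈ Icc a b, apex γ α s = q) (hm : 0 < m)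
    {ya yb : Plane} (hya : IsLastContact K q ya) (hyb : IsLastContact K q yb)
    (ha : det (ya - q) (γ a - q) = m) (hb : det (yb - q) (γ b - q) = m) {s : ℝ}
    (hs : s ∈ Icc a b) :
    ∃ y, IsLastContact K q y ∧ det (y - q) (γ s - q) = m := by
  have hγ := A.ccw.param.continuous
  have hpair {s : ℝ} (hs : s ∈ Icc a b) {y : Plane} (hy : IsLastContact K q y) :
      IsContactPair K q (γ s) y := by
    rw [← hq s hs] at hy ⊢; exact A.pair hy
  have haI : a ∈ Icc a b := ⟨le_rfl, hab⟩
  have hbI : b ∈ Icc a b := ⟨hab, le_rfl⟩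
  set N : ℝ → ℝ := fun s => det (ya - q) (γ s - q) with hN
  have hNpos {s : ℝ} (hs : s ∈ Icc a b) : 0 < N s := (hpair hs hya).det_pos
  -- the arc is a segment on the tangent from `q`, and `N` measures the distance from `q`
  have hX {s : ℝ} (hs : s ∈ Icc a b) : γ s - q = (N s / m) • (γ a - q) := by
    have h1 := (hpair hs hya).first.2 _ (A.ccw.mem a)
    have h2 := (hpair haI hya).first.2 _ (A.ccw.mem s)
    have h3 : det (γ s - q) (γ a - q) = 0 := le_antisymm (by rw [det_swap]; linarith) h2
    have hcr := cramer (ya - q) (γ a - q) (γ s - q)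
    rw [h3, zero_smul, zero_add, ha] at hcr
    rw [div_eq_inv_mul, mul_smul, ← hcr, smul_smul, inv_mul_cancel₀ hm.ne', one_smul]
  have hinj : InjOn N (Icc a b) := by
    intro s hs t ht e
    have h1 := hX hs
    rw [e, ← hX ht] at h1
    exact A.ccw.param.injOn_Ico a ⟨hs.1, hs.2.trans_lt hbL⟩ ⟨ht.1, ht.2.trans_lt hbL⟩
      (sub_left_injective h1)
  have hNc : ContinuousOn N (Icc a b) := by fun_prop
  have hNa : N a = m := ha
  -- the point of contact on the other tangent is determined by the area
  obtain ⟨k, hk⟩ : ∃ k, yb - q = k • (ya - q) := by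
    refine exists_smul_of_det_eq_zero ?_ ?_
    · rw [sub_ne_zero]; rintro rfl
      exact (hpair haI hya).notMem hya.1
    · have h1 := hya.2 _ hyb.1
      have h2 := hyb.2 _ hya.1
      rw [det_swap] at h2
      linarith
  have hkb : k * N b = m := by
    rw [← hb, hk, det_smul_left]
  have hNs := hNpos hs
  have hNb := hNpos hbI
  have hbetween : (1 ≤ m / N s ∧ m / N s ≤ k) ∨ (k ≤ m / N s ∧ m / N s ≤ 1) := by
    have hk' : k = m / N b := by field_simp; linarith
    rw [hk', one_le_div hNs, div_le_one hNs, div_le_div_iff_of_pos_left hm hNs hNb,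
      div_le_div_iff_of_pos_left hm hNb hNs]
    rcases hNc.strictMonoOn_of_injOn_Icc' hab hinj with hmono | hanti
    · exact Or.inr ⟨hmono.monotoneOn hs hbI hs.2, hNa ▸ hmono.monotoneOn haI hs hs.1⟩
    · exact Or.inl ⟨hNa ▸ hanti.antitoneOn haI hs hs.1, hanti.antitoneOn hs hbI hs.2⟩
  have hmem : q + (m / N s) • (ya - q) ∈ segment ℝ ya yb := by
    have e1 : yb - ya = (k - 1) • (ya - q) := by
      rw [show yb - ya = (yb - q) - (ya - q) by abel, hk]; module
    rw [segment_eq_image']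
    rcases eq_or_ne k 1 with rfl | hk1
    · have : m / N s = 1 := by rcases hbetween with h | h <;> linarith
      rw [this]
      exact ⟨0, by simp, by simp⟩
    · have hk1' : k - 1 ≠ 0 := sub_ne_zero.2 hk1
      refine ⟨(m / N s - 1) / (k - 1), ?_, ?_⟩
      · rcases hbetween with h | h
        · have : 0 < k - 1 := lt_of_le_of_ne (by linarith) hk1'.symm
          exact ⟨div_nonneg (by linarith) this.le, by rw [div_le_one this]; linarith⟩
        · have : 0 < 1 - k := lt_of_le_of_ne (by linarith) fun e => hk1' (by linarith)
          rw [← neg_div_neg_eq, neg_sub, neg_sub]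
          exact ⟨div_nonneg (by linarith) this.le, by rw [div_le_one this]; linarith⟩
      · simp only [e1, smul_smul]
        rw [div_mul_cancel₀ _ hk1']
        module
  refine ⟨q + (m / N s) • (ya - q), ⟨A.ccw.body.convex.segment_subset hya.1 hyb.1 hmem,
    fun w hw => ?_⟩, ?_⟩
  · rw [add_sub_cancel_left, det_smul_left]
    exact mul_nonneg (by positivity) (hya.2 w hw)
  · rw [add_sub_cancel_left, det_smul_left]
    change m / N s * N s = m
    field_simp

/-- If the moment of the hull is an affine function of the apex, then each tangent from a point of
the curve of illumination can be completed to a pair of tangents with contact triangle of area `3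
μ`. At the limits of points with different apexes this follows from the expansion of the moment, and
the arcs on which the apex is constant lie between such limits. -/
lemma exists_area {μ : ℝ} (hμ : 0 < μ)
    (hM : ∀ s s', (∫ w in hull K (apex γ α s'), w) - (∫ w in hull K (apex γ α s), w) =
      μ • (apex γ α s' - apex γ α s)) (s₀ : ℝ) :
    ∃ y, IsLastContact K (apex γ α s₀) y ∧
      det (y - apex γ α s₀) (γ s₀ - apex γ α s₀) = 6 * μ := by
  set S := {s | ∃ y, IsLastContact K (apex γ α s) y ∧
    det (y - apex γ α s) (γ s - apex γ α s) = 6 * μ} with hS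
  have hSc : IsClosed S := A.isClosed_exists_area _
  have hL := A.ccw.param.period_pos
  change s₀ ∈ S
  by_contra hs₀
  have hloc {s : ℝ} (hs : s ∉ S) : ∀ᶠ s' in nhds s, apex γ α s' = apex γ α s := by
    by_contra hcon
    exact hs (A.exists_area_of_frequently hM (Filter.not_eventually.1 hcon))
  have hconst {I : Set ℝ} (hI : IsPreconnected I) (hIo : IsOpen I) (hIS : ∀ s ∈ I, s ∉ S) {s t : ℝ}
      (hs : s ∈ I) (ht : t ∈ I) : apex γ α s = apex γ α t := by
    refine hI.induction₂ (fun s t => apex γ α s = apex γ α t) (fun x hx => ?_)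
      (fun _ _ _ _ _ _ => Eq.trans) (fun _ _ _ _ => Eq.symm) hs ht
    filter_upwards [mem_nhdsWithin_of_mem_nhds (hloc (hIS x hx))] with y hy
    exact hy.symm
  have hper (s : ℝ) (n : ℤ) (hs : s ∈ S) : s + n * L ∈ S := by
    obtain ⟨y, h1, h2⟩ := hs
    refine ⟨y, ?_, ?_⟩
    · rwa [A.apex_periodic.int_mul n s]
    · rwa [A.apex_periodic.int_mul n s, A.ccw.param.add_int_mul]
  have hne : S.Nonempty := by
    by_contra hemp
    have : ∀ s, s ∉ S := fun s hs => hemp ⟨s, hs⟩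
    exact A.not_const 0 (apex γ α 0) fun t _ =>
      hconst isPreconnected_univ isOpen_univ (fun s _ => this s) (mem_univ t) (mem_univ 0)
  obtain ⟨σ, hσ⟩ := hne
  have hlow : (S ∩ Iic s₀).Nonempty := by
    refine ⟨_, hper σ ⌊(s₀ - σ) / L⌋ hσ, ?_⟩
    have := Int.floor_le ((s₀ - σ) / L)
    rw [le_div_iff₀ hL] at this
    rw [mem_Iic]; linarith
  have hhigh : (S ∩ Ici s₀).Nonempty := by
    refine ⟨_, hper σ ⌈(s₀ - σ) / L⌉ hσ, ?_⟩
    have := Int.le_ceil ((s₀ - σ) / L)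
    rw [div_le_iff₀ hL] at this
    rw [mem_Ici]; linarith
  have hbl : BddAbove (S ∩ Iic s₀) := ⟨s₀, fun s hs => hs.2⟩
  have hbh : BddBelow (S ∩ Ici s₀) := ⟨s₀, fun s hs => hs.2⟩
  -- `(a, b)` is the component of `s₀` in the complement of `S`
  have haS := (hSc.inter isClosed_Iic).csSup_mem hlow hbl
  have hbS := (hSc.inter isClosed_Ici).csInf_mem hhigh hbh
  set a := sSup (S ∩ Iic s₀)
  set b := sInf (S ∩ Ici s₀)
  have has : a < s₀ := lt_of_le_of_ne haS.2 fun e => hs₀ (e ▸ haS.1)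
  have hsb : s₀ < b := lt_of_le_of_ne hbS.2 fun e => hs₀ (e ▸ hbS.1)
  have hgap (s : ℝ) (hs : s ∈ Ioo a b) : s ∉ S := by
    intro hsS
    rcases le_total s s₀ with h1 | h1
    · exact absurd (le_csSup hbl ⟨hsS, h1⟩) (not_le.2 hs.1)
    · exact absurd (csInf_le hbh ⟨hsS, h1⟩) (not_le.2 hs.2)
  have hq : ∀ s ∈ Icc a b, apex γ α s = apex γ α s₀ := by
    have hcl : IsClosed {s | apex γ α s = apex γ α s₀} :=
      isClosed_eq A.continuous_apex continuous_const
    have := closure_minimal (fun s hs => hconst isPreconnected_Ioo isOpen_Ioo hgap hs ⟨has, hsb⟩ :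
      Ioo a b ⊆ {s | apex γ α s = apex γ α s₀}) hcl
    rwa [closure_Ioo (has.trans hsb).ne] at this
  have hbL : b < a + L := by
    by_contra hcon
    exact A.not_const a _ fun t ht => hq t ⟨ht.1, ht.2.le.trans (not_lt.1 hcon)⟩
  obtain ⟨ya, h1, h2⟩ := haS.1
  obtain ⟨yb, h3, h4⟩ := hbS.1
  have hab := has.trans hsb
  rw [hq a ⟨le_rfl, hab.le⟩] at h1 h2
  rw [hq b ⟨hab.le, le_rfl⟩] at h3 h4
  exact hs₀ (A.exists_area_of_const hab.le hbL hq (by positivity) h1 h3 h2 h4 ⟨has.le, hsb.le⟩)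

end IsApexFamily

/-! ### The map between the points of contact -/

/-- The determinant of the first two derivatives of a curve, a multiple of its curvature. -/
def curv (γ : ℝ → Plane) (s : ℝ) : ℝ := det (deriv γ s) (deriv (deriv γ) s)

namespace IsCcwParam

variable {K : Set Plane} {γ : ℝ → Plane} {L : ℝ} (h : IsCcwParam K γ L)
include h

lemma continuous_curv : Continuous (curv γ) := by
  have := h.param.continuous_deriv
  have := h.param.continuous_deriv2
  unfold curv
  fun_prop

lemma curv_add_int_mul (s : ℝ) (n : ℤ) : curv γ (s + n * L) = curv γ s := by
  have : deriv (deriv γ) (s + n * L) = deriv (deriv γ) s := by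
    rw [← deriv_comp_add_const]
    congr 1
    ext1 x; exact h.param.deriv_add_int_mul x n
  rw [curv, curv, this, h.param.deriv_add_int_mul]

/-- The boundary of a convex set has curvature of one sign. -/
lemma curv_nonneg (s : ℝ) : 0 ≤ curv γ s := by
  have h1 := hasDerivAt_iff_tendsto_slope.1 (h.param.hasDerivAt s)
  have h2 := hasDerivAt_iff_tendsto_slope.1 (h.param.hasDerivAt_deriv s)
  have hc : Continuous fun z : Plane × Plane => det z.1 z.2 := by fun_prop
  refine ge_of_tendsto ((hc.tendsto _).comp (h1.prodMk_nhds h2)) ?_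
  refine Filter.Eventually.of_forall fun σ => ?_
  simp only [Function.comp, slope_def_module, det_smul_left, det_smul_right]
  have e1 := h.ccw s _ (h.mem σ)
  have e2 := h.ccw σ _ (h.mem s)
  have e3 : det (γ σ - γ s) (deriv γ σ - deriv γ s) =
      det (deriv γ s) (γ σ - γ s) + det (deriv γ σ) (γ s - γ σ) := by
    simp only [det, PiLp.sub_apply]; ring
  have e4 : (σ - s)⁻¹ * ((σ - s)⁻¹ * det (γ σ - γ s) (deriv γ σ - deriv γ s)) =
      (σ - s)⁻¹ ^ 2 * det (γ σ - γ s) (deriv γ σ - deriv γ s) := by ring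
  rw [e4, e3]
  have := sq_nonneg (σ - s)⁻¹
  positivity

end IsCcwParam

/-- The map `φ` sends the parameter of one point of contact to the parameter of the other, where
the chord of contact is chosen such that the triangle formed with the apex has area `3 μ`. -/
structure IsContactMap (K : Set Plane) (γ : ℝ → Plane) (L δ μ : ℝ) (α φ : ℝ → ℝ) : Prop where
  family : IsApexFamily K γ L δ α
  mu_pos : 0 < μ
  lt_map : ∀ s, s < φ s
  map_lt : ∀ s, φ s < s + L
  last : ∀ s, IsLastContact K (apex γ α s) (γ (φ s))
  area : ∀ s, det (γ (φ s) - apex γ α s) (γ s - apex γ α s) = 6 * μ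

/-- A choice of chords of contact with the same area of the triangle, as a map between parameters.
-/
lemma IsApexFamily.exists_contactMap {K : Set Plane} {γ : ℝ → Plane} {L δ μ : ℝ} {α : ℝ → ℝ}
    (A : IsApexFamily K γ L δ α) (hμ : 0 < μ)
    (hex : ∀ s, ∃ y, IsLastContact K (apex γ α s) y ∧
      det (y - apex γ α s) (γ s - apex γ α s) = 6 * μ) :
    ∃ φ, IsContactMap K γ L δ μ α φ := by
  have hex' (s : ℝ) : ∃ t, s < t ∧ t < s + L ∧ IsLastContact K (apex γ α s) (γ t) ∧
      det (γ t - apex γ α s) (γ s - apex γ α s) = 6 * μ := by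
    obtain ⟨y, h1, h2⟩ := hex s
    obtain ⟨t, ht, rfl⟩ := A.ccw.exists_eq_of_last (A.notMem s) h1 s
    refine ⟨t, lt_of_le_of_ne ht.1 ?_, ht.2, h1, h2⟩
    rintro rfl
    rw [det_self] at h2
    linarith
  choose φ h1 h2 h3 h4 using hex'
  exact ⟨φ, A, hμ, h1, h2, h3, h4⟩

namespace IsContactMap

variable {K : Set Plane} {γ : ℝ → Plane} {L δ μ : ℝ} {α φ : ℝ → ℝ}
  (M : IsContactMap K γ L δ μ α φ)
include M

lemma pair (s : ℝ) : IsContactPair K (apex γ α s) (γ s) (γ (φ s)) := M.family.pair (M.last s)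

/-- The point of contact on a tangent is determined by the area of the triangle. -/
lemma eq_map {s t : ℝ} (h1 : s ≤ t) (h2 : t ≤ s + L) (hl : IsLastContact K (apex γ α s) (γ t))
    (ha : det (γ t - apex γ α s) (γ s - apex γ α s) = 6 * μ) : t = φ s := by
  have hμ := M.mu_pos
  have h2' : t < s + L := by
    refine lt_of_le_of_ne h2 ?_
    rintro rfl
    rw [M.family.ccw.param.periodic, det_self] at ha
    linarith
  refine M.family.ccw.param.injOn_Ico s ⟨h1, h2'⟩ ⟨(M.lt_map s).le, M.map_lt s⟩ ?_
  have hm := M.area s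
  have e1 := hl.2 _ (M.last s).1
  have e2 := (M.last s).2 _ hl.1
  have e3 : det (γ t - apex γ α s) (γ (φ s) - apex γ α s) = 0 :=
    le_antisymm (by rw [det_swap]; linarith) e1
  have hcr := cramer (γ (φ s) - apex γ α s) (γ s - apex γ α s) (γ t - apex γ α s)
  rw [det_swap (γ (φ s) - apex γ α s) (γ t - apex γ α s), e3, neg_zero, zero_smul, add_zero, ha,
    hm] at hcr
  exact sub_left_injective (smul_right_injective Plane (by positivity : 6 * μ ≠ 0) hcr)

lemma continuous : Continuous φ := by
  have hc := M.family.continuous_apex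
  have hγ := M.family.ccw.param.continuous
  refine continuous_of_closed_graph (C := {z : ℝ × ℝ | z.1 ≤ z.2 ∧ z.2 ≤ z.1 + L ∧
      IsLastContact K (apex γ α z.1) (γ z.2) ∧
      det (γ z.2 - apex γ α z.1) (γ z.1 - apex γ α z.1) = 6 * μ}) ?_ (B := L) ?_ ?_ ?_
  · refine (isClosed_le continuous_fst continuous_snd).inter
      ((isClosed_le continuous_snd (by fun_prop)).inter (IsClosed.inter ?_
      (isClosed_eq (by fun_prop) continuous_const)))
    exact M.family.isClosed_lastContact.preimage
      (f := fun z : ℝ × ℝ => (z.1, γ z.2)) (by fun_prop)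
  · exact fun s => ⟨(M.lt_map s).le, (M.map_lt s).le, M.last s, M.area s⟩
  · rintro s t ⟨h1, h2, h3, h4⟩
    exact M.eq_map h1 h2 h3 h4
  · intro s
    rw [abs_of_pos (sub_pos.2 (M.lt_map s))]
    linarith [M.map_lt s]

lemma coords (s : ℝ) : ∃ b : ℝ, 0 < b ∧ apex γ α s = γ (φ s) - b • deriv γ (φ s) ∧
    0 < det (deriv γ s) (deriv γ (φ s)) ∧
    det (deriv γ s) (γ (φ s) - γ s) = b * det (deriv γ s) (deriv γ (φ s)) ∧
    det (γ (φ s) - γ s) (deriv γ (φ s)) = α s * det (deriv γ s) (deriv γ (φ s)) ∧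
    α s * b * det (deriv γ s) (deriv γ (φ s)) = 6 * μ := by
  obtain ⟨a, b, ha, hb, e1, e2, hd, h1, h2, h3⟩ := M.family.ccw.contact_coords (M.pair s)
  have : a = α s := by
    have : α s • deriv γ s = a • deriv γ s := by
      rw [apex] at e1; exact add_left_cancel e1
    exact (smul_left_injective ℝ (M.family.ccw.param.regular s) this).symm
  subst this
  exact ⟨b, hb, e2, hd, h1, h2, by rw [← h3, M.area s]⟩

/-- The map `φ` is differentiable by implicit differentiation of `N₁ N₂ = 6 μ d`, where `N₁`, `N₂`
and `d` are the determinants of the chord and the two tangent vectors. -/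
lemma differentiableAt_map_aux (s : ℝ) :
    ∃ b D : ℝ, 0 < b ∧ apex γ α s = γ (φ s) - b • deriv γ (φ s) ∧
    0 < det (deriv γ s) (deriv γ (φ s)) ∧ HasDerivAt φ D s ∧
    D * (α s * det (deriv γ s) (deriv γ (φ s)) + b ^ 2 * curv γ (φ s)) =
      α s ^ 2 * curv γ s + b * det (deriv γ s) (deriv γ (φ s)) := by
  have h := M.family.ccw
  obtain ⟨b, hb, e, hd, h1, h2, h3⟩ := M.coords s
  have ha := M.family.pos s
  set Q : ℝ × ℝ → ℝ := fun z => det (deriv γ z.1) (γ z.2 - γ z.1) *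
    det (γ z.2 - γ z.1) (deriv γ z.2) - 6 * μ * det (deriv γ z.1) (deriv γ z.2) with hQ
  have hQ0 (x : ℝ) : Q (x, φ x) = 0 := by
    obtain ⟨b, hb, e, hd, h1, h2, h3⟩ := M.coords x
    simp only [hQ]
    rw [h1, h2, ← h3]; ring
  have hdQ : DifferentiableAt ℝ Q (s, φ s) := by
    have d1 : Differentiable ℝ γ := fun x => (h.param.hasDerivAt x).differentiableAt
    have d2 : Differentiable ℝ (deriv γ) := fun x => (h.param.hasDerivAt_deriv x).differentiableAt
    have d3 (i : Fin 2) : Differentiable ℝ fun x => γ x i :=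
      fun x => ((h.param.hasDerivAt x).coord i).differentiableAt
    have d4 (i : Fin 2) : Differentiable ℝ fun x => deriv γ x i :=
      fun x => ((h.param.hasDerivAt_deriv x).coord i).differentiableAt
    have f1 (i : Fin 2) := (d3 i).comp (differentiable_fst (𝕜 := ℝ) (E := ℝ) (F := ℝ))
    have f2 (i : Fin 2) := (d3 i).comp (differentiable_snd (𝕜 := ℝ) (E := ℝ) (F := ℝ))
    have f3 (i : Fin 2) := (d4 i).comp (differentiable_fst (𝕜 := ℝ) (E := ℝ) (F := ℝ))
    have f4 (i : Fin 2) := (d4 i).comp (differentiable_snd (𝕜 := ℝ) (E := ℝ) (F := ℝ))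
    have : Differentiable ℝ Q := by
      simp only [hQ, det, PiLp.sub_apply]
      exact ((((f3 0).mul ((f2 1).sub (f1 1))).sub ((f3 1).mul ((f2 0).sub (f1 0)))).mul
        ((((f2 0).sub (f1 0)).mul (f4 1)).sub (((f2 1).sub (f1 1)).mul (f4 0)))).sub
        ((((f3 0).mul (f4 1)).sub ((f3 1).mul (f4 0))).const_mul (6 * μ))
    exact this _
  have ec : γ (φ s) - γ s = α s • deriv γ s + b • deriv γ (φ s) := by
    have : γ s + α s • deriv γ s = γ (φ s) - b • deriv γ (φ s) := e
    rw [eq_sub_iff_add_eq] at this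
    rw [← this]; abel
  set d := det (deriv γ s) (deriv γ (φ s)) with hdd
  have hA : HasDerivAt (fun x => Q (x, φ s)) (-(d * (α s ^ 2 * curv γ s + b * d))) s := by
    have k1 := hasDerivAt_det (h.param.hasDerivAt_deriv s)
      ((h.param.hasDerivAt s).const_sub (γ (φ s)))
    have k2 := hasDerivAt_det ((h.param.hasDerivAt s).const_sub (γ (φ s)))
      (hasDerivAt_const s (deriv γ (φ s)))
    have k3 := hasDerivAt_det (h.param.hasDerivAt_deriv s) (hasDerivAt_const s (deriv γ (φ s)))
    convert! (k1.mul k2).sub (k3.const_mul (6 * μ)) using 1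
    rw [h1, h2, ← h3, ec, curv, hdd]
    simp only [det, PiLp.add_apply, PiLp.neg_apply, PiLp.smul_apply, smul_eq_mul, PiLp.zero_apply]
    ring
  have hB : HasDerivAt (fun y => Q (s, y)) (d * (α s * d + b ^ 2 * curv γ (φ s))) (φ s) := by
    have k1 := hasDerivAt_det (hasDerivAt_const (φ s) (deriv γ s))
      ((h.param.hasDerivAt (φ s)).sub_const (γ s))
    have k2 := hasDerivAt_det ((h.param.hasDerivAt (φ s)).sub_const (γ s))
      (h.param.hasDerivAt_deriv (φ s))
    have k3 := hasDerivAt_det (hasDerivAt_const (φ s) (deriv γ s))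
      (h.param.hasDerivAt_deriv (φ s))
    convert! (k1.mul k2).sub (k3.const_mul (6 * μ)) using 1
    rw [h1, h2, ← h3, ec, curv, hdd]
    simp only [det, PiLp.add_apply, PiLp.smul_apply, smul_eq_mul, PiLp.zero_apply]
    ring
  have hκ := h.curv_nonneg (φ s)
  have hpos : 0 < α s * d + b ^ 2 * curv γ (φ s) := by positivity
  refine ⟨b, _, hb, e, hd, hasDerivAt_of_implicit hdQ hA hB (by positivity)
    M.continuous.continuousAt (fun x => by rw [hQ0, hQ0]), ?_⟩
  field_simp

/-- The curve of illumination and the map between the points of contact are differentiable. The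
derivative of the map is the ratio of the lengths of the two tangents, measured in the parameter
of the boundary, since the curve of illumination runs parallel to the chord of contact. -/
lemma hasDerivAt_map (s : ℝ) : ∃ b : ℝ, 0 < b ∧ apex γ α s = γ (φ s) - b • deriv γ (φ s) ∧
    HasDerivAt φ (b / α s) s ∧ curv γ (φ s) * (b / α s) ^ 3 = curv γ s ∧
    DifferentiableAt ℝ (apex γ α) s := by
  have h := M.family.ccw
  obtain ⟨b, D, hb, e, hd, hφ, hD⟩ := M.differentiableAt_map_aux s
  have ha := M.family.pos s
  have hw : HasDerivAt (fun x => γ (φ x)) (D • deriv γ (φ s)) s :=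
    (h.param.hasDerivAt (φ s)).scomp s hφ
  have hw' : HasDerivAt (fun x => deriv γ (φ x)) (D • deriv (deriv γ) (φ s)) s :=
    (h.param.hasDerivAt_deriv (φ s)).scomp s hφ
  have hv := h.param.hasDerivAt s
  have hv' := h.param.hasDerivAt_deriv s
  -- the lengths of the tangents as functions of the parameter
  obtain ⟨α', hα'⟩ : ∃ α', HasDerivAt α α' s := by
    have e1 : α = fun x => det (γ (φ x) - γ x) (deriv γ (φ x)) /
        det (deriv γ x) (deriv γ (φ x)) := by
      ext x
      obtain ⟨b, hb, e, hd, h1, h2, h3⟩ := M.coords x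
      rw [h2]; field_simp
    rw [e1]
    exact ⟨_, (hasDerivAt_det (hw.sub hv) hw').div (hasDerivAt_det hv' hw') hd.ne'⟩
  obtain ⟨β, β', hβ, hβ', hβe⟩ : ∃ (β : ℝ → ℝ) (β' : ℝ), β s = b ∧ HasDerivAt β β' s ∧
      ∀ x, apex γ α x = γ (φ x) - β x • deriv γ (φ x) := by
    refine ⟨fun x => det (deriv γ x) (γ (φ x) - γ x) / det (deriv γ x) (deriv γ (φ x)), _, ?_,
      (hasDerivAt_det hv' (hw.sub hv)).div (hasDerivAt_det hv' hw') hd.ne', fun x => ?_⟩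
    · obtain ⟨b', -, e', hd', h1, -, -⟩ := M.coords s
      have : b' = b := by
        rw [e, sub_right_inj] at e'
        exact (smul_left_injective ℝ (h.param.regular (φ s)) e').symm
      simp only
      rw [h1, this]; field_simp
    · obtain ⟨b', -, e', hd', h1, -, -⟩ := M.coords x
      beta_reduce
      rw [e', h1]
      congr 2; field_simp
  have hP : HasDerivAt (apex γ α) (deriv γ s + (α s • deriv (deriv γ) s + α' • deriv γ s)) s :=
    hv.add (hα'.smul hv')
  have hP2 : HasDerivAt (apex γ α) (D • deriv γ (φ s) -
      (b • D • deriv (deriv γ) (φ s) + β' • deriv γ (φ s))) s := by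
    rw [funext hβe, ← hβ]
    exact hw.sub (hβ'.smul hw')
  set P := deriv γ s + (α s • deriv (deriv γ) s + α' • deriv γ s) with hPdef
  have hPeq := hP.unique hP2
  -- the chord of contact is a subgradient of the area of the hull, which is constant on the curve
  have hc0 : det P (γ (φ s) - γ s) = 0 := by
    have k1 : HasDerivAt (fun x => det (apex γ α x - apex γ α s) (γ (φ s) - γ s))
        (det P (γ (φ s) - γ s)) s := by
      simpa using hasDerivAt_det (hP.sub_const (apex γ α s)) (hasDerivAt_const s (γ (φ s) - γ s))
    refine IsLocalMax.hasDerivAt_eq_zero (Filter.Eventually.of_forall fun x => ?_) k1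
    have h1 := (M.pair s).le_volume_hull (apex γ α x)
    have h2 := (M.family.area x).trans (M.family.area s).symm
    change volume.real (hull K (apex γ α x)) = volume.real (hull K (apex γ α s)) at h2
    simp only [sub_self, det_zero_left]
    linarith
  have ec : γ (φ s) - γ s = α s • deriv γ s + b • deriv γ (φ s) := by
    have : γ s + α s • deriv γ s = γ (φ s) - b • deriv γ (φ s) := e
    rw [eq_sub_iff_add_eq] at this
    rw [← this]; abel
  have c1 : det (deriv γ s) P = α s * curv γ s := by
    rw [hPdef, curv]
    simp only [det_add_right, det_smul_right, det_self]; ring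
  have c2 : det (deriv γ (φ s)) P = -(b * D * curv γ (φ s)) := by
    rw [hPeq, curv]
    simp only [det_add_right, det_sub_right, det_smul_right, det_self]; ring
  have c3 : α s ^ 2 * curv γ s = b ^ 2 * D * curv γ (φ s) := by
    rw [det_swap, ec, det_add_left, det_smul_left, det_smul_left, c1, c2] at hc0
    linarith
  have hDval : D = b / α s := by
    have : det (deriv γ s) (deriv γ (φ s)) * (D * α s) =
        det (deriv γ s) (deriv γ (φ s)) * b := by linarith
    rw [eq_div_iff ha.ne']
    exact mul_left_cancel₀ hd.ne' this
  rw [hDval] at hφ c3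
  refine ⟨b, hb, e, hφ, ?_, hP.differentiableAt⟩
  field_simp at c3 ⊢
  linarith

/-- If all triangles of contact have the same area, then the moment of the hull is an affine
function of the apex. -/
lemma moment_sub (s s' : ℝ) :
    (∫ w in hull K (apex γ α s'), w) - (∫ w in hull K (apex γ α s), w) =
      μ • (apex γ α s' - apex γ α s) := by
  have hγ := M.family.ccw.param.continuous
  have hφ := M.continuous
  have hp := M.family.continuous_apex
  obtain ⟨R, hR, hR'⟩ := M.family.exists_norm_bound
  have hd (s : ℝ) : HasDerivAt (fun x => (∫ w in hull K (apex γ α x), w) - μ • apex γ α x) 0 s := by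
    obtain ⟨b, -, -, -, -, hdiff⟩ := M.hasDerivAt_map s
    rw [hasDerivAt_iff_isLittleO]
    have hO : (fun x => apex γ α x - apex γ α s) =O[nhds s] fun x => x - s :=
      hdiff.hasDerivAt.isBigO_sub
    have ho : (fun x => (γ (φ x) - γ x) - (γ (φ s) - γ s)) =o[nhds s] fun _ => (1 : ℝ) := by
      rw [Asymptotics.isLittleO_one_iff]
      have : Continuous fun x => (γ (φ x) - γ x) - (γ (φ s) - γ s) := by fun_prop
      simpa using this.tendsto s
    have hpr := (hO.norm_left.mul_isLittleO ho.norm_left).const_mul_left R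
    simp only [mul_one] at hpr
    refine Asymptotics.IsBigO.trans_isLittleO ?_ hpr
    refine Asymptotics.IsBigO.of_bound 1 ?_
    have hpos : ∀ᶠ x in nhds s, 0 < det (γ (φ s) - apex γ α x) (γ s - apex γ α x) := by
      have hcont : Continuous fun x => det (γ (φ s) - apex γ α x) (γ s - apex γ α x) := by fun_prop
      exact (hcont.tendsto s).eventually (lt_mem_nhds (M.pair s).det_pos)
    filter_upwards [hpos] with x hx
    have h1 := (M.pair s).moment_hull_sub_le (M.pair x)
      ((M.family.area _).trans (M.family.area _).symm) hR (hR' _) hx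
    rw [M.area] at h1
    rw [one_mul]
    refine le_trans (le_of_eq ?_) (h1.trans (le_abs_self _))
    congr 1
    module
  have := is_const_of_deriv_eq_zero (fun x => (hd x).differentiableAt)
    (fun x => (hd x).deriv) s' s
  rw [smul_sub, sub_eq_sub_iff_sub_eq_sub]
  exact this

end IsContactMap

/-! ### Affine arc length and the absence of flat pieces -/

/-- The affine arc length of a curve, measured from the parameter `0`. -/
def affArc (γ : ℝ → Plane) (s : ℝ) : ℝ := ∫ x in (0 : ℝ)..s, curv γ x ^ (1 / 3 : ℝ)

namespace IsCcwParam

variable {K : Set Plane} {γ : ℝ → Plane} {L : ℝ} (h : IsCcwParam K γ L)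
include h

lemma hasDerivAt_affArc (s : ℝ) : HasDerivAt (affArc γ) (curv γ s ^ (1 / 3 : ℝ)) s := by
  have hc : Continuous fun x => curv γ x ^ (1 / 3 : ℝ) :=
    h.continuous_curv.rpow_const fun _ => Or.inr (by norm_num)
  exact intervalIntegral.integral_hasDerivAt_right (hc.intervalIntegrable _ _)
    (hc.stronglyMeasurableAtFilter _ _) hc.continuousAt

lemma continuous_affArc : Continuous (affArc γ) :=
  continuous_iff_continuousAt.2 fun s => (h.hasDerivAt_affArc s).continuousAt

lemma monotone_affArc : Monotone (affArc γ) :=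
  monotone_of_hasDerivAt_nonneg h.hasDerivAt_affArc fun s =>
    Real.rpow_nonneg (h.curv_nonneg s) _

lemma curv_eq_zero_iff (s : ℝ) : curv γ s ^ (1 / 3 : ℝ) = 0 ↔ curv γ s = 0 :=
  Real.rpow_eq_zero (h.curv_nonneg s) (by norm_num)

lemma affArc_add_int_mul (s : ℝ) (n : ℤ) : affArc γ (s + n * L) = affArc γ s + n * affArc γ L := by
  have h1 (s : ℝ) : affArc γ (s + L) = affArc γ s + affArc γ L := by
    have hd (s : ℝ) : HasDerivAt (fun s => affArc γ (s + L) - affArc γ s) 0 s := by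
      have h1 := (h.hasDerivAt_affArc (s + L)).comp_add_const s L
      have h2 := h.curv_add_int_mul s 1
      rw [Int.cast_one, one_mul] at h2
      convert! h1.sub (h.hasDerivAt_affArc s) using 1
      rw [h2, sub_self]
    have := is_const_of_deriv_eq_zero (fun s => (hd s).differentiableAt)
      (fun s => (hd s).deriv) s 0
    have h0 : affArc γ 0 = 0 := by simp [affArc]
    simp only [zero_add, h0, sub_zero] at this
    linarith
  induction n with
  | zero => simp
  | succ n ih =>
    have := h1 (s + (n : ℤ) * L)
    push_cast at this ih ⊢
    rw [show s + (n + 1) * L = s + n * L + L by ring, this, ih]; ring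
  | pred n ih =>
    have := h1 (s + (-(n : ℤ) - 1 : ℤ) * L)
    push_cast at this ih ⊢
    rw [show s + (-n - 1) * L + L = s + -n * L by ring, ih] at this
    linarith

lemma curv_eq_zero_of_affArc_eq {a b : ℝ} (hab : a < b) (he : affArc γ a = affArc γ b) :
    ∀ s ∈ Icc a b, curv γ s = 0 := by
  have hI : ∀ s ∈ Ioo a b, curv γ s = 0 := by
    intro s hs
    rw [← h.curv_eq_zero_iff]
    refine (h.hasDerivAt_affArc s).unique ?_
    refine (hasDerivAt_const s (affArc γ a)).congr_of_eventuallyEq ?_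
    filter_upwards [Ioo_mem_nhds hs.1 hs.2] with x hx
    exact le_antisymm (he ▸ h.monotone_affArc hx.2.le) (h.monotone_affArc hx.1.le)
  have := closure_minimal (t := {s | curv γ s = 0}) hI
    (isClosed_eq h.continuous_curv continuous_const)
  rwa [closure_Ioo hab.ne] at this

lemma affArc_eq_of_curv {a b : ℝ} (hab : a ≤ b) (h0 : ∀ s ∈ Ioo a b, curv γ s = 0) :
    affArc γ a = affArc γ b := by
  rcases hab.eq_or_lt with rfl | hab
  · rfl
  obtain ⟨c, hc, e⟩ := exists_hasDerivAt_eq_slope (affArc γ) _ hab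
    h.continuous_affArc.continuousOn fun s _ => h.hasDerivAt_affArc s
  rw [(h.curv_eq_zero_iff c).2 (h0 c hc), eq_div_iff (by linarith)] at e
  linarith

/-- The affine arc length determines the points of non-zero curvature. -/
lemma eq_of_affArc_eq {x y : ℝ} (hx : curv γ x ≠ 0) (he : affArc γ y = affArc γ x) : y = x := by
  rcases lt_trichotomy x y with hl | hl | hl
  · exact absurd (h.curv_eq_zero_of_affArc_eq hl he.symm x ⟨le_rfl, hl.le⟩) hx
  · exact hl.symm
  · exact absurd (h.curv_eq_zero_of_affArc_eq hl he x ⟨hl.le, le_rfl⟩) hx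

/-- On an arc of curvature zero the direction of the tangent is constant. -/
lemma det_deriv_eq_zero {a b : ℝ} (hab : a ≤ b) (h0 : ∀ s ∈ Icc a b, curv γ s = 0) :
    det (deriv γ b) (deriv γ a) = 0 := by
  rcases hab.eq_or_lt with rfl | hab
  · exact det_self _
  set u := deriv γ b
  have hpos (s : ℝ) : 0 < ‖deriv γ s‖ ^ 2 := by have := h.param.regular s; positivity
  have hd (s : ℝ) : HasDerivAt (fun s => det u (deriv γ s) ^ 2 / ‖deriv γ s‖ ^ 2)
      (2 * det u (deriv γ s) * inner ℝ u (deriv γ s) * curv γ s / (‖deriv γ s‖ ^ 2) ^ 2) s := by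
    have h1 := hasDerivAt_det (hasDerivAt_const s u) (h.param.hasDerivAt_deriv s)
    have h2 := (h.param.hasDerivAt_deriv s).norm_sq
    convert! (h1.pow 2).div h2 (hpos s).ne' using 1
    rw [norm_sq_eq, inner_eq, inner_eq, curv]
    simp only [det, PiLp.zero_apply, Pi.pow_apply]
    ring
  obtain ⟨c, hc, e⟩ := exists_hasDerivAt_eq_slope _ _ hab
    (continuous_iff_continuousAt.2 fun s => (hd s).continuousAt).continuousOn fun s _ => hd s
  rw [h0 c (Ioo_subset_Icc_self hc), mul_zero, zero_div, eq_div_iff (by linarith), zero_mul,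
    det_self] at e
  have h1 : det u (deriv γ a) ^ 2 / ‖deriv γ a‖ ^ 2 = 0 := by
    simp only [ne_eq, OfNat.ofNat_ne_zero, not_false_eq_true, zero_pow, zero_div] at e
    linarith
  rw [div_eq_zero_iff] at h1
  exact pow_eq_zero_iff (two_ne_zero) |>.1 (h1.resolve_right (hpos a).ne')

/-- The boundary is not flat everywhere, since it does not lie on a line. -/
lemma exists_curv_ne : ∃ x, curv γ x ≠ 0 := by
  by_contra! hcon
  have hd (s : ℝ) : HasDerivAt (fun s => det (deriv γ 0) (γ s)) 0 s := by
    have h1 := hasDerivAt_det (hasDerivAt_const s (deriv γ 0)) (h.param.hasDerivAt s)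
    have h2 : det (deriv γ 0) (deriv γ s) = 0 := by
      rcases le_total s 0 with hs | hs
      · exact h.det_deriv_eq_zero hs fun x _ => hcon x
      · rw [det_swap, h.det_deriv_eq_zero hs fun x _ => hcon x, neg_zero]
    rwa [det_zero_left, zero_add, h2] at h1
  have hc (s : ℝ) : det (deriv γ 0) (γ s - γ 0) = 0 := by
    rw [det_sub_right, sub_eq_zero]
    exact is_const_of_deriv_eq_zero (fun s => (hd s).differentiableAt) (fun s => (hd s).deriv) s 0
  obtain ⟨w, hw⟩ := h.body.interior_nonempty
  have hwf : w ≠ γ 0 := fun e => h.notMem_interior 0 (e ▸ hw)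
  have hpos := h.interior_pos hw 0
  -- the boundary would lie on one line through `γ 0`, but it meets the ray from `w` away from it
  have hne : w + (w - γ 0) ≠ w := by
    intro e; rw [add_eq_left, sub_eq_zero] at e; exact hwf e
  obtain ⟨τ, hτ, hf, -⟩ := h.body.exists_exit hw hne
  rw [← h.param.range_eq] at hf
  obtain ⟨s, hs⟩ := hf
  have := hc s
  rw [hs, add_sub_cancel_left, show w + τ • (w - γ 0) - γ 0 = (1 + τ) • (w - γ 0) by module,
    det_smul_right] at this
  have := mul_pos (by linarith : 0 < 1 + τ) hpos
  linarith

lemma affArc_period_pos : 0 < affArc γ L := by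
  obtain ⟨x, hx⟩ := h.exists_curv_ne
  have hL := h.param.period_pos
  have h1 := h.affArc_add_int_mul x 1
  rw [Int.cast_one, one_mul, one_mul] at h1
  have h2 := h.monotone_affArc (show x ≤ x + L by linarith)
  refine lt_of_le_of_ne (by linarith) fun e => hx ?_
  exact h.curv_eq_zero_of_affArc_eq (show x < x + L by linarith) (by linarith) x
    ⟨le_rfl, by linarith⟩

/-- The endpoints of an arc of curvature zero span a segment in the direction of the tangent. -/
lemma exists_flat_length {a b : ℝ} (hab : a < b) (h0 : ∀ s ∈ Icc a b, curv γ s = 0) :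
    ∃ N : ℝ, 0 < N ∧ γ b - γ a = N • deriv γ b := by
  set u := deriv γ b with hu
  have hu0 : u ≠ 0 := h.param.regular b
  have hpar {s : ℝ} (hs : s ∈ Icc a b) : det u (deriv γ s) = 0 :=
    h.det_deriv_eq_zero hs.2 fun x hx => h0 x ⟨hs.1.trans hx.1, hx.2⟩
  have hγ' := h.param.continuous_deriv
  have hk0 {s : ℝ} (hs : s ∈ Icc a b) : inner ℝ u (deriv γ s) ≠ 0 := by
    obtain ⟨k, hk⟩ := exists_smul_of_det_eq_zero hu0 (hpar hs)
    rw [hk, inner_smul_right, real_inner_self_eq_norm_sq]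
    have : k ≠ 0 := by
      rintro rfl; rw [zero_smul] at hk; exact h.param.regular s hk
    positivity
  have hub : 0 < inner ℝ u (deriv γ b) := by
    rw [← hu, real_inner_self_eq_norm_sq]; positivity
  have hkpos {s : ℝ} (hs : s ∈ Icc a b) : 0 < inner ℝ u (deriv γ s) := by
    by_contra hneg
    obtain ⟨c, hc, e⟩ := intermediate_value_Icc (f := fun s => inner ℝ u (deriv γ s)) hs.2
      (by fun_prop) ⟨not_lt.1 hneg, hub.le⟩
    exact hk0 ⟨hs.1.trans hc.1, hc.2⟩ e
  have hd1 (s : ℝ) : HasDerivAt (fun s => det u (γ s)) (det u (deriv γ s)) s := by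
    simpa using hasDerivAt_det (hasDerivAt_const s u) (h.param.hasDerivAt s)
  have hd2 (s : ℝ) : HasDerivAt (fun s => inner ℝ u (γ s)) (inner ℝ u (deriv γ s)) s := by
    simpa using (hasDerivAt_const s u).inner ℝ (h.param.hasDerivAt s)
  obtain ⟨c, hc, e⟩ := exists_hasDerivAt_eq_slope _ _ hab
    (continuous_iff_continuousAt.2 fun s => (hd1 s).continuousAt).continuousOn fun s _ => hd1 s
  obtain ⟨c', hc', e'⟩ := exists_hasDerivAt_eq_slope _ _ hab
    (continuous_iff_continuousAt.2 fun s => (hd2 s).continuousAt).continuousOn fun s _ => hd2 s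
  have hba : 0 < b - a := by linarith
  have h1 := hkpos (Ioo_subset_Icc_self hc')
  rw [hpar (Ioo_subset_Icc_self hc), eq_div_iff hba.ne', zero_mul, ← det_sub_right] at e
  rw [e', lt_div_iff₀ hba, zero_mul, ← inner_sub_right] at h1
  obtain ⟨N, hN⟩ := exists_smul_of_det_eq_zero hu0 e.symm
  refine ⟨N, ?_, hN⟩
  rw [hN, inner_smul_right, real_inner_self_eq_norm_sq] at h1
  exact pos_of_mul_pos_left h1 (by positivity)

lemma curv_eq_zero_of_line {a b : ℝ} {u p : Plane} (hu : u ≠ 0)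
    (hl : ∀ s ∈ Icc a b, det u (γ s - p) = 0) : ∀ s ∈ Ioo a b, curv γ s = 0 := by
  have h1 : ∀ s ∈ Ioo a b, det u (deriv γ s) = 0 := by
    intro s hs
    have hd := hasDerivAt_det (hasDerivAt_const s u) ((h.param.hasDerivAt s).sub_const p)
    rw [det_zero_left, zero_add] at hd
    refine hd.unique ((hasDerivAt_const s (0 : ℝ)).congr_of_eventuallyEq ?_)
    filter_upwards [Ioo_mem_nhds hs.1 hs.2] with x hx using hl x (Ioo_subset_Icc_self hx)
  intro s hs
  have hd := hasDerivAt_det (hasDerivAt_const s u) (h.param.hasDerivAt_deriv s)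
  rw [det_zero_left, zero_add] at hd
  have h2 : det u (deriv (deriv γ) s) = 0 := by
    refine hd.unique ((hasDerivAt_const s (0 : ℝ)).congr_of_eventuallyEq ?_)
    filter_upwards [Ioo_mem_nhds hs.1 hs.2] with x hx using h1 x hx
  obtain ⟨k, hk⟩ := exists_smul_of_det_eq_zero hu (h1 s hs)
  rw [curv, hk, det_smul_left, h2, mul_zero]

end IsCcwParam

namespace IsContactMap

variable {K : Set Plane} {γ : ℝ → Plane} {L δ μ : ℝ} {α φ : ℝ → ℝ}
  (M : IsContactMap K γ L δ μ α φ)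
include M

/-- The map between the points of contact preserves affine arc length. -/
lemma affArc_map (s : ℝ) : affArc γ (φ s) = affArc γ s + affArc γ (φ 0) := by
  have h := M.family.ccw
  have hd (s : ℝ) : HasDerivAt (fun s => affArc γ (φ s) - affArc γ s) 0 s := by
    obtain ⟨b, hb, -, hφ, hκ, -⟩ := M.hasDerivAt_map s
    have ha := M.family.pos s
    convert! ((h.hasDerivAt_affArc (φ s)).comp s hφ).sub (h.hasDerivAt_affArc s) using 1
    rw [← hκ, Real.mul_rpow (h.curv_nonneg _) (by positivity), ← Real.rpow_natCast,
      ← Real.rpow_mul (by positivity)]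
    norm_num
  have := is_const_of_deriv_eq_zero (fun s => (hd s).differentiableAt)
    (fun s => (hd s).deriv) s 0
  have h0 : affArc γ 0 = 0 := by simp [affArc]
  simp only [h0, sub_zero] at this
  linarith

lemma affArc_iterate (n : ℕ) (s : ℝ) :
    affArc γ (φ^[n] s) = affArc γ s + n * affArc γ (φ 0) := by
  induction n with
  | zero => simp
  | succ n ih =>
    rw [Function.iterate_succ_apply', M.affArc_map, ih]; push_cast; ring

lemma curv_map (s : ℝ) : curv γ (φ s) = 0 ↔ curv γ s = 0 := by
  obtain ⟨b, hb, -, -, hκ, -⟩ := M.hasDerivAt_map s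
  have ha := M.family.pos s
  have : (b / α s) ^ 3 ≠ 0 := by positivity
  rw [← hκ, mul_eq_zero, or_iff_left this]

lemma curv_iterate (n : ℕ) (s : ℝ) : curv γ (φ^[n] s) = 0 ↔ curv γ s = 0 := by
  induction n with
  | zero => simp
  | succ n ih => rw [Function.iterate_succ_apply', M.curv_map, ih]

/-- Where the curvature vanishes somewhere, the rotation that `φ` induces on the affine arc length
is of finite order: otherwise an orbit of `φ` would come close to each point of non-zero
curvature. -/
lemma exists_iterate_period {a : ℝ} (ha : curv γ a = 0) :
    ∃ n : ℕ, 0 < n ∧ ∃ m : ℤ, (n : ℝ) * affArc γ (φ 0) = m * affArc γ L := by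
  have h := M.family.ccw
  set ρ := affArc γ (φ 0)
  set g := affArc γ L with hg
  have hg0 : 0 < g := h.affArc_period_pos
  rcases AddSubgroup.dense_or_cyclic (AddSubgroup.closure {ρ, g}) with hd | ⟨c, hc⟩
  · exfalso
    -- choose an element of the dense group that moves `a` to a point `x` near `x₀` in terms of
    -- affine arc length; affine arc length determines points of non-zero curvature, so `x` is on
    -- the orbit of `a`
    obtain ⟨x₀, hx₀⟩ := h.exists_curv_ne
    have hev : ∀ᶠ x in nhds x₀, curv γ x ≠ 0 :=
      h.continuous_curv.continuousAt.eventually_ne hx₀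
    obtain ⟨ε, hε, hball⟩ := Metric.eventually_nhds_iff_ball.1 hev
    have hlt : affArc γ x₀ < affArc γ (x₀ + ε / 2) := by
      refine lt_of_le_of_ne (h.monotone_affArc (by linarith)) fun e => hx₀ ?_
      exact h.curv_eq_zero_of_affArc_eq (by linarith) e x₀ ⟨le_rfl, by linarith⟩
    obtain ⟨z, hz, hz1, hz2⟩ := hd.exists_between
      (sub_lt_sub_right hlt (affArc γ a))
    obtain ⟨k, m, rfl⟩ := AddSubgroup.mem_closure_pair.1 hz
    obtain ⟨x, hx, e⟩ := intermediate_value_Icc (show x₀ ≤ x₀ + ε / 2 by linarith)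
      h.continuous_affArc.continuousOn
      (show affArc γ a + (k • ρ + m • g) ∈ _ from ⟨by linarith, by linarith⟩)
    have hxne : curv γ x ≠ 0 := by
      refine hball x ?_
      rw [Metric.mem_ball, Real.dist_eq, abs_of_nonneg (by linarith [hx.1])]
      linarith [hx.2]
    rw [zsmul_eq_mul, zsmul_eq_mul] at e
    obtain ⟨n, rfl | rfl⟩ := k.eq_nat_or_neg
    · have := h.eq_of_affArc_eq hxne (y := φ^[n] a + m * L) (by
        rw [h.affArc_add_int_mul, M.affArc_iterate, e]; push_cast; ring)
      rw [← this, h.curv_add_int_mul, Ne, M.curv_iterate] at hxne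
      exact hxne ha
    · have hxn : curv γ (φ^[n] x) ≠ 0 := fun e0 => hxne ((M.curv_iterate n x).1 e0)
      have := h.eq_of_affArc_eq hxn (y := a + m * L) (by
        rw [h.affArc_add_int_mul, M.affArc_iterate, e]; push_cast; ring)
      rw [← this, h.curv_add_int_mul] at hxn
      exact hxn ha
  -- both `ρ` and `g` are multiples of the generator `c`
  · have h1 : ρ ∈ AddSubgroup.closure {ρ, g} := AddSubgroup.subset_closure (by simp)
    have h2 : g ∈ AddSubgroup.closure {ρ, g} := AddSubgroup.subset_closure (by simp)
    rw [hc, AddSubgroup.mem_closure_singleton] at h1 h2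
    obtain ⟨i, hi⟩ := h1
    obtain ⟨j, hj⟩ := h2
    rw [zsmul_eq_mul] at hi hj
    have hj0 : j ≠ 0 := by rintro rfl; simp at hj; linarith
    refine ⟨j.natAbs, Int.natAbs_pos.2 hj0, j.sign * i, ?_⟩
    have e : ((j.natAbs : ℕ) : ℝ) = (j.sign : ℝ) * j := by
      rw [← Int.cast_mul, Int.sign_mul_self_eq_natAbs]; simp
    rw [e, ← hi, ← hj]; push_cast; ring

/-- Near limits of points of non-zero curvature an iterate of `φ` of finite order is a
translation. -/
lemma iterate_eq_of_frequently {n : ℕ} {m : ℤ}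
    (hnm : (n : ℝ) * affArc γ (φ 0) = m * affArc γ L) {c : ℝ}
    (hc : ∃ᶠ x in nhdsWithin c {c}ᶜ, curv γ x ≠ 0) :
    φ^[n] c = c + m * L ∧ ∀ D, HasDerivAt φ^[n] D c → D = 1 := by
  have h := M.family.ccw
  have hx {x : ℝ} (hx : curv γ x ≠ 0) : φ^[n] x = x + m * L := by
    apply h.eq_of_affArc_eq (by rwa [h.curv_add_int_mul])
    rw [M.affArc_iterate, h.affArc_add_int_mul, hnm]
  have hcl : IsClosed {x | φ^[n] x = x + m * L} :=
    isClosed_eq (M.continuous.iterate n) (by fun_prop)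
  have h1 : φ^[n] c = c + m * L :=
    hcl.mem_of_frequently_of_tendsto ((hc.filter_mono nhdsWithin_le_nhds).mono fun x => hx)
      Filter.tendsto_id
  refine ⟨h1, fun D hD => ?_⟩
  have h2 := hasDerivAt_iff_tendsto_slope.1 hD
  refine isClosed_singleton.mem_of_frequently_of_tendsto (s := {(1 : ℝ)}) ?_ h2
  refine (hc.and_eventually self_mem_nhdsWithin).mono fun x hxc => ?_
  have : x - c ≠ 0 := sub_ne_zero.2 hxc.2
  rw [mem_singleton_iff, slope_def_field, hx hxc.1, h1, add_sub_add_right_eq_sub, div_self this]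

/-- If `γ a` lies on the tangent at `γ b`, then the map `φ` distorts the segment between these
points by a factor that is smaller than the derivative of `φ` at `b`. -/
lemma flat_step {a b N : ℝ} (hN : 0 < N) (he : γ b - γ a = N • deriv γ b) :
    ∃ N' D : ℝ, 0 < N' ∧ 0 < D ∧ HasDerivAt φ D b ∧
      γ (φ b) - γ (φ a) = N' • deriv γ (φ b) ∧ N' < D * N := by
  have h := M.family.ccw
  obtain ⟨β, hβ, eβ, hφ, -, -⟩ := M.hasDerivAt_map b
  have hα := M.family.pos b
  set q := apex γ α b with hq
  have eb : γ b - q = -(α b • deriv γ b) := by rw [hq, apex]; abel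
  have ea : γ a - q = ((N + α b) / α b) • (γ b - q) := by
    rw [show γ a - q = (γ b - q) - (γ b - γ a) by abel, he, eb]
    match_scalars
    field_simp; ring
  have hr : IsFirstContact K q (γ a) := by
    refine ⟨h.mem a, fun w hw => ?_⟩
    rw [ea, det_smul_right]
    exact mul_nonneg (by positivity) ((M.family.first b).2 w hw)
  have hqa : q = apex γ α a := M.family.eq_apex (M.family.area b) hr
  have hla := M.last a
  have hma := M.area a
  rw [← hqa] at hla hma
  have hlb := M.last b
  have hmb := M.area b
  rw [← hq] at hlb hmb
  have hcol : det (γ (φ b) - q) (γ (φ a) - q) = 0 := by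
    have h1 := hla.2 _ hlb.1
    have h2 := hlb.2 _ hla.1
    exact le_antisymm (by rw [det_swap]; linarith) h2
  have hne : γ (φ b) - q ≠ 0 := by
    intro e
    have := (M.pair b).det_pos
    rw [← hq, e, det_zero_left] at this
    exact lt_irrefl _ this
  obtain ⟨k, hk⟩ := exists_smul_of_det_eq_zero hne hcol
  have hkv : k * ((N + α b) / α b) = 1 := by
    rw [hk, ea, det_smul_left, det_smul_right, hmb] at hma
    have hμ : 6 * μ ≠ 0 := by have := M.mu_pos; positivity
    exact mul_right_cancel₀ hμ (by linarith)
  have hk' : k = α b / (N + α b) := by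
    field_simp at hkv ⊢; linarith
  have eβ' : γ (φ b) - q = β • deriv γ (φ b) := by rw [eβ]; abel
  refine ⟨N / (N + α b) * β, β / α b, by positivity, by positivity, hφ, ?_, ?_⟩
  · rw [show γ (φ b) - γ (φ a) = (γ (φ b) - q) - (γ (φ a) - q) by abel, hk, eβ', hk']
    match_scalars
    field_simp; ring
  · rw [div_mul_eq_mul_div, div_mul_eq_mul_div, div_lt_div_iff₀ (by positivity) hα]
    have := mul_pos (mul_pos hN hβ) hN
    linarith

/-- The comparison of `flat_step` for the iterates of `φ`, by the chain rule. -/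
lemma flat_iterate {a b N : ℝ} (hN : 0 < N) (he : γ b - γ a = N • deriv γ b) (n : ℕ) :
    ∃ N' D : ℝ, 0 < N' ∧ 0 < D ∧ HasDerivAt φ^[n + 1] D b ∧
      γ (φ^[n + 1] b) - γ (φ^[n + 1] a) = N' • deriv γ (φ^[n + 1] b) ∧ N' < D * N := by
  induction n with
  | zero => simpa using M.flat_step hN he
  | succ n ih =>
    obtain ⟨N₁, D₁, hN₁, hD₁, hd₁, e₁, hlt₁⟩ := ih
    obtain ⟨N₂, D₂, hN₂, hD₂, hd₂, e₂, hlt₂⟩ := M.flat_step hN₁ e₁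
    refine ⟨N₂, D₂ * D₁, hN₂, by positivity, ?_, ?_, ?_⟩
    · rw [Function.iterate_succ']
      exact hd₂.comp b hd₁
    · rw [Function.iterate_succ_apply', Function.iterate_succ_apply' φ (n + 1)]
      exact e₂
    · rw [mul_assoc]
      exact hlt₂.trans (mul_lt_mul_of_pos_left hlt₁ hD₂)

/-- The boundary has no flat pieces. A maximal flat piece would be mapped to itself by an iterate of
`φ`, up to a period; the derivative of the iterate at an endpoint is `1`, since the iterate is a
translation on the adjacent curved arcs, but it has to exceed the factor `1` by which the piece is
stretched. -/
lemma no_flat {a₀ b₀ : ℝ} (hab₀ : a₀ < b₀) (h0 : ∀ s ∈ Icc a₀ b₀, curv γ s = 0) : False := by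
  have h := M.family.ccw
  have hL := h.param.period_pos
  have hg := h.affArc_period_pos
  obtain ⟨n, hn, m, hnm⟩ := M.exists_iterate_period (h0 a₀ ⟨le_rfl, hab₀.le⟩)
  -- the level set of the affine arc length is the maximal parameter interval `[a, b]` of a flat
  -- piece
  set F := {s | affArc γ s = affArc γ a₀} with hF
  have hFc : IsClosed F := isClosed_eq h.continuous_affArc continuous_const
  have ha₀ : a₀ ∈ F := rfl
  have hb₀ : b₀ ∈ F :=
    (h.affArc_eq_of_curv hab₀.le fun s hs => h0 s (Ioo_subset_Icc_self hs)).symm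
  have hper (k : ℤ) := h.affArc_add_int_mul a₀ k
  have hbA : BddAbove F := by
    refine ⟨a₀ + (1 : ℤ) * L, fun s hs => ?_⟩
    by_contra hlt
    have h1 := h.monotone_affArc (not_le.1 hlt).le
    rw [hper, show affArc γ s = affArc γ a₀ from hs] at h1
    push_cast at h1; linarith
  have hbB : BddBelow F := by
    refine ⟨a₀ + (-1 : ℤ) * L, fun s hs => ?_⟩
    by_contra hlt
    have h1 := h.monotone_affArc (not_le.1 hlt).le
    rw [hper, show affArc γ s = affArc γ a₀ from hs] at h1
    push_cast at h1; linarith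
  have haF := hFc.csInf_mem ⟨a₀, ha₀⟩ hbB
  have hbF := hFc.csSup_mem ⟨a₀, ha₀⟩ hbA
  have hab : sInf F < sSup F :=
    (csInf_le hbB ha₀).trans_lt (hab₀.trans_le (le_csSup hbA hb₀))
  have hlow (x : ℝ) (hx : x < sInf F) : x ∉ F := fun hxF => not_le.2 hx (csInf_le hbB hxF)
  have hhigh (x : ℝ) (hx : sSup F < x) : x ∉ F := fun hxF => not_le.2 hx (le_csSup hbA hxF)
  set a := sInf F
  set b := sSup F
  have hfa : ∃ᶠ x in nhdsWithin a {a}ᶜ, curv γ x ≠ 0 := by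
    refine Filter.Frequently.filter_mono (f := nhdsWithin a (Iio a)) ?_
      (nhdsWithin_mono _ fun x hx => ne_of_lt hx)
    intro hev
    simp only [not_not] at hev
    obtain ⟨x, hx, hxI⟩ := (mem_nhdsLT_iff_exists_Ioo_subset).1 hev
    refine hlow x hx ?_
    exact (h.affArc_eq_of_curv (le_of_lt hx) fun s hs => hxI hs).trans haF
  have hfb : ∃ᶠ x in nhdsWithin b {b}ᶜ, curv γ x ≠ 0 := by
    refine Filter.Frequently.filter_mono (f := nhdsWithin b (Ioi b)) ?_
      (nhdsWithin_mono _ fun x hx => ne_of_gt hx)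
    intro hev
    simp only [not_not] at hev
    obtain ⟨x, hx, hxI⟩ := (mem_nhdsGT_iff_exists_Ioo_subset).1 hev
    refine hhigh x hx ?_
    exact (h.affArc_eq_of_curv (le_of_lt hx) fun s hs => hxI hs).symm.trans hbF
  obtain ⟨ea, -⟩ := M.iterate_eq_of_frequently hnm hfa
  obtain ⟨eb, hD1⟩ := M.iterate_eq_of_frequently hnm hfb
  obtain ⟨N, hN, hNe⟩ := h.exists_flat_length hab
    (h.curv_eq_zero_of_affArc_eq hab (haF.trans hbF.symm))
  obtain ⟨k, rfl⟩ : ∃ k, n = k + 1 := ⟨n - 1, by omega⟩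
  obtain ⟨N', D, -, -, hd, e, hlt⟩ := M.flat_iterate hN hNe k
  -- the iterate maps the piece to itself, so its stretched length `N'` is `N`
  rw [ea, eb, h.param.add_int_mul, h.param.add_int_mul, h.param.deriv_add_int_mul, hNe] at e
  rw [hD1 D hd, one_mul] at hlt
  exact hlt.ne' (smul_left_injective ℝ (h.param.regular b) e)

/-- All triangles formed by a point of the curve of illumination and its points of contact have
the same area. -/
lemma det_contactPair {q x y : Plane} (hq : volume.real (hull K q) = volume.real K + δ)
    (C : IsContactPair K q x y) : det (y - q) (x - q) = 6 * μ := by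
  have h := M.family.ccw
  obtain ⟨s, -, rfl⟩ := h.exists_eq_of_first C.notMem C.first 0
  obtain rfl := M.family.eq_apex hq C.first
  obtain ⟨t, -, rfl⟩ := h.exists_eq_of_last C.notMem C.last 0
  by_cases hne : γ (φ s) = γ t
  · rw [← hne]; exact M.area s
  exfalso
  have hl := M.last s
  obtain ⟨t', ht', e'⟩ := h.param.exists_param (h.param.mem_frontier (φ s)) t
  rw [← e'] at hne hl
  have htt : t < t' := lt_of_le_of_ne ht'.1 fun e => hne (by rw [e])
  -- both points of contact lie on the same tangent
  obtain ⟨b, hb, eb⟩ := (h.last_iff C.notMem).1 C.last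
  have hcol : det (γ t - apex γ α s) (γ t' - apex γ α s) = 0 := by
    have h1 := C.last.2 _ hl.1
    have h2 := hl.2 _ C.last.1
    exact le_antisymm (by rw [det_swap]; linarith) h1
  have hbt : γ t - apex γ α s = b • deriv γ t := by rw [eb]; abel
  have h0 : det (deriv γ t) (γ t' - γ t) = 0 := by
    rw [hbt, det_smul_left, mul_eq_zero, or_iff_right hb.ne'] at hcol
    rw [show γ t' - γ t = (γ t' - apex γ α s) - (γ t - apex γ α s) by abel, det_sub_right, hcol,
      hbt, det_smul_right, det_self, mul_zero, sub_zero]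
  -- a second point of contact on the same tangent would make an arc of the boundary flat
  have hseg := h.segment_subset_frontier (h.mem t') h0
  have hu : γ t' - γ t ≠ 0 := sub_ne_zero.2 hne
  have hline {σ : ℝ} (hσ : γ σ ∈ segment ℝ (γ t) (γ t')) :
      det (γ t' - γ t) (γ σ - γ t) = 0 := by
    rw [segment_eq_image'] at hσ
    obtain ⟨r, -, e⟩ := hσ
    rw [← e, add_sub_cancel_left, det_smul_right, det_self, mul_zero]
  have hend {a b : ℝ} (hab : a < b) (hI : ∀ σ ∈ Icc a b, γ σ ∈ segment ℝ (γ t) (γ t')) : False := by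
    have h1 := h.curv_eq_zero_of_line hu fun σ hσ => hline (hI σ hσ)
    refine M.no_flat (a₀ := (3 * a + b) / 4) (b₀ := (a + 3 * b) / 4) (by linarith) fun σ hσ =>
      h1 σ ⟨by linarith [hσ.1], by linarith [hσ.2]⟩
  rcases h.param.flat_arc htt ht'.2 hseg with hI | hI
  · exact hend htt hI
  · exact hend ht'.2 hI

end IsContactMap

/-! ### Illumination: homothety and constant affine distance -/

/-- In each direction there is a point of the curve of illumination that lies strictly further out
than the centroid of its silhouette cone. -/
lemma IsApexFamily.exists_det_centroid_lt {K : Set Plane} {γ : ℝ → Plane} {L δ : ℝ} {α : ℝ → ℝ}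
    (A : IsApexFamily K γ L δ α) {v : Plane} (hv : v ≠ 0) :
    ∃ s, (∀ s', det v (apex γ α s') ≤ det v (apex γ α s)) ∧
      det v (centroid (silhouetteCone K (apex γ α s))) < det v (apex γ α s) := by
  have h := A.ccw
  have hp := A.continuous_apex
  obtain ⟨s, hs, hmax⟩ := (isCompact_Icc (a := (0 : ℝ)) (b := 0 + L)).exists_isMaxOn
    ⟨0, by simp [h.param.period_pos.le]⟩
    (show ContinuousOn (fun s => det v (apex γ α s)) _ by fun_prop)
  have hmax' (s' : ℝ) : det v (apex γ α s') ≤ det v (apex γ α s) := by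
    obtain ⟨t, ht, e⟩ := A.apex_periodic.exists_mem_Ico h.param.period_pos s' 0
    rw [e]; exact hmax (Ico_subset_Icc_self ht)
  refine ⟨s, hmax', ?_⟩
  obtain ⟨x, hx, hxm⟩ := h.body.isCompact.exists_isMaxOn
    (h.body.interior_nonempty.mono interior_subset) (f := fun w => det v w) (by fun_prop)
  have hxm' (w : Plane) (hw : w ∈ K) : 0 ≤ det (-v) (w - x) := by
    have := isMaxOn_iff.1 hxm w hw
    rw [det_neg_left, det_sub_right]; linarith
  -- the tangent at the extreme point of `K` meets the curve of illumination at the same height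
  have hK : ∀ w ∈ K, det v w ≤ det v (apex γ α s) := by
    obtain ⟨t, -, rfl⟩ := h.param.exists_param
      (h.body.mem_frontier_of_det (neg_ne_zero.2 hv) hx hxm') 0
    have h0 := h.support_unique hxm'
    rw [det_neg_left, neg_eq_zero] at h0
    have h1 := hmax' t
    rw [apex, det_add_right, det_smul_right, h0, mul_zero, add_zero] at h1
    exact fun w hw => (isMaxOn_iff.1 hxm w hw).trans h1
  have hhull : ∀ w ∈ hull K (apex γ α s), det v w ≤ det v (apex γ α s) := by
    intro w hw
    obtain ⟨k, hk, r, hr, rfl⟩ := h.body.mem_hull_iff.1 hw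
    rw [det_add_right, det_smul_right, det_sub_right]
    nlinarith [hK k hk, hr.1]
  have hvol : 0 < volume.real (silhouetteCone K (apex γ α s)) := by
    have := (h.body.mem_illuminationCurve_iff A.area_pos).2 (A.area s)
    rw [illuminationCurve, mem_ofPred_eq] at this
    change volume (silhouetteCone K (apex γ α s)) = ENNReal.ofReal δ at this
    rw [Measure.real, this, ENNReal.toReal_ofReal A.area_pos.le]
    exact A.area_pos
  have := lt_det_centroid (h.body.hull (apex γ α s)).isCompact
    (D := silhouetteCone K (apex γ α s)) sdiff_subset
    ((h.body.hull _).isClosed.measurableSet.diff h.body.isClosed.measurableSet) hvol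
    (neg_ne_zero.2 hv) (m := -det v (apex γ α s)) (fun w hw => by
      rw [det_neg_left]; linarith [hhull w hw.1])
  rw [det_neg_left] at this
  linarith

/-- The part of the result on illumination, for counterclockwise parametrizations. -/
theorem IsCcwParam.illumination {K : Set Plane} {γ : ℝ → Plane} {L : ℝ} (h : IsCcwParam K γ L)
    {δ lam : ℝ} (hδ : 0 < δ) :
    (0 < lam ∧ lam < 1 ∧
      IsHomothetic (illuminationCurve K δ) (illuminationCentroidCurve K δ) lam) ↔
    ∀ p ∈ illuminationCurve K δ, ∀ s t : ℝ, IsContactChord γ p s t →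
      affineDist (γ s) (deriv γ s) (γ t) (deriv γ t) ^ 3 = 24 * δ * lam := by
  obtain ⟨α, A⟩ := h.exists_apexFamily hδ
  constructor
  · rintro ⟨h0, -, hom⟩ p hp s t hst
    have hμ : 0 < δ * lam := mul_pos hδ h0
    have hM (s s' : ℝ) := h.moment_of_homothetic hδ h0 hom (A.area s) (A.area s')
    obtain ⟨φ, M⟩ := A.exists_contactMap hμ (A.exists_area hμ hM)
    rw [h.body.mem_illuminationCurve_iff hδ] at hp
    have hpK := h.body.notMem_of_mem_illuminationCurve hδ hp
    have C := (h.isContactChord_iff hpK).1 hst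
    rw [h.affineDist_contact C, M.det_contactPair hp C]
    ring
  · intro hall
    have harea (s : ℝ) : ∃ y, IsLastContact K (apex γ α s) y ∧
        det (y - apex γ α s) (γ s - apex γ α s) = 6 * (δ * lam) := by
      obtain ⟨y, C⟩ := A.exists_pair s
      obtain ⟨t, -, rfl⟩ := h.exists_eq_of_last C.notMem C.last 0
      refine ⟨γ t, C.last, ?_⟩
      have := hall _ ((h.body.mem_illuminationCurve_iff hδ).2 (A.area s)) s t
        ((h.isContactChord_iff C.notMem).2 C)
      rw [h.affineDist_contact C] at this
      linarith
    have hμ : 0 < δ * lam := by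
      obtain ⟨y, hy, e⟩ := harea 0
      have := (A.pair hy).det_pos
      linarith
    have hlam : 0 < lam := pos_of_mul_pos_right hμ hδ.le
    obtain ⟨φ, M⟩ := A.exists_contactMap hμ harea
    obtain ⟨k, hk⟩ : ∃ k, ∀ s,
        centroid (silhouetteCone K (apex γ α s)) = lam • apex γ α s + k := by
      refine ⟨centroid (silhouetteCone K (apex γ α 0)) - lam • apex γ α 0, fun s => ?_⟩
      have e := M.moment_sub 0 s
      rw [sub_eq_iff_eq_add] at e
      have hs := A.area s
      have h0 := A.area 0
      change volume.real (hull K (apex γ α s)) = _ at hs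
      change volume.real (hull K (apex γ α 0)) = _ at h0
      rw [h.body.centroid_silhouetteCone hs, h.body.centroid_silhouetteCone h0, e]
      match_scalars <;> field_simp
    -- compare the extreme points of both curves in two opposite directions
    have hlam1 : lam < 1 := by
      have hv := h.param.regular 0
      obtain ⟨s, hs, hs'⟩ := A.exists_det_centroid_lt hv
      obtain ⟨t, -, ht'⟩ := A.exists_det_centroid_lt (neg_ne_zero.2 hv)
      have hst := hs t
      rw [hk, det_add_right, det_smul_right] at hs' ht'
      simp only [det_neg_left] at ht'
      by_contra hcon
      nlinarith
    refine ⟨hlam, hlam1, (1 - lam)⁻¹ • k, ?_⟩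
    rw [illuminationCentroidCurve, A.illuminationCurve_eq, ← range_comp, ← range_comp]
    congr 1
    ext1 s
    have : 1 - lam ≠ 0 := by linarith
    simp only [Function.comp, AffineMap.homothety_apply, vsub_eq_sub, vadd_eq_add, hk]
    match_scalars
    · ring
    · field_simp; ring

/-! ### Reversal of the parametrization -/

lemma deriv_reverse (γ : ℝ → Plane) (s : ℝ) : deriv (fun s => γ (-s)) s = -deriv γ (-s) :=
  deriv_comp_neg γ s

/-- Reversal makes a clockwise parametrization counterclockwise. -/
lemma IsC2BoundaryParam.reverse {K : Set Plane} {γ : ℝ → Plane} {L : ℝ}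
    (hγ : IsC2BoundaryParam K γ L) : IsC2BoundaryParam K (fun s => γ (-s)) L where
  contDiff := hγ.contDiff.comp contDiff_neg
  period_pos := hγ.period_pos
  periodic := fun s => by
    have := hγ.periodic (-(s + L))
    beta_reduce
    rw [← this]; congr 1; ring
  regular := fun s => by
    rw [deriv_reverse]; exact neg_ne_zero.2 (hγ.regular _)
  simple := by
    intro s hs t ht e
    have e' : γ (L - s) = γ (L - t) := by
      rw [sub_eq_neg_add, sub_eq_neg_add, hγ.periodic, hγ.periodic]; exact e
    rcases hs.1.eq_or_lt with rfl | h1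
    · rcases ht.1.eq_or_lt with rfl | h2
      · rfl
      · have := hγ.simple ⟨le_rfl, hγ.period_pos⟩ (⟨by linarith [ht.2], by linarith⟩ :
          L - t ∈ Ico 0 L) (by rw [← e', sub_zero]; simpa using (hγ.periodic 0).symm)
        linarith [ht.2]
    · rcases ht.1.eq_or_lt with rfl | h2
      · have := hγ.simple ⟨le_rfl, hγ.period_pos⟩ (⟨by linarith [hs.2], by linarith⟩ :
          L - s ∈ Ico 0 L) (by rw [e', sub_zero]; simpa using (hγ.periodic 0).symm)
        linarith [hs.2]
      · have := hγ.simple (⟨by linarith [hs.2], by linarith⟩ : L - s ∈ Ico 0 L)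
          (⟨by linarith [ht.2], by linarith⟩ : L - t ∈ Ico 0 L) e'
        linarith
  range_eq := by
    rw [← hγ.range_eq]
    exact (Equiv.neg ℝ).surjective.range_comp γ

lemma affineDist_neg (x x' y y' : Plane) : affineDist x (-x') y (-y') = affineDist x x' y y' := by
  simp only [affineDist, triangleArea, det_neg_left, det_neg_right, neg_mul_neg, neg_neg]

lemma isContactChord_reverse (γ : ℝ → Plane) (p : Plane) (s t : ℝ) :
    IsContactChord (fun s => γ (-s)) p s t ↔ IsContactChord γ p (-s) (-t) := by
  simp only [IsContactChord, deriv_reverse, det_neg_right, neg_eq_zero]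

end Flotation

end

theorem mainTheorem3 (K : Set Flotation.Plane) (hK : Flotation.IsConvexBody K)
    (γ : ℝ → Flotation.Plane) (L : ℝ) (hγ : Flotation.IsC2BoundaryParam K γ L) :
    (∀ δ lam : ℝ, 0 < δ → δ ≤ volume.real K / 2 →
      ((1 < lam ∧ Flotation.IsHomothetic (Flotation.flotationCurve K δ)
          (Flotation.buoyancyCurve K δ) lam) ↔
        ∀ s t : ℝ, Flotation.IsFlotationChord K δ (γ s) (γ t) →
          Flotation.det (deriv γ s) (deriv γ t) ≠ 0 ∧
          Flotation.affineDist (γ s) (deriv γ s) (γ t) (deriv γ t) ^ 3 = 12 * δ * lam)) ∧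
    (∀ δ lam : ℝ, 0 < δ →
      ((0 < lam ∧ lam < 1 ∧ Flotation.IsHomothetic (Flotation.illuminationCurve K δ)
          (Flotation.illuminationCentroidCurve K δ) lam) ↔
        ∀ p ∈ Flotation.illuminationCurve K δ, ∀ s t : ℝ, Flotation.IsContactChord γ p s t →
          Flotation.affineDist (γ s) (deriv γ s) (γ t) (deriv γ t) ^ 3 = 24 * δ * lam)) := by
  rcases hγ.ccw_or_cw hK with hccw | hcw
  · have h : Flotation.IsCcwParam K γ L := ⟨hK, hγ, hccw⟩
    exact ⟨fun δ lam h0 h1 => h.flotation h0 h1, fun δ lam h0 => h.illumination h0⟩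
  · have h : Flotation.IsCcwParam K (fun s => γ (-s)) L :=
      ⟨hK, hγ.reverse, fun s w hw => by
        rw [Flotation.deriv_reverse, Flotation.det_neg_left]
        linarith [hcw (-s) w hw]⟩
    constructor
    · intro δ lam h0 h1
      rw [h.flotation h0 h1]
      simp only [Flotation.deriv_reverse, Flotation.affineDist_neg, Flotation.det_neg_left,
        Flotation.det_neg_right, neg_neg]
      exact ⟨fun H s t => by simpa only [neg_neg] using H (-s) (-t), fun H s t => H (-s) (-t)⟩
    · intro δ lam h0
      rw [h.illumination h0]
      simp only [Flotation.deriv_reverse, Flotation.affineDist_neg,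
        Flotation.isContactChord_reverse]
      exact ⟨fun H p hp s t => by simpa only [neg_neg] using H p hp (-s) (-t),
        fun H p hp s t => H p hp (-s) (-t)⟩
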